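/- Let $\Omega\subset\mathbb R^2$ be a bounded domain with polygonal boundary and let $n\neq 1$ be a real constant. All functions are complex valued; $H^2_0(\Omega)\times H^1_0(\Omega)$ carries the product norm $\|(\cdot,\cdot)\|$. Put $$a((u,\phi),(v,\psi))=\tfrac1{n-1}\int_\Omega D^2u:D^2\bar v+\int_\Omega\nabla\phi\cdot\nabla\bar\psi,$$ $$b((u,\phi),(v,\psi))=\tfrac n{n-1}\int_\Omega\Delta u\,\bar v+\tfrac1{n-1}\int_\Omega u\,\Delta\bar v-\int_\Omega\nabla\phi\cdot\nabla\bar v+\tfrac n{n-1}\int_\Omega u\,\bar\psi ,$$ and let $T(f,g)=(\tilde u,\tilde\phi)\in H_0^2(\Omega)\times H_0^1(\Omega)$ be the solution of $a((\tilde u,\tilde\phi),(v,\psi))=b((f,g),(v,\psi))$ for all $(v,\psi)\in H_0^2(\Omega)\times H_0^1(\Omega)$. Let $\mathcal T_h$ be a decomposition of $\Omega$ into finitely many open simple polygons $K$ of diameter $h_K$, $h=\max_K h_K$, such that for a constant $C_{\mathcal T}>0$ each edge of $K$ is longer than $C_{\mathcal T}h_K$ and $K$ is star-shaped with respect to every point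 of a ball of radius $C_{\mathcal T}h_K$. For functions on $K$ let $a^\Delta_K(u,v)=\int_KD^2u:D^2\bar v$ and $a^\nabla_K(\phi,\psi)=\int_K\nabla\phi\cdot\nabla\bar\psi$. Define projectors as follows. * $\Pi_2^\Delta:H^2(K)\to\mathbb P_2(K)$: $a_K^\Delta(\Pi_2^\Delta v,q)=a_K^\Delta(v,q)$ for $q\in\mathbb P_2(K)$, and $\sum_i(\Pi_2^\Delta v)(P_i)q(P_i)=\sum_iv(P_i)q(P_i)$ for $q\in\mathbb P_1(K)$, where the $P_i$ are the vertices of $K$. * $\Pi_1^\nabla:H^1(K)\to\mathbb P_1(K)$: $a_K^\nabla(\Pi_1^\nabla\psi,q)=a_K^\nabla(\psi,q)$ for $q\in\mathbb P_1(K)$, and $\int_{\partial K}\Pi_1^\nabla\psi=\int_{\partial K}\psi$. * $\Pi_2^\nabla:H^2(K)\to\mathbb P_2(K)$: $a_K^\nabla(\Pi_2^\nabla w,q)=a_K^\nabla(w,q)$ for $q\in\mathbb P_2(K)$, and $\int_K\Pi_2^\nabla w=\int_Kw$. * $\Pi^0_l$: the $L^2(K)$-orthogonal projector onto $\mathbb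 P_l(K)$. Let $W_h^K$ be the space of $v\in H^2(K)$ such that $\Delta^2v\in\mathbb P_2(K)$; $v$ and $\nabla v$ are continuous on $\partial K$; $v|_e\in\mathbb P_3(e)$ and $\partial_\nu v|_e\in\mathbb P_1(e)$ for each edge $e$; and $\int_K(\Pi_2^\Delta v)q=\int_Kvq$ for all $q\in\mathbb P_2(K)$. Let $V_h^K$ be the space of $\psi\in H^1(K)$ such that $\Delta\psi\in\mathbb P_1(K)$; $\psi$ is continuous on $\partial K$; $\psi|_e\in\mathbb P_1(e)$ for each edge $e$; and $\int_K(\Pi_1^\nabla\psi)q=\int_K\psi q$ for all $q\in\mathbb P_1(K)$. Put $W_h=\{v\in H_0^2(\Omega):v|_K\in W_h^K\ \forall K\}$, $V_h=\{\psi\in H_0^1(\Omega):\psi|_K\in V_h^K\ \forall K\}$ and $Z_h=W_h\times V_h$. Let $s_K^\Delta$ on $W_h^K$ and $s_K^\nabla$ on $V_h^K$ be Hermitian positive definite forms with $$c_0a_K^\Delta(v,v)\le s_K^\Delta(v,v)\le c_1a_K^\Delta(v,v)\ \text{ if } \Pi_2^\Delta v=0,\qquad c_2a_K^\nabla(\psi,\psi)\le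 s_K^\nabla(\psi,\psi)\le c_3a_K^\nabla(\psi,\psi)\ \text{ if } \Pi_1^\nabla\psi=0,$$ with constants $c_0,\dots,c_3>0$. Put $$a_h((u,\phi),(v,\psi))=\sum_K\Big\{\tfrac1{n-1}\big[a_K^\Delta(\Pi_2^\Delta u,\Pi_2^\Delta v)+s_K^\Delta(u-\Pi_2^\Delta u,v-\Pi_2^\Delta v)\big]+a_K^\nabla(\Pi_1^\nabla\phi,\Pi_1^\nabla\psi)+s_K^\nabla(\phi-\Pi_1^\nabla\phi,\psi-\Pi_1^\nabla\psi)\Big\},$$ $$b_h((u,\phi),(v,\psi))=\sum_K\Big\{\tfrac n{n-1}\int_K\Pi_2^0(\Delta u)\,\overline{\Pi_2^0v}+\tfrac1{n-1}\int_K\Pi_2^0u\,\overline{\Pi_2^0(\Delta v)}-\int_K\nabla\Pi_1^\nabla\phi\cdot\nabla\overline{\Pi_2^\nabla v}+\tfrac n{n-1}\int_K\Pi_2^0u\,\overline{\Pi_1^0\psi}\Big\},$$ and let $T_h(f,g)=(\tilde u_h,\tilde\phi_h)\in Z_h$ be the solution of $a_h((\tilde u_h,\tilde\phi_h),(v_h,\psi_h))=b_h((f,g),(v_h,\psi_h))$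 for all $(v_h,\psi_h)\in Z_h$. **Lemma.** There is a constant $C>0$, depending only on $\Omega$, $n$, $C_{\mathcal T}$ and $c_0,\dots,c_3$ (in particular not on $h$ or the mesh), such that for all $(f,g)\in H^2_0(\Omega)\times H^1_0(\Omega)$, with $(\tilde u,\tilde\phi)=T(f,g)$, $$\|(T-T_h)(f,g)\|\le C\Big(h\|(f,g)\|+|\tilde u-\tilde u_I|_{2,\Omega}+|\tilde u-\tilde u_\pi|_{2,h}+|\tilde\phi-\tilde\phi_I|_{1,\Omega}+|\tilde\phi-\tilde\phi_\pi|_{1,h}\Big)$$ for all $(\tilde u_I,\tilde\phi_I)\in Z_h$ and all $(\tilde u_\pi,\tilde\phi_\pi)\in L^2(\Omega)^2$ with $(\tilde u_\pi,\tilde\phi_\pi)|_K\in\mathbb P_2(K)\times\mathbb P_1(K)$ for every $K$, where $|v|_{2,h}^2=\sum_K|v|_{2,K}^2$ and $|\psi|_{1,h}^2=\sum_K|\psi|_{1,K}^2$. -/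

import Mathlib

open MeasureTheory Filter Topology

namespace TransmissionVEM

noncomputable section

/-- The Euclidean plane. -/
abbrev Plane : Type := EuclideanSpace ℝ (Fin 2)

/-- Complex functions on the plane. A function "on `U`" is such a function of which only the
almost everywhere class on `U` matters. -/
abbrev Fn : Type := Plane → ℂ

/-! ### Weak derivatives and Sobolev spaces -/

/-- Classical partial derivative. -/
def pd (i : Fin 2) (φ : Fn) : Fn := fun x => fderiv ℝ φ x (EuclideanSpace.single i 1)

/-- Classical Laplacian. -/
def lap (φ : Fn) : Fn := fun x => ∑ i : Fin 2, pd i (pd i φ) x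

/-- `φ ∈ C_c^∞(U)`. -/
def IsTest (U : Set Plane) (φ : Fn) : Prop :=
  ContDiff ℝ ((⊤ : ℕ∞) : WithTop ℕ∞) φ ∧ HasCompactSupport φ ∧ tsupport φ ⊆ U

/-- `v ∈ L²(U)`. -/
def MemL2 (U : Set Plane) (v : Fn) : Prop := MemLp v 2 (volume.restrict U)

/-- `g` is the weak partial derivative `∂_i v` in `U`. -/
def HasWeakPartial (U : Set Plane) (i : Fin 2) (v g : Fn) : Prop :=
  ∀ φ : Fn, IsTest U φ → ∫ x in U, v x * pd i φ x = -∫ x in U, g x * φ x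

open Classical in
/-- The weak partial derivative `∂_i v ∈ L²(U)` (unique almost everywhere in the open set `U`);
`0` if there is none. -/
def wd (U : Set Plane) (i : Fin 2) (v : Fn) : Fn :=
  if h : ∃ g, MemL2 U g ∧ HasWeakPartial U i v g then h.choose else 0

/-- `v ∈ H¹(U)`. -/
def MemH1 (U : Set Plane) (v : Fn) : Prop :=
  MemL2 U v ∧ ∀ i, ∃ g, MemL2 U g ∧ HasWeakPartial U i v g

/-- `v ∈ H²(U)`. -/
def MemH2 (U : Set Plane) (v : Fn) : Prop :=
  MemH1 U v ∧ ∀ i, MemH1 U (wd U i v)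

/-- Entries `∂_{ij} v` of the weak Hessian. -/
def hess (U : Set Plane) (v : Fn) (i j : Fin 2) : Fn := wd U i (wd U j v)

/-- The weak Laplacian. -/
def wlap (U : Set Plane) (v : Fn) : Fn := fun x => ∑ i : Fin 2, hess U v i i x

/-- The seminorm `|v|_{1,U}`. -/
def semi1 (U : Set Plane) (v : Fn) : ℝ :=
  Real.sqrt (∫ x in U, ∑ i : Fin 2, ‖wd U i v x‖ ^ 2)

/-- The seminorm `|v|_{2,U}`. -/
def semi2 (U : Set Plane) (v : Fn) : ℝ :=
  Real.sqrt (∫ x in U, ∑ i : Fin 2, ∑ j : Fin 2, ‖hess U v i j x‖ ^ 2)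

/-- The norm `‖v‖_{1,U}`. -/
def norm1 (U : Set Plane) (v : Fn) : ℝ :=
  Real.sqrt ((∫ x in U, ‖v x‖ ^ 2) + semi1 U v ^ 2)

/-- The norm `‖v‖_{2,U}`. -/
def norm2 (U : Set Plane) (v : Fn) : ℝ :=
  Real.sqrt ((∫ x in U, ‖v x‖ ^ 2) + semi1 U v ^ 2 + semi2 U v ^ 2)

/-- The product norm `‖(v, ψ)‖` of `H²(U) × H¹(U)`. -/
def prodNorm (U : Set Plane) (v ψ : Fn) : ℝ :=
  Real.sqrt (norm2 U v ^ 2 + norm1 U ψ ^ 2)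

/-- `v ∈ H¹₀(U)`, the closure of `C_c^∞(U)` in `H¹(U)`. -/
def MemH01 (U : Set Plane) (v : Fn) : Prop :=
  MemH1 U v ∧ ∃ φ : ℕ → Fn, (∀ m, IsTest U (φ m)) ∧
    Tendsto (fun m => norm1 U (v - φ m)) atTop (𝓝 0)

/-- `v ∈ H²₀(U)`, the closure of `C_c^∞(U)` in `H²(U)`. -/
def MemH02 (U : Set Plane) (v : Fn) : Prop :=
  MemH2 U v ∧ ∃ φ : ℕ → Fn, (∀ m, IsTest U (φ m)) ∧
    Tendsto (fun m => norm2 U (v - φ m)) atTop (𝓝 0)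

/-! ### Boundary values -/

/-- `c` is the trace of `v` at the boundary point `x` of `U`: the limit of the averages of `v`
over `U ∩ B(x, r)` as `r → 0`. On a Lipschitz domain this limit exists and is the usual trace at
almost every boundary point if `v ∈ H¹(U)`, and it is the value at every boundary point if `v` has
a continuous representative on the closure (in particular if `v ∈ H²(U)`). -/
def HasBdryValue (U : Set Plane) (v : Fn) (x : Plane) (c : ℂ) : Prop :=
  Tendsto (fun r : ℝ => ⨍ y in Metric.ball x r ∩ U, v y) (𝓝[>] 0) (𝓝 c)

/-- The trace of `v` as a function on the boundary. -/
def bdryValue (U : Set Plane) (v : Fn) (x : Plane) : ℂ :=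
  limUnder (𝓝[>] (0 : ℝ)) (fun r : ℝ => ⨍ y in Metric.ball x r ∩ U, v y)

/-! ### Polygons and meshes -/

/-- An open polygon: a bounded nonempty connected open set whose boundary is a closed polygonal
line that does not intersect itself. (Simple connectedness follows.) Consecutive edges may be
aligned, and the polygon need not be convex. -/
structure Element where
  /-- number of vertices -/
  N : ℕ
  three_le : 3 ≤ N
  /-- the cyclic list of vertices -/
  poly : Polygon Plane N
  injective : Function.Injective poly.vertices
  simple : ∀ i j, i ≠ j → poly.edgeSet ℝ i ∩ poly.edgeSet ℝ j ⊆
    {poly i, poly (finRotate N i)} ∩ {poly j, poly (finRotate N j)}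
  /-- the open polygon itself -/
  carrier : Set Plane
  isOpen : IsOpen carrier
  isConnected : IsConnected carrier
  isBounded : Bornology.IsBounded carrier
  frontier_eq : frontier carrier = poly.boundary ℝ

namespace Element

/-- The diameter `h_K`. -/
def diam (K : Element) : ℝ := Metric.diam K.carrier

/-- The point of parameter `t ∈ [0,1]` of the `i`-th edge. -/
def edgePt (K : Element) (i : Fin K.N) (t : ℝ) : Plane := K.poly.edgePath ℝ i t

/-- The length of the `i`-th edge. -/
def edgeLen (K : Element) (i : Fin K.N) : ℝ := dist (K.poly i) (K.poly (finRotate K.N i))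

/-- The derivative at a point of the `i`-th edge in the direction normal to that edge, for a field
`G` of gradients: `ν · G` times the length of the edge, up to sign. -/
def edgeNormal (K : Element) (i : Fin K.N) (G : Fin 2 → Fn) (x : Plane) : ℂ :=
  (((K.poly (finRotate K.N i)) 1 - (K.poly i) 1 : ℝ) : ℂ) * G 0 x
    - (((K.poly (finRotate K.N i)) 0 - (K.poly i) 0 : ℝ) : ℂ) * G 1 x

/-- `∫_{∂K} ψ` (of the trace of `ψ`). -/
def bdryInt (K : Element) (ψ : Fn) : ℂ :=
  ∑ i, (K.edgeLen i : ℂ) * ∫ t in (0 : ℝ)..1, bdryValue K.carrier ψ (K.edgePt i t)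

end Element

/-- A bounded domain with polygonal boundary. -/
def IsPolygonalDomain (Ω : Set Plane) : Prop :=
  IsOpen Ω ∧ IsConnected Ω ∧ Bornology.IsBounded Ω ∧
    ∃ S : Finset (Plane × Plane), frontier Ω = ⋃ s ∈ S, segment ℝ s.1 s.2

/-- A decomposition `𝒯_h` of `Ω` into finitely many polygons. -/
structure Mesh (Ω : Set Plane) where
  /-- number of elements -/
  card : ℕ
  /-- the elements -/
  elt : Fin card → Element
  subset : ∀ k, (elt k).carrier ⊆ Ω
  disjoint : ∀ k l, k ≠ l → Disjoint (elt k).carrier (elt l).carrier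
  cover : closure Ω = ⋃ k, closure (elt k).carrier

/-- `h = max_K h_K`. -/
def Mesh.size {Ω : Set Plane} (𝒯 : Mesh Ω) : ℝ := ⨆ k, (𝒯.elt k).diam

/-- The two mesh assumptions with constant `CT`: every edge of `K` is longer than `CT * h_K`, and
`K` is star-shaped with respect to every point of a ball of radius `CT * h_K`. -/
def Mesh.Regular {Ω : Set Plane} (𝒯 : Mesh Ω) (CT : ℝ) : Prop :=
  ∀ k, (∀ i, CT * (𝒯.elt k).diam < (𝒯.elt k).edgeLen i) ∧
    ∃ x₀, ∀ y ∈ Metric.ball x₀ (CT * (𝒯.elt k).diam), StarConvex ℝ y (𝒯.elt k).carrier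

/-! ### Polynomials and continuous forms -/

/-- `ℙ_k`: complex polynomials in two variables of degree at most `k`, as functions. -/
def PolyFn (k : ℕ) : Set Fn :=
  {p | ∃ P : MvPolynomial (Fin 2) ℂ, P.totalDegree ≤ k ∧
    ∀ x : Plane, p x = MvPolynomial.eval (fun i => (x i : ℂ)) P}

/-- `∫_U D²u : D²v̄`. -/
def aDelta (U : Set Plane) (u v : Fn) : ℂ :=
  ∫ x in U, ∑ i : Fin 2, ∑ j : Fin 2, hess U u i j x * star (hess U v i j x)

/-- `∫_U ∇φ · ∇ψ̄`. -/
def aGrad (U : Set Plane) (φ ψ : Fn) : ℂ :=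
  ∫ x in U, ∑ i : Fin 2, wd U i φ x * star (wd U i ψ x)

/-- The form `a`. -/
def aForm (Ω : Set Plane) (n : ℝ) (u φ v ψ : Fn) : ℂ :=
  (1 / ((n : ℂ) - 1)) * aDelta Ω u v + aGrad Ω φ ψ

/-- The form `b`. -/
def bForm (Ω : Set Plane) (n : ℝ) (u φ v ψ : Fn) : ℂ :=
  ((n : ℂ) / ((n : ℂ) - 1)) * (∫ x in Ω, wlap Ω u x * star (v x))
    + (1 / ((n : ℂ) - 1)) * (∫ x in Ω, u x * star (wlap Ω v x))
    - aGrad Ω φ v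
    + ((n : ℂ) / ((n : ℂ) - 1)) * (∫ x in Ω, u x * star (ψ x))

/-- `T(f, g) = (u, φ)`: the pair `(u, φ) ∈ H²₀(Ω) × H¹₀(Ω)` solves the source problem
`a((u, φ), (v, ψ)) = b((f, g), (v, ψ))` for all `(v, ψ) ∈ H²₀(Ω) × H¹₀(Ω)`. -/
def IsT (Ω : Set Plane) (n : ℝ) (f g u φ : Fn) : Prop :=
  MemH02 Ω u ∧ MemH01 Ω φ ∧ ∀ v ψ, MemH02 Ω v → MemH01 Ω ψ →
    aForm Ω n u φ v ψ = bForm Ω n f g v ψ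

/-! ### Projectors -/

open Classical in
/-- The (unique) polynomial in `ℙ_k` satisfying a condition; `0` if there is none. -/
def polySelect (k : ℕ) (cond : Fn → Prop) : Fn :=
  if h : ∃ p ∈ PolyFn k, cond p then h.choose else 0

/-- `Π_2^Δ : H²(K) → ℙ_2`. -/
def projDelta (K : Element) (v : Fn) : Fn :=
  polySelect 2 fun p =>
    (∀ q ∈ PolyFn 2, aDelta K.carrier p q = aDelta K.carrier v q) ∧
    (∀ q ∈ PolyFn 1, ∑ i, p (K.poly i) * q (K.poly i)
      = ∑ i, bdryValue K.carrier v (K.poly i) * q (K.poly i))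

/-- `Π_1^∇ : H¹(K) → ℙ_1`. -/
def projGrad1 (K : Element) (ψ : Fn) : Fn :=
  polySelect 1 fun p =>
    (∀ q ∈ PolyFn 1, aGrad K.carrier p q = aGrad K.carrier ψ q) ∧
    K.bdryInt p = K.bdryInt ψ

/-- `Π_2^∇ : H²(K) → ℙ_2`. -/
def projGrad2 (K : Element) (w : Fn) : Fn :=
  polySelect 2 fun p =>
    (∀ q ∈ PolyFn 2, aGrad K.carrier p q = aGrad K.carrier w q) ∧
    ∫ x in K.carrier, p x = ∫ x in K.carrier, w x

/-- The `L²(K)`-orthogonal projector `Π_l^0` onto `ℙ_l`. -/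
def projL2 (K : Element) (l : ℕ) (w : Fn) : Fn :=
  polySelect l fun p => ∀ q ∈ PolyFn l,
    ∫ x in K.carrier, p x * q x = ∫ x in K.carrier, w x * q x

/-! ### Virtual element spaces -/

/-- `b`, restricted to the `i`-th edge of `K`, is a polynomial of degree at most `k`. -/
def IsEdgePoly (K : Element) (i : Fin K.N) (k : ℕ) (b : Plane → ℂ) : Prop :=
  ∃ P : Polynomial ℂ, P.natDegree ≤ k ∧
    ∀ t ∈ Set.Icc (0 : ℝ) 1, b (K.edgePt i t) = P.eval (t : ℂ)

/-- The preliminary space `W̃_h^K`. -/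
def MemWtilde (K : Element) (v : Fn) : Prop :=
  MemH2 K.carrier v ∧
  (∃ q ∈ PolyFn 2, ∀ φ, IsTest K.carrier φ →
    ∫ x in K.carrier, v x * lap (lap φ) x = ∫ x in K.carrier, q x * φ x) ∧
  (∃ b : Fn, ContinuousOn b (frontier K.carrier) ∧
    (∀ x ∈ frontier K.carrier, HasBdryValue K.carrier v x (b x)) ∧
    ∀ i, IsEdgePoly K i 3 b) ∧
  (∃ G : Fin 2 → Fn, (∀ j, ContinuousOn (G j) (frontier K.carrier)) ∧
    (∀ j i, ∀ᵐ t ∂(volume.restrict (Set.Icc (0 : ℝ) 1)),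
      HasBdryValue K.carrier (wd K.carrier j v) (K.edgePt i t) (G j (K.edgePt i t))) ∧
    ∀ i, IsEdgePoly K i 1 (K.edgeNormal i G))

/-- The preliminary space `Ṽ_h^K`. -/
def MemVtilde (K : Element) (ψ : Fn) : Prop :=
  MemH1 K.carrier ψ ∧
  (∃ q ∈ PolyFn 1, ∀ φ, IsTest K.carrier φ →
    ∫ x in K.carrier, ψ x * lap φ x = ∫ x in K.carrier, q x * φ x) ∧
  (∃ b : Fn, ContinuousOn b (frontier K.carrier) ∧
    (∀ i, ∀ᵐ t ∂(volume.restrict (Set.Icc (0 : ℝ) 1)),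
      HasBdryValue K.carrier ψ (K.edgePt i t) (b (K.edgePt i t))) ∧
    ∀ i, IsEdgePoly K i 1 b)

/-- The local space `W_h^K`. -/
def MemWK (K : Element) (v : Fn) : Prop :=
  MemWtilde K v ∧ ∀ q ∈ PolyFn 2,
    ∫ x in K.carrier, projDelta K v x * q x = ∫ x in K.carrier, v x * q x

/-- The local space `V_h^K`. -/
def MemVK (K : Element) (ψ : Fn) : Prop :=
  MemVtilde K ψ ∧ ∀ q ∈ PolyFn 1,
    ∫ x in K.carrier, projGrad1 K ψ x * q x = ∫ x in K.carrier, ψ x * q x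

/-- The global space `W_h`. -/
def MemW {Ω : Set Plane} (𝒯 : Mesh Ω) (v : Fn) : Prop :=
  MemH02 Ω v ∧ ∀ k, MemWK (𝒯.elt k) v

/-- The global space `V_h`. -/
def MemV {Ω : Set Plane} (𝒯 : Mesh Ω) (ψ : Fn) : Prop :=
  MemH01 Ω ψ ∧ ∀ k, MemVK (𝒯.elt k) ψ

/-! ### Stabilization and discrete forms -/

/-- `s` is a Hermitian positive definite sesquilinear form on the space of functions on `U` (modulo
equality almost everywhere in `U`) given by the predicate `S`. -/
structure IsPosDefForm (U : Set Plane) (S : Fn → Prop) (s : Fn → Fn → ℂ) : Prop where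
  congr : ∀ v v' w, S v → S v' → S w → v =ᵐ[volume.restrict U] v' → s v w = s v' w
  add : ∀ v v' w, S v → S v' → S w → s (v + v') w = s v w + s v' w
  smul : ∀ (c : ℂ) (v w : Fn), S v → S w → s (c • v) w = c * s v w
  herm : ∀ v w, S v → S w → s w v = star (s v w)
  pos : ∀ v, S v → ¬ v =ᵐ[volume.restrict U] 0 → 0 < (s v v).re

/-- Admissible stabilizing form `s_K^Δ` with constants `c₀`, `c₁`. -/
def IsStabDelta (K : Element) (c₀ c₁ : ℝ) (s : Fn → Fn → ℂ) : Prop :=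
  IsPosDefForm K.carrier (MemWK K) s ∧
  ∀ v, MemWK K v → projDelta K v = 0 →
    c₀ * (aDelta K.carrier v v).re ≤ (s v v).re ∧ (s v v).re ≤ c₁ * (aDelta K.carrier v v).re

/-- Admissible stabilizing form `s_K^∇` with constants `c₂`, `c₃`. -/
def IsStabGrad (K : Element) (c₂ c₃ : ℝ) (s : Fn → Fn → ℂ) : Prop :=
  IsPosDefForm K.carrier (MemVK K) s ∧
  ∀ ψ, MemVK K ψ → projGrad1 K ψ = 0 →
    c₂ * (aGrad K.carrier ψ ψ).re ≤ (s ψ ψ).re ∧ (s ψ ψ).re ≤ c₃ * (aGrad K.carrier ψ ψ).re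

/-- The local form `a_{h,K}^Δ`. -/
def ahDelta (K : Element) (s : Fn → Fn → ℂ) (u v : Fn) : ℂ :=
  aDelta K.carrier (projDelta K u) (projDelta K v) + s (u - projDelta K u) (v - projDelta K v)

/-- The local form `a_{h,K}^∇`. -/
def ahGrad (K : Element) (s : Fn → Fn → ℂ) (φ ψ : Fn) : ℂ :=
  aGrad K.carrier (projGrad1 K φ) (projGrad1 K ψ) + s (φ - projGrad1 K φ) (ψ - projGrad1 K ψ)

/-- The local form `b_{h,K}`. -/
def bhK (K : Element) (n : ℝ) (u φ v ψ : Fn) : ℂ :=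
  ((n : ℂ) / ((n : ℂ) - 1)) *
      (∫ x in K.carrier, projL2 K 2 (wlap K.carrier u) x * star (projL2 K 2 v x))
    + (1 / ((n : ℂ) - 1)) *
      (∫ x in K.carrier, projL2 K 2 u x * star (projL2 K 2 (wlap K.carrier v) x))
    - aGrad K.carrier (projGrad1 K φ) (projGrad2 K v)
    + ((n : ℂ) / ((n : ℂ) - 1)) *
      (∫ x in K.carrier, projL2 K 2 u x * star (projL2 K 1 ψ x))

/-- The discrete form `a_h`; the factor `1/(n-1)` is the one of the form `a`. -/
def ahForm {Ω : Set Plane} (𝒯 : Mesh Ω) (n : ℝ) (sΔ sG : Fin 𝒯.card → Fn → Fn → ℂ)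
    (u φ v ψ : Fn) : ℂ :=
  ∑ k, ((1 / ((n : ℂ) - 1)) * ahDelta (𝒯.elt k) (sΔ k) u v + ahGrad (𝒯.elt k) (sG k) φ ψ)

/-- The discrete form `b_h`. -/
def bhForm {Ω : Set Plane} (𝒯 : Mesh Ω) (n : ℝ) (u φ v ψ : Fn) : ℂ :=
  ∑ k, bhK (𝒯.elt k) n u φ v ψ

/-- `T_h(f, g) = (u_h, φ_h)`: the pair `(u_h, φ_h) ∈ Z_h = W_h × V_h` solves the discrete source
problem `a_h((u_h, φ_h), (v_h, ψ_h)) = b_h((f, g), (v_h, ψ_h))` for all `(v_h, ψ_h) ∈ Z_h`. -/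
def IsTh {Ω : Set Plane} (𝒯 : Mesh Ω) (n : ℝ) (sΔ sG : Fin 𝒯.card → Fn → Fn → ℂ)
    (f g uh φh : Fn) : Prop :=
  MemW 𝒯 uh ∧ MemV 𝒯 φh ∧ ∀ vh ψh, MemW 𝒯 vh → MemV 𝒯 ψh →
    ahForm 𝒯 n sΔ sG uh φh vh ψh = bhForm 𝒯 n f g vh ψh

/-! ### Broken seminorms and piecewise polynomials -/

/-- The broken seminorm `|ψ|_{1,h}`. -/
def broken1 {Ω : Set Plane} (𝒯 : Mesh Ω) (ψ : Fn) : ℝ :=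
  Real.sqrt (∑ k, semi1 (𝒯.elt k).carrier ψ ^ 2)

/-- The broken seminorm `|v|_{2,h}`. -/
def broken2 {Ω : Set Plane} (𝒯 : Mesh Ω) (v : Fn) : ℝ :=
  Real.sqrt (∑ k, semi2 (𝒯.elt k).carrier v ^ 2)

/-- `w|_K ∈ ℙ_k` for every element `K`. -/
def PiecewisePoly {Ω : Set Plane} (𝒯 : Mesh Ω) (k : ℕ) (w : Fn) : Prop :=
  ∀ l, ∃ p ∈ PolyFn k, w =ᵐ[volume.restrict (𝒯.elt l).carrier] p

end

end TransmissionVEM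

open TransmissionVEM

/-! The estimate is a Strang argument in which every constant is traced back to the star-shapedness
parameter, the domain, the refractive index and the stabilization bounds.

The source problem decouples. Testing with a pair whose second or first entry is zero gives one
fourth-order and one second-order equation, and in the fourth-order one the factor `1/(n-1)` can be
divided out. Hence the sign of `n - 1` plays no role, and both components are treated by one
abstract lemma, `IsStabilized.sqrt_sum_le`. With `δ = uh - uI`, the stabilized form is bounded below
by `min 1 c₀` times the exact one, bounded above by `max 1 c₁` times it, and agrees with it whenever
one argument is a polynomial. Writing `a_h(δ, δ)` as `[a_h(uh, δ) - a(u, δ)] - [a_h(uI - p, δ) + a(p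
- u, δ)]` on the elements leaves the interpolation error, the polynomial approximation error and the
first bracket, which up to the factor `n - 1` is `(b_h - b)((f, g), (δ, 0))`.

The error of `b_h` is of order `h` (`Mesh.norm_bhForm_sub_le`). In each of its four terms
orthogonality moves the whole error onto one factor that has a derivative to spare, and a Poincaré
inequality on the element turns that derivative into a factor `h_K`. The data `f ∈ H²` and `g ∈ H¹`
need no further regularity.

The Poincaré inequality, with a constant depending only on the ratio of the diameter to the radius
of the star centre, is `exists_integral_norm_sub_sq_le`. For smooth functions `v x - v y` is
integrated along the segment from a point of the ball to a point of the domain. For `H¹` functions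
one mollifies on a slightly contracted copy of the domain, where mollification commutes with weak
differentiation, and passes to the limit with Fatou's lemma.

The rest links these pieces. The projectors are choices of polynomials, so existence comes from
nondegenerate bilinear forms on `ℙ_k`, and their linearity on the virtual element spaces from
uniqueness. Elements exhaust the domain up to null sets, so global forms are sums of local ones.
Friedrichs inequalities finally turn the seminorms of `u - uh` and `φ - φh` into full norms. -/

namespace TransmissionVEM

noncomputable section

/-! ### Semidefinite Hermitian forms -/

/-- Cauchy–Schwarz for a Hermitian form that is semidefinite on a set of vectors closed under
linear combinations. -/
theorem norm_sq_le_of_semidefinite {V : Type*} [AddCommGroup V] [Module ℂ V] (S : V → Prop)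
    (s : V → V → ℂ) (hadd : ∀ v w, S v → S w → S (v + w)) (hsmul : ∀ (c : ℂ) v, S v → S (c • v))
    (sadd : ∀ v v' w, S v → S v' → S w → s (v + v') w = s v w + s v' w)
    (ssmul : ∀ (c : ℂ) v w, S v → S w → s (c • v) w = c * s v w)
    (sherm : ∀ v w, S v → S w → s w v = star (s v w))
    (spos : ∀ v, S v → 0 ≤ (s v v).re) {v w : V} (hv : S v) (hw : S w) :
    ‖s v w‖ ^ 2 ≤ (s v v).re * (s w w).re := by
  -- Positivity at `v - t s(v,w) w` for real `t`. The discriminant of this quadratic gives the claim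
  -- multiplied by `‖s v w‖²`, which is why the zero case is separated at the end.
  have key : ∀ t : ℝ, 0 ≤ ((s w w).re * ‖s v w‖ ^ 2) * (t * t) + (-2 * ‖s v w‖ ^ 2) * t
      + (s v v).re := by
    intro t
    have h1 := hsmul (-(t : ℂ) * s v w) w hw
    have h2 := hadd _ _ hv h1
    have h3 := spos _ h2
    have e : s (v + (-(t : ℂ) * s v w) • w) (v + (-(t : ℂ) * s v w) • w)
        = s v v + -(t : ℂ) * (s v w * star (s v w)) + -(t : ℂ) * (s v w * star (s v w))
          + (t : ℂ) ^ 2 * (s v w * star (s v w)) * s w w := by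
      rw [sadd _ _ _ hv h1 h2, ssmul _ _ _ hw h2, sherm _ v h2 hv, sherm _ w h2 hw,
        sadd _ _ _ hv h1 hv, sadd _ _ _ hv h1 hw, ssmul _ _ _ hw hv, ssmul _ _ _ hw hw,
        sherm v w hv hw]
      have hvv := sherm v v hv hv
      have hww := sherm w w hw hw
      simp only [star_add, star_mul', star_neg, Complex.star_def, Complex.conj_ofReal,
        Complex.conj_conj]
        at hvv hww ⊢
      rw [← hvv, ← hww]
      ring
    rw [e, Complex.star_def, Complex.mul_conj, Complex.normSq_eq_norm_sq] at h3
    have e2 : ((s v v : ℂ) + -(t : ℂ) * ((‖s v w‖ ^ 2 : ℝ) : ℂ) + -(t : ℂ) * ((‖s v w‖ ^ 2 : ℝ) : ℂ)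
        + (t : ℂ) ^ 2 * ((‖s v w‖ ^ 2 : ℝ) : ℂ) * s w w).re
        = (s v v).re - 2 * t * ‖s v w‖ ^ 2 + t ^ 2 * ‖s v w‖ ^ 2 * (s w w).re := by
      have : (t : ℂ) ^ 2 * ((‖s v w‖ ^ 2 : ℝ) : ℂ) = ((t ^ 2 * ‖s v w‖ ^ 2 : ℝ) : ℂ) := by
        push_cast; ring
      rw [this]
      simp only [Complex.add_re, Complex.re_ofReal_mul, ← Complex.ofReal_neg, Complex.ofReal_re]
      ring
    rw [e2] at h3
    linarith
  have hd := discrim_le_zero key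
  rw [discrim] at hd
  have h0 : 0 ≤ (s v v).re * (s w w).re := mul_nonneg (spos v hv) (spos w hw)
  by_cases hz : ‖s v w‖ ^ 2 = 0
  · rw [hz]; exact h0
  · have hp : 0 < ‖s v w‖ ^ 2 := lt_of_le_of_ne (sq_nonneg _) (Ne.symm hz)
    nlinarith [mul_pos hp hp]

/-! ### Square integrable families -/

/-- The `L²(U)` inner product of families of functions. -/
def l2ip {ι : Type} [Fintype ι] (U : Set Plane) (F G : ι → Fn) : ℂ :=
  ∫ x in U, ∑ i, F i x * star (G i x)

/-- The `L²(U)` norm of a family of functions. -/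
def l2norm {ι : Type} [Fintype ι] (U : Set Plane) (F : ι → Fn) : ℝ :=
  Real.sqrt (∫ x in U, ∑ i, ‖F i x‖ ^ 2)

theorem MemL2.add {U : Set Plane} {v w : Fn} (hv : MemL2 U v) (hw : MemL2 U w) :
    MemL2 U (v + w) := MemLp.add hv hw

theorem MemL2.sub {U : Set Plane} {v w : Fn} (hv : MemL2 U v) (hw : MemL2 U w) :
    MemL2 U (v - w) := MemLp.sub hv hw

theorem MemL2.smul {U : Set Plane} {v : Fn} (c : ℂ) (hv : MemL2 U v) :
    MemL2 U (c • v) := MemLp.const_smul hv c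

theorem MemL2.star {U : Set Plane} {v : Fn} (hv : MemL2 U v) :
    MemL2 U (fun x => star (v x)) := MemLp.star hv

theorem MemL2.mono {U K : Set Plane} (h : K ⊆ U) {v : Fn} (hv : MemL2 U v) : MemL2 K v :=
  MemLp.mono_measure (Measure.restrict_mono h le_rfl) hv

theorem MemL2.congr {U : Set Plane} {v w : Fn} (hv : MemL2 U v) (h : v =ᵐ[volume.restrict U] w) :
    MemL2 U w := (memLp_congr_ae h).1 hv

theorem MemL2.integrable_mul {U : Set Plane} {v w : Fn} (hv : MemL2 U v) (hw : MemL2 U w) :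
    Integrable (fun x => v x * w x) (volume.restrict U) := MemLp.integrable_mul hv hw

theorem MemL2.integrable_mul_star {U : Set Plane} {v w : Fn} (hv : MemL2 U v) (hw : MemL2 U w) :
    Integrable (fun x => v x * Star.star (w x)) (volume.restrict U) := hv.integrable_mul hw.star

theorem MemL2.integrable_norm_sq {U : Set Plane} {v : Fn} (hv : MemL2 U v) :
    Integrable (fun x => ‖v x‖ ^ 2) (volume.restrict U) := MemLp.integrable_norm_pow hv two_ne_zero

section families

variable {ι : Type} [Fintype ι] {U : Set Plane}

theorem l2ip_congr {F F' G G' : ι → Fn} (hF : ∀ i, F i =ᵐ[volume.restrict U] F' i)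
    (hG : ∀ i, G i =ᵐ[volume.restrict U] G' i) : l2ip U F G = l2ip U F' G' := by
  apply integral_congr_ae
  filter_upwards [ae_all_iff.2 hF, ae_all_iff.2 hG] with x h1 h2
  simp only [h1, h2]

theorem l2norm_congr {F F' : ι → Fn} (hF : ∀ i, F i =ᵐ[volume.restrict U] F' i) :
    l2norm U F = l2norm U F' := by
  rw [l2norm, l2norm]
  congr 1
  apply integral_congr_ae
  filter_upwards [ae_all_iff.2 hF] with x h1
  simp only [h1]

theorem l2norm_nonneg (F : ι → Fn) : 0 ≤ l2norm U F := Real.sqrt_nonneg _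

theorem l2norm_sq (F : ι → Fn) : l2norm U F ^ 2 = ∫ x in U, ∑ i, ‖F i x‖ ^ 2 :=
  Real.sq_sqrt (integral_nonneg fun _ => Finset.sum_nonneg fun _ _ => sq_nonneg _)

theorem l2norm_sq_eq_sum {F : ι → Fn} (hF : ∀ i, MemL2 U (F i)) :
    l2norm U F ^ 2 = ∑ i, ∫ x in U, ‖F i x‖ ^ 2 := by
  rw [l2norm_sq, integral_finsetSum _ fun i _ => (hF i).integrable_norm_sq]

theorem l2ip_add {F F' G : ι → Fn} (hF : ∀ i, MemL2 U (F i)) (hF' : ∀ i, MemL2 U (F' i))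
    (hG : ∀ i, MemL2 U (G i)) : l2ip U (F + F') G = l2ip U F G + l2ip U F' G := by
  rw [l2ip, l2ip, l2ip, ← integral_add]
  · congr 1
    ext x
    simp only [Pi.add_apply, add_mul, Finset.sum_add_distrib]
  · exact integrable_finsetSum _ fun i _ => (hF i).integrable_mul_star (hG i)
  · exact integrable_finsetSum _ fun i _ => (hF' i).integrable_mul_star (hG i)

theorem l2ip_smul (c : ℂ) (F G : ι → Fn) : l2ip U (c • F) G = c * l2ip U F G := by
  rw [l2ip, l2ip, ← integral_const_mul]
  congr 1
  ext x
  simp only [Pi.smul_apply, smul_eq_mul, Finset.mul_sum, mul_assoc]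

theorem l2ip_star (F G : ι → Fn) : l2ip U G F = star (l2ip U F G) := by
  rw [l2ip, l2ip, Complex.star_def, ← integral_conj]
  congr 1
  ext x
  simp [mul_comm]

theorem l2ip_self (F : ι → Fn) : l2ip U F F = ((l2norm U F ^ 2 : ℝ) : ℂ) := by
  rw [l2norm_sq, l2ip, ← integral_complex_ofReal]
  congr 1
  ext x
  push_cast
  refine Finset.sum_congr rfl fun i _ => ?_
  rw [Complex.star_def, Complex.mul_conj, Complex.normSq_eq_norm_sq]
  push_cast; rfl

theorem l2ip_self_re (F : ι → Fn) : (l2ip U F F).re = l2norm U F ^ 2 := by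
  rw [l2ip_self, Complex.ofReal_re]

theorem l2ip_add_right {F G G' : ι → Fn} (hF : ∀ i, MemL2 U (F i)) (hG : ∀ i, MemL2 U (G i))
    (hG' : ∀ i, MemL2 U (G' i)) : l2ip U F (G + G') = l2ip U F G + l2ip U F G' := by
  rw [l2ip_star, l2ip_add hG hG' hF, star_add, ← l2ip_star, ← l2ip_star]

theorem norm_l2ip_le {F G : ι → Fn} (hF : ∀ i, MemL2 U (F i)) (hG : ∀ i, MemL2 U (G i)) :
    ‖l2ip U F G‖ ≤ l2norm U F * l2norm U G := by
  have := norm_sq_le_of_semidefinite (fun F : ι → Fn => ∀ i, MemL2 U (F i)) (l2ip U)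
    (fun v w hv hw i => (hv i).add (hw i)) (fun c v hv i => (hv i).smul c)
    (fun _ _ _ h1 h2 h3 => l2ip_add h1 h2 h3) (fun c v w _ _ => l2ip_smul c v w)
    (fun v w _ _ => l2ip_star v w)
    (fun v _ => by rw [l2ip_self_re]; exact sq_nonneg _) hF hG
  rw [l2ip_self_re, l2ip_self_re, ← mul_pow] at this
  exact le_of_sq_le_sq this (mul_nonneg (l2norm_nonneg _) (l2norm_nonneg _))

theorem l2norm_add_le {F G : ι → Fn} (hF : ∀ i, MemL2 U (F i)) (hG : ∀ i, MemL2 U (G i)) :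
    l2norm U (F + G) ≤ l2norm U F + l2norm U G := by
  refine le_of_sq_le_sq ?_ (add_nonneg (l2norm_nonneg _) (l2norm_nonneg _))
  have hFG : ∀ i, MemL2 U ((F + G) i) := fun i => (hF i).add (hG i)
  rw [← l2ip_self_re, l2ip_add hF hG hFG, l2ip_add_right hF hF hG, l2ip_add_right hG hF hG,
    l2ip_star F G]
  simp only [Complex.add_re, l2ip_self_re, Complex.star_def, Complex.conj_re]
  nlinarith [norm_l2ip_le hF hG, Complex.re_le_norm (l2ip U F G)]

theorem l2norm_smul (c : ℂ) (F : ι → Fn) : l2norm U (c • F) = ‖c‖ * l2norm U F := by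
  rw [l2norm, l2norm, ← Real.sqrt_sq (norm_nonneg c), ← Real.sqrt_mul (sq_nonneg _),
    ← integral_const_mul]
  congr 2
  ext x
  simp [Finset.mul_sum, mul_pow]

end families

/-! ### Test functions -/

theorem contDiff_pd {φ : Fn} (h : ContDiff ℝ ((⊤ : ℕ∞) : WithTop ℕ∞) φ) (i : Fin 2) :
    ContDiff ℝ ((⊤ : ℕ∞) : WithTop ℕ∞) (pd i φ) :=
  (h.fderiv_right (m := ((⊤ : ℕ∞) : WithTop ℕ∞)) (by simp)).clm_apply contDiff_const

theorem tsupport_pd_subset (i : Fin 2) (φ : Fn) : tsupport (pd i φ) ⊆ tsupport φ :=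
  tsupport_fderiv_apply_subset ℝ _

theorem IsTest.pd {U : Set Plane} {φ : Fn} (h : IsTest U φ) (i : Fin 2) : IsTest U (pd i φ) :=
  ⟨contDiff_pd h.1 i, h.2.1.of_isClosed_subset (isClosed_tsupport _) (tsupport_pd_subset i φ),
    (tsupport_pd_subset i φ).trans h.2.2⟩

theorem IsTest.mono {U V : Set Plane} (hUV : U ⊆ V) {φ : Fn} (h : IsTest U φ) : IsTest V φ :=
  ⟨h.1, h.2.1, h.2.2.trans hUV⟩

theorem IsTest.add {U : Set Plane} {φ ψ : Fn} (h : IsTest U φ) (h' : IsTest U ψ) :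
    IsTest U (φ + ψ) :=
  ⟨h.1.add h'.1, h.2.1.add h'.2.1,
    (tsupport_add φ ψ).trans (Set.union_subset h.2.2 h'.2.2)⟩

theorem IsTest.memL2 {U V : Set Plane} {φ : Fn} (h : IsTest U φ) : MemL2 V φ :=
  (h.1.continuous.memLp_of_hasCompactSupport h.2.1).restrict V

theorem IsTest.eq_zero {U : Set Plane} {φ : Fn} (h : IsTest U φ) {x : Plane} (hx : x ∉ U) :
    φ x = 0 := image_eq_zero_of_notMem_tsupport fun h' => hx (h.2.2 h')

theorem IsTest.ofReal {U : Set Plane} {g : Plane → ℝ}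
    (h : ContDiff ℝ ((⊤ : ℕ∞) : WithTop ℕ∞) g) (hc : HasCompactSupport g)
    (hs : tsupport g ⊆ U) : IsTest U (fun x => (g x : ℂ)) := by
  refine ⟨Complex.ofRealCLM.contDiff.comp h, hc.comp_left (g := ((↑) : ℝ → ℂ)) rfl, ?_⟩
  exact (tsupport_comp_subset (g := ((↑) : ℝ → ℂ)) rfl g).trans hs

theorem setIntegral_eq_of_test {U : Set Plane} {φ : Fn} (hφ : IsTest U φ) (v : Fn) :
    ∫ x in U, v x * φ x = ∫ x, v x * φ x :=
  setIntegral_eq_integral_of_forall_compl_eq_zero fun x hx => by rw [hφ.eq_zero hx, mul_zero]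

/-! ### Weak partial derivatives -/

/-- Fundamental lemma of the calculus of variations. Real-valued test functions already suffice to
separate complex functions. -/
theorem HasWeakPartial.ae_eq {U : Set Plane} (hU : IsOpen U) {i : Fin 2} {v g g' : Fn}
    (hg : MemL2 U g) (hg' : MemL2 U g') (h : HasWeakPartial U i v g)
    (h' : HasWeakPartial U i v g') : g =ᵐ[volume.restrict U] g' := by
  have hd : MemL2 U (g - g') := hg.sub hg'
  have hl : LocallyIntegrableOn (g - g') U volume :=
    locallyIntegrableOn_of_locallyIntegrable_restrict
      (MemLp.locallyIntegrable hd (by norm_num))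
  have := hU.ae_eq_zero_of_integral_contDiff_smul_eq_zero hl (fun ρ h1 h2 h3 => by
    have ht := IsTest.ofReal h1 h2 h3
    have e : ∀ x, ρ x • (g - g') x = (g - g') x * (ρ x : ℂ) := fun x => by
      rw [Complex.real_smul, mul_comm]
    simp_rw [e]
    rw [← setIntegral_eq_of_test ht]
    simp only [Pi.sub_apply, sub_mul]
    rw [integral_sub (hg.integrable_mul ht.memL2) (hg'.integrable_mul ht.memL2)]
    have := h _ ht
    rw [h' _ ht] at this
    rw [neg_inj] at this
    rw [this, sub_self])
  rw [Filter.EventuallyEq, ae_restrict_iff' hU.measurableSet]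
  filter_upwards [this] with x hx hxU
  exact sub_eq_zero.1 (hx hxU)

theorem MemH1.wd_spec {U : Set Plane} {v : Fn} (h : MemH1 U v) (i : Fin 2) :
    MemL2 U (wd U i v) ∧ HasWeakPartial U i v (wd U i v) := by
  rw [wd, dif_pos (h.2 i)]
  exact (h.2 i).choose_spec

theorem MemH1.memL2_wd {U : Set Plane} {v : Fn} (h : MemH1 U v) (i : Fin 2) :
    MemL2 U (wd U i v) := (h.wd_spec i).1

/-- Since `wd` is a choice, it is computed by exhibiting some weak derivative and appealing to
uniqueness. All rules for `wd` and `hess` below are therefore identities almost everywhere. -/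
theorem HasWeakPartial.wd_ae_eq {U : Set Plane} (hU : IsOpen U) {i : Fin 2} {v g : Fn}
    (hg : MemL2 U g) (h : HasWeakPartial U i v g) : wd U i v =ᵐ[volume.restrict U] g := by
  have hex : ∃ g, MemL2 U g ∧ HasWeakPartial U i v g := ⟨g, hg, h⟩
  rw [wd, dif_pos hex]
  exact HasWeakPartial.ae_eq hU hex.choose_spec.1 hg hex.choose_spec.2 h

theorem HasWeakPartial.congr {U : Set Plane} {i : Fin 2} {v v' g g' : Fn}
    (h : HasWeakPartial U i v g) (hv : v =ᵐ[volume.restrict U] v')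
    (hg : g =ᵐ[volume.restrict U] g') : HasWeakPartial U i v' g' := by
  intro φ hφ
  have h1 : ∫ x in U, v x * pd i φ x = ∫ x in U, v' x * pd i φ x :=
    integral_congr_ae (hv.mono fun x hx => congrArg (· * pd i φ x) hx)
  have h2 : ∫ x in U, g x * φ x = ∫ x in U, g' x * φ x :=
    integral_congr_ae (hg.mono fun x hx => congrArg (· * φ x) hx)
  rw [← h1, ← h2, h φ hφ]

theorem HasWeakPartial.add {U : Set Plane} {i : Fin 2} {v w g k : Fn} (hv : MemL2 U v)
    (hw : MemL2 U w) (hg : MemL2 U g) (hk : MemL2 U k)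
    (h : HasWeakPartial U i v g) (h' : HasWeakPartial U i w k) :
    HasWeakPartial U i (v + w) (g + k) := by
  intro φ hφ
  simp only [Pi.add_apply, add_mul]
  rw [integral_add (hv.integrable_mul (hφ.pd i).memL2) (hw.integrable_mul (hφ.pd i).memL2),
    integral_add (hg.integrable_mul hφ.memL2) (hk.integrable_mul hφ.memL2), h φ hφ, h' φ hφ,
    neg_add]

theorem HasWeakPartial.smul {U : Set Plane} {i : Fin 2} {v g : Fn} (c : ℂ)
    (h : HasWeakPartial U i v g) : HasWeakPartial U i (c • v) (c • g) := by
  intro φ hφ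
  simp only [Pi.smul_apply, smul_eq_mul, mul_assoc]
  rw [integral_const_mul, integral_const_mul, h φ hφ, mul_neg]

/-- A test function of the smaller set is one of the larger set, and the integrals over both equal
the integral over the plane. -/
theorem HasWeakPartial.mono {U K : Set Plane} (hKU : K ⊆ U) {i : Fin 2} {v g : Fn}
    (h : HasWeakPartial U i v g) : HasWeakPartial K i v g := by
  intro φ hφ
  rw [setIntegral_eq_of_test (hφ.pd i), setIntegral_eq_of_test hφ,
    ← setIntegral_eq_of_test ((hφ.mono hKU).pd i), ← setIntegral_eq_of_test (hφ.mono hKU)]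
  exact h φ (hφ.mono hKU)

theorem hasWeakPartial_of_contDiff {U : Set Plane} {v : Fn}
    (h : ContDiff ℝ ((⊤ : ℕ∞) : WithTop ℕ∞) v) (i : Fin 2) : HasWeakPartial U i v (pd i v) := by
  intro φ hφ
  rw [setIntegral_eq_of_test (hφ.pd i), setIntegral_eq_of_test hφ]
  have hc : ∀ {p ψ : Fn}, Continuous p → IsTest U ψ → Integrable (fun x => p x * ψ x) := by
    intro p ψ hp hψ
    exact (hp.mul hψ.1.continuous).integrable_of_hasCompactSupport hψ.2.1.mul_left
  exact integral_mul_fderiv_eq_neg_fderiv_mul_of_integrable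
    (hc (contDiff_pd h i).continuous hφ) (hc h.continuous (hφ.pd i)) (hc h.continuous hφ)
    (fun x _ => (h.differentiable (by simp)) x)
    (fun x _ => (hφ.1.differentiable (by simp)) x)

theorem memL2_of_continuous {U : Set Plane} (hU : Bornology.IsBounded U) {v : Fn}
    (hv : Continuous v) : MemL2 U v := by
  obtain ⟨R, hR⟩ := hU.subset_closedBall 0
  have h1 : MemL2 (Metric.closedBall 0 R) v := by
    have : IsFiniteMeasure (volume.restrict (Metric.closedBall (0 : Plane) R)) :=
      ⟨by rw [Measure.restrict_apply_univ]; exact (isCompact_closedBall _ _).measure_lt_top⟩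
    obtain ⟨C, hC⟩ := (isCompact_closedBall (0 : Plane) R).exists_bound_of_continuousOn
      hv.continuousOn
    exact MemLp.of_bound hv.aestronglyMeasurable C
      ((ae_restrict_iff' Metric.isClosed_closedBall.measurableSet).2 (Eventually.of_forall hC))
  exact h1.mono hR

/-! ### The spaces `H¹` and `H²` -/

theorem MemH1.congr {U : Set Plane} {v w : Fn} (h : MemH1 U v) (e : v =ᵐ[volume.restrict U] w) :
    MemH1 U w :=
  ⟨h.1.congr e, fun i => ⟨wd U i v, h.memL2_wd i, (h.wd_spec i).2.congr e EventuallyEq.rfl⟩⟩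

theorem MemH1.add {U : Set Plane} {v w : Fn} (hv : MemH1 U v) (hw : MemH1 U w) :
    MemH1 U (v + w) :=
  ⟨hv.1.add hw.1, fun i => ⟨_, (hv.memL2_wd i).add (hw.memL2_wd i),
    (hv.wd_spec i).2.add hv.1 hw.1 (hv.memL2_wd i) (hw.memL2_wd i) (hw.wd_spec i).2⟩⟩

theorem MemH1.smul {U : Set Plane} {v : Fn} (c : ℂ) (hv : MemH1 U v) : MemH1 U (c • v) :=
  ⟨hv.1.smul c, fun i => ⟨_, (hv.memL2_wd i).smul c, (hv.wd_spec i).2.smul c⟩⟩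

theorem MemH1.mono {U K : Set Plane} (hKU : K ⊆ U) {v : Fn} (hv : MemH1 U v) : MemH1 K v :=
  ⟨hv.1.mono hKU, fun i => ⟨_, (hv.memL2_wd i).mono hKU, (hv.wd_spec i).2.mono hKU⟩⟩

theorem memH1_of_contDiff {U : Set Plane} (hb : Bornology.IsBounded U) {v : Fn}
    (h : ContDiff ℝ ((⊤ : ℕ∞) : WithTop ℕ∞) v) : MemH1 U v :=
  ⟨memL2_of_continuous hb h.continuous,
    fun i => ⟨_, memL2_of_continuous hb (contDiff_pd h i).continuous,
      hasWeakPartial_of_contDiff h i⟩⟩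

theorem wd_congr {U : Set Plane} (hU : IsOpen U) {v w : Fn} (h : MemH1 U v)
    (e : v =ᵐ[volume.restrict U] w) (i : Fin 2) :
    wd U i v =ᵐ[volume.restrict U] wd U i w :=
  (((h.wd_spec i).2.congr e EventuallyEq.rfl).wd_ae_eq hU (h.memL2_wd i)).symm

theorem wd_add {U : Set Plane} (hU : IsOpen U) {v w : Fn} (hv : MemH1 U v) (hw : MemH1 U w)
    (i : Fin 2) :
    wd U i (v + w) =ᵐ[volume.restrict U] wd U i v + wd U i w :=
  ((hv.wd_spec i).2.add hv.1 hw.1 (hv.memL2_wd i) (hw.memL2_wd i) (hw.wd_spec i).2).wd_ae_eq hU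
    ((hv.memL2_wd i).add (hw.memL2_wd i))

theorem wd_smul {U : Set Plane} (hU : IsOpen U) {v : Fn} (hv : MemH1 U v) (c : ℂ) (i : Fin 2) :
    wd U i (c • v) =ᵐ[volume.restrict U] c • wd U i v :=
  ((hv.wd_spec i).2.smul c).wd_ae_eq hU ((hv.memL2_wd i).smul c)

theorem wd_of_contDiff {U : Set Plane} (hU : IsOpen U) (hb : Bornology.IsBounded U) {v : Fn}
    (h : ContDiff ℝ ((⊤ : ℕ∞) : WithTop ℕ∞) v) (i : Fin 2) :
    wd U i v =ᵐ[volume.restrict U] pd i v :=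
  (hasWeakPartial_of_contDiff h i).wd_ae_eq hU
    (memL2_of_continuous hb (contDiff_pd h i).continuous)

theorem MemH2.add {U : Set Plane} (hU : IsOpen U) {v w : Fn} (hv : MemH2 U v)
    (hw : MemH2 U w) : MemH2 U (v + w) :=
  ⟨hv.1.add hw.1, fun i => ((hv.2 i).add (hw.2 i)).congr (wd_add hU hv.1 hw.1 i).symm⟩

theorem MemH2.smul {U : Set Plane} (hU : IsOpen U) {v : Fn} (c : ℂ) (hv : MemH2 U v) : MemH2 U
    (c • v) :=
  ⟨hv.1.smul c, fun i => ((hv.2 i).smul c).congr (wd_smul hU hv.1 c i).symm⟩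

theorem memH2_of_contDiff {U : Set Plane} (hU : IsOpen U) (hb : Bornology.IsBounded U) {v : Fn}
    (h : ContDiff ℝ ((⊤ : ℕ∞) : WithTop ℕ∞) v) : MemH2 U v :=
  ⟨memH1_of_contDiff hb h,
    fun i => (memH1_of_contDiff hb (contDiff_pd h i)).congr (wd_of_contDiff hU hb h i).symm⟩

theorem hess_congr {U : Set Plane} (hU : IsOpen U) {v w : Fn} (h : MemH2 U v)
    (e : v =ᵐ[volume.restrict U] w) (i j : Fin 2) :
    hess U v i j =ᵐ[volume.restrict U] hess U w i j :=
  wd_congr hU (h.2 j) (wd_congr hU h.1 e j) i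

theorem hess_add {U : Set Plane} (hU : IsOpen U) {v w : Fn} (hv : MemH2 U v) (hw : MemH2 U w)
    (i j : Fin 2) :
    hess U (v + w) i j =ᵐ[volume.restrict U] hess U v i j + hess U w i j :=
  (wd_congr hU ((hv.add hU hw).2 j) (wd_add hU hv.1 hw.1 j) i).trans
    (wd_add hU (hv.2 j) (hw.2 j) i)

theorem hess_smul {U : Set Plane} (hU : IsOpen U) {v : Fn} (hv : MemH2 U v) (c : ℂ) (i j : Fin 2) :
    hess U (c • v) i j =ᵐ[volume.restrict U] c • hess U v i j :=
  (wd_congr hU ((hv.smul hU c).2 j) (wd_smul hU hv.1 c j) i).trans (wd_smul hU (hv.2 j) c i)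

theorem hess_of_contDiff {U : Set Plane} (hU : IsOpen U) (hb : Bornology.IsBounded U) {v : Fn}
    (h : ContDiff ℝ ((⊤ : ℕ∞) : WithTop ℕ∞) v) (i j : Fin 2) :
    hess U v i j =ᵐ[volume.restrict U] pd i (pd j v) :=
  (wd_congr hU ((memH2_of_contDiff hU hb h).2 j) (wd_of_contDiff hU hb h j) i).trans
    (wd_of_contDiff hU hb (contDiff_pd h j) i)

theorem wd_mono {U : Set Plane} {K : Set Plane} (hK : IsOpen K) (hKU : K ⊆ U) {v : Fn}
    (hv : MemH1 U v)
    (i : Fin 2) : wd K i v =ᵐ[volume.restrict K] wd U i v :=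
  ((hv.wd_spec i).2.mono hKU).wd_ae_eq hK ((hv.memL2_wd i).mono hKU)

theorem MemH2.mono {U : Set Plane} {K : Set Plane} (hK : IsOpen K) (hKU : K ⊆ U) {v : Fn}
    (hv : MemH2 U v) :
    MemH2 K v :=
  ⟨hv.1.mono hKU, fun i => ((hv.2 i).mono hKU).congr (wd_mono hK hKU hv.1 i).symm⟩

theorem hess_mono {U : Set Plane} {K : Set Plane} (hK : IsOpen K) (hKU : K ⊆ U) {v : Fn}
    (hv : MemH2 U v)
    (i j : Fin 2) : hess K v i j =ᵐ[volume.restrict K] hess U v i j :=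
  (wd_congr hK ((hv.mono hK hKU).2 j) (wd_mono hK hKU hv.1 j) i).trans
    (wd_mono hK hKU (hv.2 j) i)

theorem MemH2.memL2_hess {U : Set Plane} {v : Fn} (hv : MemH2 U v) (i j : Fin 2) : MemL2 U
    (hess U v i j) :=
  (hv.2 j).memL2_wd i

theorem MemH2.memL2_wlap {U : Set Plane} {v : Fn} (hv : MemH2 U v) : MemL2 U (wlap U v) := by
  have : wlap U v = hess U v 0 0 + hess U v 1 1 := by
    ext x; simp [wlap]
  rw [this]
  exact (hv.memL2_hess 0 0).add (hv.memL2_hess 1 1)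

/-! ### The Poincaré inequality for smooth functions on star-shaped domains -/

open ENNReal in
-- Cauchy–Schwarz against the constant 1, kept in `ℝ≥0∞` so that no integrability has to be checked.
theorem sq_lintegral_le {α : Type*} [MeasurableSpace α] (μ : Measure α) {f : α → ℝ≥0∞}
    (hf : AEMeasurable f μ) : (∫⁻ x, f x ∂μ) ^ 2 ≤ μ Set.univ * ∫⁻ x, f x ^ 2 ∂μ := by
  have h := lintegral_mul_norm_pow_le (μ := μ) (f := fun _ => 1) (g := fun x => f x ^ 2)
    aemeasurable_const (hf.pow_const 2) (p := 1 / 2) (q := 1 / 2) (by norm_num) (by norm_num)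
    (by norm_num)
  have e : ∀ a : ℝ≥0∞, (a ^ 2) ^ (1 / 2 : ℝ) = a := fun a => by
    rw [← ENNReal.rpow_natCast, ← ENNReal.rpow_mul]; norm_num
  have e' : ∀ a : ℝ≥0∞, (a ^ (1 / 2 : ℝ)) ^ 2 = a := fun a => by
    rw [← ENNReal.rpow_natCast, ← ENNReal.rpow_mul]; norm_num
  simp only [ENNReal.one_rpow, one_mul, lintegral_const, e] at h
  calc (∫⁻ x, f x ∂μ) ^ 2 ≤ (μ Set.univ ^ (1 / 2 : ℝ) * (∫⁻ x, f x ^ 2 ∂μ) ^ (1 / 2 : ℝ)) ^ 2 := by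
        gcongr
    _ = _ := by rw [mul_pow, e', e']

open ENNReal in
-- The Jacobian factor in the plane is `r⁻²`, which is at most 4 for `r ≥ 1/2`.
theorem lintegral_comp_smul_add (f : Plane → ℝ≥0∞) (hf : Measurable f) {r : ℝ} (hr : 1 / 2 ≤ r)
    (a : Plane) : ∫⁻ y, f (r • y + a) ≤ 4 * ∫⁻ y, f y := by
  have hr0 : r ≠ 0 := by positivity
  have h1 : ∫⁻ y, f (r • y + a) = ∫⁻ y, f (y + a) ∂(Measure.map (fun x : Plane => r • x) volume) :=
    by rw [lintegral_map (by fun_prop) (by fun_prop)]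
  rw [h1, Measure.map_addHaar_smul volume hr0, lintegral_smul_measure, lintegral_add_right_eq_self,
    smul_eq_mul]
  gcongr
  rw [finrank_euclideanSpace, Fintype.card_fin, abs_of_nonneg (by positivity)]
  have : (r ^ 2)⁻¹ ≤ 4 := by
    rw [inv_le_comm₀ (by positivity) (by norm_num)]
    nlinarith
  calc ENNReal.ofReal (r ^ 2)⁻¹ ≤ ENNReal.ofReal 4 := ENNReal.ofReal_le_ofReal this
    _ = 4 := by norm_num

/-- Squared length of the gradient. -/
def gradSq (w : Fn) (z : Plane) : ENNReal := ∑ i : Fin 2, ‖pd i w z‖ₑ ^ 2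

theorem measurable_gradSq {w : Fn} (hw : ContDiff ℝ ((⊤ : ℕ∞) : WithTop ℕ∞) w) :
    Measurable (gradSq w) := by
  refine Finset.measurable_sum _ fun i _ => ?_
  exact ((contDiff_pd hw i).continuous.enorm.measurable).pow_const 2

theorem fderiv_apply_eq_sum (w : Fn) (z v : Plane) :
    fderiv ℝ w z v = ∑ i : Fin 2, (v i : ℂ) * pd i w z := by
  have hv : v = ∑ i : Fin 2, v i • EuclideanSpace.single i (1 : ℝ) := by
    ext j
    fin_cases j <;> simp
  conv_lhs => rw [hv]
  rw [map_sum]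
  refine Finset.sum_congr rfl fun i _ => ?_
  rw [map_smul, Complex.real_smul, pd]

theorem enorm_fderiv_apply_sq_le (w : Fn) (z v : Plane) :
    ‖fderiv ℝ w z v‖ₑ ^ 2 ≤ ENNReal.ofReal (‖v‖ ^ 2) * gradSq w z := by
  have h1 : ‖fderiv ℝ w z v‖ ^ 2 ≤ ‖v‖ ^ 2 * ∑ i : Fin 2, ‖pd i w z‖ ^ 2 := by
    rw [fderiv_apply_eq_sum, EuclideanSpace.norm_sq_eq]
    calc ‖∑ i : Fin 2, (v i : ℂ) * pd i w z‖ ^ 2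
        ≤ (∑ i : Fin 2, ‖v i‖ * ‖pd i w z‖) ^ 2 := by
          gcongr
          refine (norm_sum_le _ _).trans_eq ?_
          simp
      _ ≤ _ := Finset.sum_mul_sq_le_sq_mul_sq _ _ _
  have h2 : gradSq w z = ENNReal.ofReal (∑ i : Fin 2, ‖pd i w z‖ ^ 2) := by
    rw [ENNReal.ofReal_sum_of_nonneg fun _ _ => sq_nonneg _, gradSq]
    refine Finset.sum_congr rfl fun i _ => ?_
    rw [ENNReal.ofReal_pow (norm_nonneg _), ofReal_norm]
  rw [h2, ← ENNReal.ofReal_mul (sq_nonneg _), ← ofReal_norm,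
    ← ENNReal.ofReal_pow (norm_nonneg _)]
  exact ENNReal.ofReal_le_ofReal h1

/-- Fundamental theorem of calculus along the segment from `y` to `x`, then Cauchy–Schwarz on the
unit interval. -/
theorem enorm_sub_sq_le_segment {w : Fn} (hw : ContDiff ℝ ((⊤ : ℕ∞) : WithTop ℕ∞) w)
    (x y : Plane) : ‖w x - w y‖ₑ ^ 2 ≤ ENNReal.ofReal (‖x - y‖ ^ 2) *
      ∫⁻ t in Set.Icc (0 : ℝ) 1, gradSq w (y + t • (x - y)) := by
  have hd : ∀ t : ℝ, HasDerivAt (fun t : ℝ => w (y + t • (x - y)))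
      (fderiv ℝ w (y + t • (x - y)) (x - y)) t := by
    intro t
    have h1 : HasDerivAt (fun t : ℝ => y + t • (x - y)) (x - y) t := by
      simpa using ((hasDerivAt_id t).smul_const (x - y)).const_add y
    exact ((hw.differentiable (by simp)) _).hasFDerivAt.comp_hasDerivAt t h1
  have hc : Continuous fun t : ℝ => fderiv ℝ w (y + t • (x - y)) (x - y) := by
    have h1 : Continuous (fderiv ℝ w) := hw.continuous_fderiv (by simp)
    have h2 : Continuous fun t : ℝ => y + t • (x - y) := by fun_prop
    exact (h1.comp h2).clm_apply continuous_const
  have hi := intervalIntegral.integral_eq_sub_of_hasDerivAt (a := 0) (b := 1) (fun t _ => hd t)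
    (hc.intervalIntegrable _ _)
  have e : w x - w y = ∫ t in Set.Icc (0 : ℝ) 1, fderiv ℝ w (y + t • (x - y)) (x - y) := by
    rw [integral_Icc_eq_integral_Ioc, ← intervalIntegral.integral_of_le zero_le_one, hi]
    simp
  rw [e]
  calc _ ≤ (∫⁻ t in Set.Icc (0 : ℝ) 1, ‖fderiv ℝ w (y + t • (x - y)) (x - y)‖ₑ) ^ 2 := by
        gcongr
        exact enorm_integral_le_lintegral_enorm _
    _ ≤ (volume.restrict (Set.Icc (0 : ℝ) 1)) Set.univ *
        ∫⁻ t in Set.Icc (0 : ℝ) 1, ‖fderiv ℝ w (y + t • (x - y)) (x - y)‖ₑ ^ 2 :=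
        sq_lintegral_le _ hc.enorm.measurable.aemeasurable
    _ ≤ 1 * ∫⁻ t in Set.Icc (0 : ℝ) 1, ENNReal.ofReal (‖x - y‖ ^ 2) *
          gradSq w (y + t • (x - y)) := by
        gcongr
        · simp
        · exact enorm_fderiv_apply_sq_le _ _ _
    _ = _ := by
        rw [one_mul, lintegral_const_mul]
        exact (measurable_gradSq hw).comp (by fun_prop)

/-- The point `(1 - t) y + t x` depends on `y` with factor `1 - t` and on `x` with factor `t`. One
of the two is at least `1/2`, so substituting in that variable costs at most 4, and the other
variable contributes the volume of its set. This avoids the singularity that a substitution in only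
one variable would have at an end of `[0,1]`. -/
theorem lintegral_lintegral_segment_le {A B : Set Plane} (hA : MeasurableSet A)
    {t : ℝ} (h : ∀ x ∈ A, ∀ y ∈ B, y + t • (x - y) ∈ A)
    (hBm : MeasurableSet B) {g : Plane → ENNReal} (hg : Measurable g) :
    ∫⁻ x in A, ∫⁻ y in B, g (y + t • (x - y)) ≤
      4 * (volume A + volume B) * ∫⁻ z in A, g z := by
  have hgA : Measurable (A.indicator g) := hg.indicator hA
  -- The indicator of `A` changes nothing on the segments, and it allows the integration to be
  -- enlarged to the whole plane before substituting.
  have hle : ∫⁻ x in A, ∫⁻ y in B, g (y + t • (x - y)) ≤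
      ∫⁻ x in A, ∫⁻ y in B, A.indicator g (y + t • (x - y)) := by
    refine setLIntegral_mono' hA fun x hx => setLIntegral_mono' hBm fun y hy => ?_
    rw [Set.indicator_of_mem (h x hx y hy)]
  refine hle.trans ?_
  rcases le_total t (1 / 2) with h1 | h1
  · calc ∫⁻ x in A, ∫⁻ y in B, A.indicator g (y + t • (x - y))
        ≤ ∫⁻ x in A, 4 * ∫⁻ z in A, g z := by
          refine setLIntegral_mono' hA fun x _ => ?_
          refine (setLIntegral_le_lintegral _ _).trans ?_
          have := lintegral_comp_smul_add (A.indicator g) hgA (r := 1 - t) (by linarith) (t • x)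
          rw [lintegral_indicator hA] at this
          refine le_trans (le_of_eq ?_) this
          congr 1; ext y; congr 1
          module
      _ = 4 * (∫⁻ z in A, g z) * volume A := by rw [setLIntegral_const]
      _ ≤ _ := by
          rw [mul_right_comm]
          gcongr
          exact le_self_add
  · rw [lintegral_lintegral_swap]
    · calc ∫⁻ y in B, ∫⁻ x in A, A.indicator g (y + t • (x - y))
          ≤ ∫⁻ y in B, 4 * ∫⁻ z in A, g z := by
            refine setLIntegral_mono' hBm fun y _ => ?_
            refine (setLIntegral_le_lintegral _ _).trans ?_
            have := lintegral_comp_smul_add (A.indicator g) hgA (r := t) h1 (y - t • y)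
            rw [lintegral_indicator hA] at this
            refine le_trans (le_of_eq ?_) this
            congr 1; ext x; congr 1
            module
        _ = 4 * (∫⁻ z in A, g z) * volume B := by rw [setLIntegral_const]
        _ ≤ _ := by
            rw [mul_right_comm]
            gcongr
            exact le_add_self
    · refine Measurable.aemeasurable ?_
      exact hgA.comp (f := fun p : Plane × Plane => p.2 + t • (p.1 - p.2)) (by fun_prop)

/-- The segment bound integrated over `A × B`. Tonelli moves the segment parameter outside, after
which each fixed parameter is covered by `lintegral_lintegral_segment_le`. -/
theorem lintegral_lintegral_sub_sq_le {A B : Set Plane} (hA : MeasurableSet A)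
    (hBm : MeasurableSet B) {D : ℝ}
    (h : ∀ x ∈ A, ∀ y ∈ B, ∀ t ∈ Set.Icc (0 : ℝ) 1, y + t • (x - y) ∈ A)
    (hD : ∀ x ∈ A, ∀ y ∈ B, ‖x - y‖ ≤ D)
    {w : Fn} (hw : ContDiff ℝ ((⊤ : ℕ∞) : WithTop ℕ∞) w) :
    ∫⁻ x in A, ∫⁻ y in B, ‖w x - w y‖ₑ ^ 2 ≤
      ENNReal.ofReal (D ^ 2) * (4 * (volume A + volume B) * ∫⁻ z in A, gradSq w z) := by
  have hg := measurable_gradSq hw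
  have hm : Measurable fun p : (Plane × Plane) × ℝ => gradSq w (p.1.2 + p.2 • (p.1.1 - p.1.2)) :=
    hg.comp (by fun_prop)
  calc ∫⁻ x in A, ∫⁻ y in B, ‖w x - w y‖ₑ ^ 2
      ≤ ∫⁻ x in A, ∫⁻ y in B, ENNReal.ofReal (D ^ 2) *
          ∫⁻ t in Set.Icc (0 : ℝ) 1, gradSq w (y + t • (x - y)) := by
        refine setLIntegral_mono' hA fun x hx => setLIntegral_mono' hBm fun y hy => ?_
        refine (enorm_sub_sq_le_segment hw x y).trans ?_
        gcongr
        exact hD x hx y hy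
    _ = ENNReal.ofReal (D ^ 2) * ∫⁻ x in A, ∫⁻ y in B,
          ∫⁻ t in Set.Icc (0 : ℝ) 1, gradSq w (y + t • (x - y)) := by
        have h2 : Measurable fun p : Plane × Plane =>
            ∫⁻ t in Set.Icc (0 : ℝ) 1, gradSq w (p.2 + t • (p.1 - p.2)) :=
          hm.lintegral_prod_right'
        rw [← lintegral_const_mul _ h2.lintegral_prod_right']
        congr 1; ext x
        rw [← lintegral_const_mul]
        exact h2.comp (by fun_prop)
    _ = ENNReal.ofReal (D ^ 2) * ∫⁻ t in Set.Icc (0 : ℝ) 1, ∫⁻ x in A, ∫⁻ y in B,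
          gradSq w (y + t • (x - y)) := by
        congr 1
        have h3 : ∀ x : Plane, ∫⁻ y in B, ∫⁻ t in Set.Icc (0 : ℝ) 1, gradSq w (y + t • (x - y))
            = ∫⁻ t in Set.Icc (0 : ℝ) 1, ∫⁻ y in B, gradSq w (y + t • (x - y)) := fun x => by
          rw [lintegral_lintegral_swap]
          refine Measurable.aemeasurable ?_
          exact hg.comp (f := fun p : Plane × ℝ => p.1 + p.2 • (x - p.1)) (by fun_prop)
        simp_rw [h3]
        rw [lintegral_lintegral_swap]
        refine Measurable.aemeasurable ?_
        have h4 : Measurable fun p : (Plane × ℝ) × Plane =>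
            gradSq w (p.2 + p.1.2 • (p.1.1 - p.2)) := hg.comp (by fun_prop)
        exact h4.lintegral_prod_right'
    _ ≤ ENNReal.ofReal (D ^ 2) * ∫⁻ t in Set.Icc (0 : ℝ) 1,
          4 * (volume A + volume B) * ∫⁻ z in A, gradSq w z := by
        refine mul_le_mul' le_rfl ?_
        refine setLIntegral_mono' (measurableSet_Icc (a := (0 : ℝ)) (b := 1)) fun t ht => ?_
        exact lintegral_lintegral_segment_le hA (fun x hx y hy => h x hx y hy t ht) hBm hg
    _ = _ := by rw [setLIntegral_const]; simp

/-! ### Mollification -/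

/-- The mollification of `V` by a bump function. -/
def moll (η : ContDiffBump (0 : Plane)) (V : Fn) : Fn :=
  fun x => ∫ y, (η.normed volume (x - y) : ℂ) * V y

theorem moll_eq_convolution (η : ContDiffBump (0 : Plane)) (V : Fn) :
    moll η V = convolution V (η.normed volume) (ContinuousLinearMap.lsmul ℝ ℝ).flip volume := by
  ext x
  simp only [moll, convolution, ContinuousLinearMap.flip_apply, ContinuousLinearMap.lsmul_apply,
    Complex.real_smul]

theorem moll_eq_convolution_left (η : ContDiffBump (0 : Plane)) (V : Fn) :
    moll η V = convolution (η.normed volume) V (ContinuousLinearMap.lsmul ℝ ℝ) volume := by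
  ext x
  rw [convolution_lsmul_swap]
  simp only [moll, Complex.real_smul]

theorem contDiff_moll (η : ContDiffBump (0 : Plane)) {V : Fn} (hV : LocallyIntegrable V) :
    ContDiff ℝ ((⊤ : ℕ∞) : WithTop ℕ∞) (moll η V) := by
  rw [moll_eq_convolution]
  exact η.hasCompactSupport_normed.contDiff_convolution_right _ hV η.contDiff_normed

theorem pd_moll (η : ContDiffBump (0 : Plane)) {V : Fn} (hV : LocallyIntegrable V) (i : Fin 2)
    (x : Plane) : pd i (moll η V) x =
      ∫ y, (fderiv ℝ (η.normed volume) (x - y) (EuclideanSpace.single i 1) : ℂ) * V y := by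
  rw [pd, moll_eq_convolution]
  have h := η.hasCompactSupport_normed (μ := volume).hasFDerivAt_convolution_right
    (ContinuousLinearMap.lsmul ℝ ℝ : ℝ →L[ℝ] ℂ →L[ℝ] ℂ).flip hV
    (η.contDiff_normed (n := 1)) x
  rw [h.fderiv, convolution_precompR_apply _ hV (η.hasCompactSupport_normed.fderiv ℝ)
    ((η.contDiff_normed (n := 1)).continuous_fderiv (by simp))]
  simp only [convolution, ContinuousLinearMap.flip_apply, ContinuousLinearMap.lsmul_apply,
    Complex.real_smul]

/-- Inside the domain the derivatives of a mollification are the mollified weak derivatives. -/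
theorem pd_moll_eq {K : Set Plane} (hK : IsOpen K) {v g : Fn} (hv : MemL2 K v) {i : Fin 2}
    (hg : HasWeakPartial K i v g) (η : ContDiffBump (0 : Plane)) {x : Plane}
    (hx : Metric.closedBall x η.rOut ⊆ K) :
    pd i (moll η (K.indicator v)) x = moll η (K.indicator g) x := by
  have hV : LocallyIntegrable (K.indicator v) :=
    MemLp.locallyIntegrable ((memLp_indicator_iff_restrict hK.measurableSet).2 hv) (by norm_num)
  have hd : ContDiff ℝ ((⊤ : ℕ∞) : WithTop ℕ∞) (fun y => η.normed volume (x - y)) :=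
    η.contDiff_normed.comp (contDiff_const.sub contDiff_id)
  have hs : tsupport (fun y => η.normed volume (x - y)) ⊆ Metric.closedBall x η.rOut := by
    refine closure_minimal (fun y hy => ?_) Metric.isClosed_closedBall
    have : x - y ∈ Function.support (η.normed volume) := hy
    rw [η.support_normed_eq, Metric.mem_ball, dist_zero_right] at this
    rw [Metric.mem_closedBall, dist_comm, dist_eq_norm]
    exact this.le
  have hT : IsTest K (fun y => (η.normed volume (x - y) : ℂ)) :=
    IsTest.ofReal hd ((isCompact_closedBall x η.rOut).of_isClosed_subset
      (isClosed_tsupport _) hs) (hs.trans hx)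
  -- The kernel is differentiated in `y`, not in `x`. The resulting sign cancels the one in the
  -- definition of the weak derivative.
  have hpd : ∀ y, pd i (fun y => (η.normed volume (x - y) : ℂ)) y =
      -(fderiv ℝ (η.normed volume) (x - y) (EuclideanSpace.single i 1) : ℂ) := by
    intro y
    have h1 : HasFDerivAt (fun y : Plane => x - y) (-ContinuousLinearMap.id ℝ Plane) y :=
      (hasFDerivAt_id y).const_sub x
    have h2 : HasFDerivAt (η.normed volume) (fderiv ℝ (η.normed volume) (x - y)) (x - y) :=
      ((η.contDiff_normed (n := 1)).differentiable (by simp) _).hasFDerivAt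
    have h3 := (Complex.ofRealCLM.hasFDerivAt (x := η.normed volume (x - y))).comp y (h2.comp y h1)
    rw [pd]
    have h4 : HasFDerivAt (fun y => (η.normed volume (x - y) : ℂ)) _ y := h3
    rw [h4.fderiv]
    simp
  have key := hg _ hT
  rw [pd_moll η hV]
  simp only [moll]
  have e : ∀ (k f : Fn), ∫ y, k y * K.indicator f y = ∫ y in K, f y * k y := by
    intro k f
    rw [← integral_indicator hK.measurableSet]
    congr 1; ext y
    by_cases hy : y ∈ K <;> simp [hy, mul_comm]
  rw [e (fun y => ((η.normed volume (x - y) : ℝ) : ℂ)),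
    e (fun y => ((fderiv ℝ (η.normed volume) (x - y) (EuclideanSpace.single i 1) : ℝ) : ℂ))]
  simp only [hpd, mul_neg, integral_neg] at key
  exact neg_inj.1 key

/-- The normalized bump is the density of a probability measure `ν`, so mollifying is averaging
translates. The square of an average is at most the average of the squares, and Tonelli with
translation invariance removes `ν`. -/
theorem lintegral_enorm_moll_sq_le (η : ContDiffBump (0 : Plane)) {G : Fn}
    (hG : AEStronglyMeasurable G) :
    ∫⁻ x, ‖moll η G x‖ₑ ^ 2 ≤ ∫⁻ x, ‖G x‖ₑ ^ 2 := by
  have hk : Measurable fun y => ENNReal.ofReal (η.normed volume y) :=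
    η.continuous_normed.measurable.ennreal_ofReal
  have hk1 : ∫⁻ y, ENNReal.ofReal (η.normed volume y) = 1 := by
    rw [← ofReal_integral_eq_lintegral_ofReal η.integrable_normed
      (Eventually.of_forall fun _ => η.nonneg_normed _), η.integral_normed, ENNReal.ofReal_one]
  set ν := volume.withDensity fun y => ENNReal.ofReal (η.normed volume y) with hν
  have hν1 : ν Set.univ = 1 := by rw [hν, withDensity_apply _ MeasurableSet.univ]; simpa using hk1
  have : IsProbabilityMeasure ν := ⟨hν1⟩
  have hac : ν ≪ volume := withDensity_absolutelyContinuous _ _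
  -- As `G` is measurable only up to null sets, its translates stay so with respect to `ν` only
  -- because null sets pull back to null sets.
  have hqm : ∀ x : Plane, Measure.QuasiMeasurePreserving (fun t : Plane => x - t) ν volume :=
    fun x => ⟨by fun_prop, by
      refine (hac.map (by fun_prop)).trans ?_
      exact (quasiMeasurePreserving_sub_left_of_right_invariant volume x).absolutelyContinuous⟩
  have hpt : ∀ x, ‖moll η G x‖ₑ ^ 2 ≤ ∫⁻ t, ‖G (x - t)‖ₑ ^ 2 ∂ν := by
    intro x
    have e : moll η G x = ∫ t, (η.normed volume t : ℂ) * G (x - t) := by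
      rw [moll, ← integral_sub_left_eq_self _ volume x]
      simp
    have h1 : ‖moll η G x‖ₑ ≤ ∫⁻ t, ‖G (x - t)‖ₑ ∂ν := by
      rw [e, hν, lintegral_withDensity_eq_lintegral_mul₀' hk.aemeasurable]
      · refine (enorm_integral_le_lintegral_enorm _).trans_eq ?_
        congr 1; ext t
        rw [enorm_mul, Pi.mul_apply, ← ofReal_norm ((η.normed volume t : ℝ) : ℂ),
          Complex.norm_real, Real.norm_of_nonneg (η.nonneg_normed _)]
      · exact (hG.comp_quasiMeasurePreserving (hqm x)).enorm
    calc ‖moll η G x‖ₑ ^ 2 ≤ (∫⁻ t, ‖G (x - t)‖ₑ ∂ν) ^ 2 := by gcongr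
      _ ≤ ν Set.univ * ∫⁻ t, ‖G (x - t)‖ₑ ^ 2 ∂ν :=
        sq_lintegral_le ν (hG.comp_quasiMeasurePreserving (hqm x)).enorm
      _ = _ := by rw [hν1, one_mul]
  calc ∫⁻ x, ‖moll η G x‖ₑ ^ 2 ≤ ∫⁻ x, ∫⁻ t, ‖G (x - t)‖ₑ ^ 2 ∂ν := lintegral_mono hpt
    _ = ∫⁻ t, (∫⁻ x, ‖G (x - t)‖ₑ ^ 2) ∂ν := by
      rw [lintegral_lintegral_swap]
      have hq : Measure.QuasiMeasurePreserving (fun p : Plane × Plane => p.1 - p.2)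
          (volume.prod ν) volume := by
        exact quasiMeasurePreserving_sub_of_right_invariant volume ν
      exact (hG.comp_quasiMeasurePreserving hq).enorm.pow_const 2
    _ = ∫⁻ t, (∫⁻ x, ‖G x‖ₑ ^ 2) ∂ν := by
      congr 1; ext t
      exact lintegral_sub_right_eq_self (fun x => ‖G x‖ₑ ^ 2) t
    _ = _ := by rw [lintegral_const, hν1, mul_one]

/-! ### The Poincaré inequality on star-shaped domains -/

/-- Contracting by `l` towards the centre leaves room `(1 - l) ρ`. A point `z` near `x` is the
convex combination, with weights `l` and `1 - l`, of the dilate of `x` in `K` and of a point of the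
star ball. -/
theorem closedBall_subset_of_starConvex {K : Set Plane} {x₀ : Plane} {ρ l r : ℝ} (hl0 : 0 < l)
    (hl1 : l < 1) (hstar : ∀ y ∈ Metric.ball x₀ ρ, StarConvex ℝ y K) (hr : r < (1 - l) * ρ)
    {x : Plane} (hx : x₀ + l⁻¹ • (x - x₀) ∈ K) : Metric.closedBall x r ⊆ K := by
  intro z hz
  have h1 : 0 < 1 - l := by linarith
  have hy : x₀ + (1 - l)⁻¹ • (z - x) ∈ Metric.ball x₀ ρ := by
    rw [Metric.mem_closedBall, dist_eq_norm] at hz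
    rw [Metric.mem_ball, dist_eq_norm, add_sub_cancel_left, norm_smul, norm_inv,
      Real.norm_of_nonneg h1.le, inv_mul_lt_iff₀ h1]
    linarith
  have h2 := hstar _ hy hx h1.le hl0.le (by ring)
  have e : (1 - l) • (x₀ + (1 - l)⁻¹ • (z - x)) + l • (x₀ + l⁻¹ • (x - x₀)) = z := by
    rw [smul_add, smul_add, smul_inv_smul₀ h1.ne', smul_inv_smul₀ hl0.ne']
    module
  rwa [e] at h2

/-- On the contracted domain the mollification has the mollified weak derivatives as its
derivatives, so the smooth inequality applies there. The right-hand side no longer depends on the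
mollifier or on `l`, which makes the passage to the limit possible. -/
theorem lintegral_lintegral_moll_le {K : Set Plane} (hK : IsOpen K)
    (hb : Bornology.IsBounded K) {x₀ : Plane} {ρ l : ℝ} (hl0 : 0 < l) (hl1 : l < 1)
    (hρ : 0 < ρ) (hne : K.Nonempty) (hstar : ∀ y ∈ Metric.ball x₀ ρ, StarConvex ℝ y K)
    {v : Fn} (hv : MemH1 K v)
    (η : ContDiffBump (0 : Plane)) (hη : η.rOut < (1 - l) * ρ) :
    ∫⁻ x in {x | x₀ + l⁻¹ • (x - x₀) ∈ K}, ∫⁻ y in Metric.ball x₀ (l * ρ),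
        ‖moll η (K.indicator v) x - moll η (K.indicator v) y‖ₑ ^ 2 ≤
      ENNReal.ofReal (Metric.diam K ^ 2) * (4 * (volume K + volume (Metric.ball x₀ ρ)) *
        ∑ i, ∫⁻ z in K, ‖wd K i v z‖ₑ ^ 2) := by
  set A := {x | x₀ + l⁻¹ • (x - x₀) ∈ K} with hA
  have hAo : IsOpen A := hK.preimage (by fun_prop)
  have hball : ∀ x ∈ A, Metric.closedBall x η.rOut ⊆ K := fun x hx =>
    closedBall_subset_of_starConvex hl0 hl1 hstar hη hx
  have hAK : A ⊆ K := fun x hx => hball x hx (Metric.mem_closedBall_self η.rOut_pos.le)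
  have hBK : Metric.ball x₀ ρ ⊆ K := fun y hy => (hstar y hy).mem hne
  have hBB : Metric.ball x₀ (l * ρ) ⊆ Metric.ball x₀ ρ := Metric.ball_subset_ball (by nlinarith)
  have hscale : ∀ y ∈ Metric.ball x₀ (l * ρ), x₀ + l⁻¹ • (y - x₀) ∈ Metric.ball x₀ ρ := by
    intro y hy
    rw [Metric.mem_ball, dist_eq_norm] at hy ⊢
    rwa [add_sub_cancel_left, norm_smul, norm_inv, Real.norm_of_nonneg hl0.le,
      inv_mul_lt_iff₀ hl0]
  have hV : LocallyIntegrable (K.indicator v) :=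
    MemLp.locallyIntegrable ((memLp_indicator_iff_restrict hK.measurableSet).2 hv.1) (by norm_num)
  refine (lintegral_lintegral_sub_sq_le hAo.measurableSet
    Metric.isOpen_ball.measurableSet (D := Metric.diam K) ?_ ?_ (contDiff_moll η hV)).trans ?_
  -- The contracted domain is star-shaped with respect to the contracted ball: dilate both points,
  -- use `hstar`, and contract back.
  · intro x hx y hy t ht
    have := hstar _ (hscale y hy) hx (sub_nonneg.2 ht.2) ht.1 (by ring)
    rw [hA, Set.mem_ofPred_eq]
    convert this using 1
    module
  · intro x hx y hy
    rw [← dist_eq_norm]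
    exact Metric.dist_le_diam_of_mem hb (hAK hx) (hBK (hBB hy))
  · gcongr
    have hm : ∀ i : Fin 2, AEStronglyMeasurable (K.indicator (wd K i v)) volume := fun i =>
      ((memLp_indicator_iff_restrict hK.measurableSet).2 (hv.memL2_wd i)).aestronglyMeasurable
    calc ∫⁻ z in A, gradSq (moll η (K.indicator v)) z
        = ∫⁻ z in A, ∑ i, ‖moll η (K.indicator (wd K i v)) z‖ₑ ^ 2 := by
          refine setLIntegral_congr_fun hAo.measurableSet fun z hz => ?_
          refine Finset.sum_congr rfl fun i _ => ?_
          rw [pd_moll_eq hK hv.1 (hv.wd_spec i).2 η (hball z hz)]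
      _ ≤ ∫⁻ z, ∑ i, ‖moll η (K.indicator (wd K i v)) z‖ₑ ^ 2 := setLIntegral_le_lintegral _ _
      _ = ∑ i, ∫⁻ z, ‖moll η (K.indicator (wd K i v)) z‖ₑ ^ 2 := by
          refine lintegral_finsetSum _ fun i _ => ?_
          refine Measurable.pow_const ?_ 2
          refine (contDiff_moll η ?_).continuous.enorm.measurable
          exact MemLp.locallyIntegrable
            ((memLp_indicator_iff_restrict hK.measurableSet).2 (hv.memL2_wd i)) (by norm_num)
      _ ≤ ∑ i, ∫⁻ z in K, ‖wd K i v z‖ₑ ^ 2 := by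
          refine Finset.sum_le_sum fun i _ => (lintegral_enorm_moll_sq_le η (hm i)).trans_eq ?_
          rw [← lintegral_indicator hK.measurableSet]
          congr 1; ext z
          by_cases hz : z ∈ K <;> simp [hz]

/-- The contraction factor tends to 1 while the mollifications converge almost everywhere. Fatou's
lemma, once for each variable, preserves the uniform bound. -/
theorem lintegral_lintegral_sub_sq_le_of_starConvex {K : Set Plane} (hK : IsOpen K)
    (hb : Bornology.IsBounded K) {x₀ : Plane} {ρ : ℝ} (hρ : 0 < ρ) (hne : K.Nonempty)
    (hstar : ∀ y ∈ Metric.ball x₀ ρ, StarConvex ℝ y K) {v : Fn} (hv : MemH1 K v) :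
    ∫⁻ x in K, ∫⁻ y in Metric.ball x₀ ρ, ‖v x - v y‖ₑ ^ 2 ≤
      ENNReal.ofReal (Metric.diam K ^ 2) * (4 * (volume K + volume (Metric.ball x₀ ρ)) *
        ∑ i, ∫⁻ z in K, ‖wd K i v z‖ₑ ^ 2) := by
  set B := Metric.ball x₀ ρ with hB
  have hBK : B ⊆ K := fun y hy => (hstar y hy).mem hne
  set M := ENNReal.ofReal (Metric.diam K ^ 2) * (4 * (volume K + volume B) *
        ∑ i, ∫⁻ z in K, ‖wd K i v z‖ₑ ^ 2) with hM
  -- The contraction factor will be `1 - d m`. The shift by 2 keeps `d m` strictly below 1 also for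
  -- `m = 0`.
  let d : ℕ → ℝ := fun m => 1 / ((m : ℝ) + 2)
  have hd0 : ∀ m, 0 < d m := fun m => by positivity
  have hd1 : ∀ m, d m < 1 := fun m => by
    rw [div_lt_one (by positivity)]; linarith [(Nat.cast_nonneg m : (0 : ℝ) ≤ m)]
  have hdt : Tendsto d atTop (𝓝 0) := by
    have h1 : Tendsto (fun m : ℕ => (m : ℝ) + 2) atTop atTop :=
      tendsto_atTop_add_const_right _ _ tendsto_natCast_atTop_atTop
    exact h1.inv_tendsto_atTop.congr fun m => (one_div _).symm
  -- The outer radius is half of the room `d m * ρ` that the contraction leaves. The fixed ratio 2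
  -- of the radii is what almost everywhere convergence requires.
  let η : ℕ → ContDiffBump (0 : Plane) := fun m =>
    { rIn := d m * ρ / 4
      rOut := d m * ρ / 2
      rIn_pos := by have := hd0 m; positivity
      rIn_lt_rOut := by have := mul_pos (hd0 m) hρ; linarith }
  have hη : ∀ m, (η m).rOut < (1 - (1 - d m)) * ρ := fun m => by
    have := mul_pos (hd0 m) hρ
    change d m * ρ / 2 < _
    linarith
  set V := K.indicator v with hVdef
  have hV2 : MemLp V 2 volume := (memLp_indicator_iff_restrict hK.measurableSet).2 hv.1
  have hV : LocallyIntegrable V := hV2.locallyIntegrable (by norm_num)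
  let A : ℕ → Set Plane := fun m => {x | x₀ + (1 - d m)⁻¹ • (x - x₀) ∈ K}
  let B' : ℕ → Set Plane := fun m => Metric.ball x₀ ((1 - d m) * ρ)
  have hAo : ∀ m, IsOpen (A m) := fun m => hK.preimage (by fun_prop)
  let w : ℕ → Fn := fun m => moll (η m) V
  have hw : ∀ m, Continuous (w m) := fun m => (contDiff_moll (η m) hV).continuous
  -- Indicators place all the integrands on the fixed product of `K` and the ball, as Fatou's lemma
  -- needs. Each pair of points is eventually inside, since `K` and the ball are open.
  let F : ℕ → Plane × Plane → ENNReal := fun m =>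
    (A m ×ˢ B' m).indicator fun p => ‖w m p.1 - w m p.2‖ₑ ^ 2
  have hF : ∀ m, Measurable (F m) := fun m => by
    refine Measurable.indicator ?_ ((hAo m).measurableSet.prod Metric.isOpen_ball.measurableSet)
    have : Continuous fun p : Plane × Plane => w m p.1 - w m p.2 :=
      ((hw m).comp continuous_fst).sub ((hw m).comp continuous_snd)
    exact this.enorm.measurable.pow_const 2
  have hFM : ∀ m, ∫⁻ x in K, ∫⁻ y in B, F m (x, y) ≤ M := fun m => by
    calc ∫⁻ x in K, ∫⁻ y in B, F m (x, y) ≤ ∫⁻ x, ∫⁻ y, F m (x, y) := by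
          refine (setLIntegral_le_lintegral _ _).trans (lintegral_mono fun x => ?_)
          exact setLIntegral_le_lintegral _ _
      _ = ∫⁻ x in A m, ∫⁻ y in B' m, ‖w m x - w m y‖ₑ ^ 2 := by
          rw [← lintegral_indicator (hAo m).measurableSet]
          congr 1; ext x
          by_cases hx : x ∈ A m
          · rw [Set.indicator_of_mem hx,
              ← lintegral_indicator (Metric.isOpen_ball.measurableSet : MeasurableSet (B' m))]
            congr 1; ext y
            by_cases hy : y ∈ B' m
            · rw [Set.indicator_of_mem hy]
              simp [F, hx, hy]
            · rw [Set.indicator_of_notMem hy]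
              simp [F, hx, hy]
          · simp [F, hx]
      _ ≤ M := lintegral_lintegral_moll_le hK hb (by linarith [hd1 m]) (by linarith [hd0 m]) hρ
          hne hstar hv (η m) (hη m)
  have hconv : ∀ᵐ x ∂(volume : Measure Plane), Tendsto (fun m => w m x) atTop (𝓝 (V x)) := by
    have := ContDiffBump.ae_convolution_tendsto_right_of_locallyIntegrable (μ := volume) (φ := η)
      (l := atTop) (K := 2) (by
        have := (hdt.mul_const (ρ / 2))
        rw [zero_mul] at this
        exact this.congr fun m => by change d m * (ρ / 2) = d m * ρ / 2; ring)
      (Eventually.of_forall fun m => by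
        change d m * ρ / 2 ≤ 2 * (d m * ρ / 4)
        linarith) hV
    simpa only [w, moll_eq_convolution_left] using this
  have hcont : ∀ x : Plane, Tendsto (fun m => x₀ + (1 - d m)⁻¹ • (x - x₀)) atTop (𝓝 x) := by
    intro x
    have h1 : Tendsto (fun m => (1 - d m)⁻¹) atTop (𝓝 1) := by
      simpa using (hdt.const_sub 1).inv₀ (by norm_num)
    simpa using (h1.smul_const (x - x₀)).const_add x₀
  have hlim : ∀ x ∈ K, ∀ y ∈ B, Tendsto (fun m => w m x) atTop (𝓝 (V x)) →
      Tendsto (fun m => w m y) atTop (𝓝 (V y)) →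
      ‖v x - v y‖ₑ ^ 2 = liminf (fun m => F m (x, y)) atTop := by
    intro x hx y hy h1 h2
    have hVx : V x = v x := Set.indicator_of_mem hx v
    have hVy : V y = v y := Set.indicator_of_mem (hBK hy) v
    rw [hVx] at h1
    rw [hVy] at h2
    symm
    apply Tendsto.liminf_eq
    have h3 : Tendsto (fun m => ‖w m x - w m y‖ₑ ^ 2) atTop (𝓝 (‖v x - v y‖ₑ ^ 2)) :=
      ENNReal.Tendsto.pow (h1.sub h2).enorm
    refine h3.congr' ?_
    have h5 : ∀ᶠ m in atTop, y ∈ B' m := by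
      have h6 : Tendsto (fun m => (1 - d m) * ρ) atTop (𝓝 ρ) := by
        simpa using (hdt.const_sub 1).mul_const ρ
      exact h6.eventually (lt_mem_nhds hy)
    filter_upwards [(hcont x).eventually (hK.mem_nhds hx), h5] with m h7 h8
    have h9 : x ∈ A m := h7
    simp [F, h9, h8]
  calc ∫⁻ x in K, ∫⁻ y in B, ‖v x - v y‖ₑ ^ 2
      ≤ ∫⁻ x in K, ∫⁻ y in B, liminf (fun m => F m (x, y)) atTop := by
        refine lintegral_mono_ae ?_
        filter_upwards [ae_restrict_of_ae hconv, ae_restrict_mem hK.measurableSet] with x h1 hx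
        refine lintegral_mono_ae ?_
        filter_upwards [ae_restrict_of_ae hconv,
          ae_restrict_mem Metric.isOpen_ball.measurableSet] with y h2 hy
        exact (hlim x hx y hy h1 h2).le
    _ ≤ ∫⁻ x in K, liminf (fun m => ∫⁻ y in B, F m (x, y)) atTop := by
        refine lintegral_mono fun x => ?_
        exact lintegral_liminf_le fun m => (hF m).comp (by fun_prop)
    _ ≤ liminf (fun m => ∫⁻ x in K, ∫⁻ y in B, F m (x, y)) atTop :=
        lintegral_liminf_le fun m => (hF m).lintegral_prod_right'
    _ ≤ M := by
        refine (liminf_le_liminf (Eventually.of_forall hFM)).trans_eq ?_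
        exact liminf_const M

theorem MemL2.ofReal_integral_norm_sq {U : Set Plane} {v : Fn} (hv : MemL2 U v) :
    ENNReal.ofReal (∫ x in U, ‖v x‖ ^ 2) = ∫⁻ x in U, ‖v x‖ₑ ^ 2 := by
  rw [ofReal_integral_eq_lintegral_ofReal hv.integrable_norm_sq
    (Eventually.of_forall fun _ => sq_nonneg _)]
  congr 1; ext x
  rw [ENNReal.ofReal_pow (norm_nonneg _), ofReal_norm]

theorem semi1_eq_l2norm (U : Set Plane) (v : Fn) : semi1 U v = l2norm U (fun i => wd U i v) := rfl

/-- The Poincaré inequality on a domain of diameter `D` that is star-shaped with respect to a ball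
of radius `ρ`. -/
theorem exists_integral_norm_sub_sq_le {K : Set Plane} (hK : IsOpen K)
    (hb : Bornology.IsBounded K) {x₀ : Plane} {ρ : ℝ} (hρ : 0 < ρ) (hne : K.Nonempty)
    (hstar : ∀ y ∈ Metric.ball x₀ ρ, StarConvex ℝ y K) {v : Fn} (hv : MemH1 K v) :
    ∃ c : ℂ, ∫ x in K, ‖v x - c‖ ^ 2 ≤
      4 * (1 + (Metric.diam K / ρ) ^ 2) * (Metric.diam K * semi1 K v) ^ 2 := by
  set D := Metric.diam K
  have hD : 0 ≤ D := Metric.diam_nonneg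
  set B := Metric.ball x₀ ρ with hB
  have hBK : B ⊆ K := fun y hy => (hstar y hy).mem hne
  have hx₀ : x₀ ∈ K := hBK (Metric.mem_ball_self hρ)
  have hB0 : volume B ≠ 0 := (Metric.measure_ball_pos volume x₀ hρ).ne'
  have hBt : volume B ≠ ⊤ := measure_ball_lt_top.ne
  -- The domain lies in the disc of radius `D` about the centre, so the ratio of areas is at most
  -- `(D/ρ)²`.
  have hKB : volume K ≤ ENNReal.ofReal ((D / ρ) ^ 2) * volume B := by
    have h1 : K ⊆ Metric.closedBall x₀ D := fun x hx => Metric.dist_le_diam_of_mem hb hx hx₀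
    refine (measure_mono h1).trans_eq ?_
    rw [Measure.addHaar_closedBall volume x₀ hD, hB, Measure.addHaar_ball volume x₀ hρ.le,
      ← mul_assoc, ← ENNReal.ofReal_mul (by positivity), finrank_euclideanSpace, Fintype.card_fin,
      div_pow, div_mul_cancel₀ _ (by positivity)]
  set S := ∑ i, ∫⁻ z in K, ‖wd K i v z‖ₑ ^ 2 with hS
  have hSs : S = ENNReal.ofReal (semi1 K v ^ 2) := by
    rw [semi1_eq_l2norm, l2norm_sq_eq_sum hv.memL2_wd,
      ENNReal.ofReal_sum_of_nonneg fun i _ => integral_nonneg fun _ => sq_nonneg _]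
    exact Finset.sum_congr rfl fun i _ => ((hv.memL2_wd i).ofReal_integral_norm_sq).symm
  have hvm : AEStronglyMeasurable v (volume.restrict K) := hv.1.aestronglyMeasurable
  have hvB : AEStronglyMeasurable v (volume.restrict B) :=
    hvm.mono_measure (Measure.restrict_mono hBK le_rfl)
  have hmeas : AEMeasurable (fun p : Plane × Plane => ‖v p.1 - v p.2‖ₑ ^ 2)
      ((volume.restrict K).prod (volume.restrict B)) :=
    (hvm.comp_fst.sub hvB.comp_snd).enorm.pow_const 2
  have hmain := lintegral_lintegral_sub_sq_le_of_starConvex hK hb hρ hne hstar hv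
  rw [lintegral_lintegral_swap hmeas] at hmain
  -- Some `y` in the ball makes the inner integral no larger than its mean. The constant is the
  -- value of `v` at that point, so no mean value of `v` is needed.
  obtain ⟨y, -, hy⟩ := exists_le_setLAverage hB0 hBt
    (f := fun y => ∫⁻ x in K, ‖v x - v y‖ₑ ^ 2) hmeas.lintegral_prod_left'
  refine ⟨v y, ?_⟩
  have : IsFiniteMeasure (volume.restrict K) := ⟨by
    rw [Measure.restrict_apply_univ]; exact hb.measure_lt_top⟩
  have hvc : MemL2 K fun x => v x - v y := hv.1.sub (memLp_const (v y))
  rw [← ENNReal.ofReal_le_ofReal_iff (by positivity), hvc.ofReal_integral_norm_sq]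
  refine hy.trans ?_
  rw [setLAverage_eq, ENNReal.div_le_iff_le_mul (Or.inl hB0) (Or.inl hBt)]
  refine hmain.trans ?_
  rw [← hS, hSs, ← hB]
  calc ENNReal.ofReal (D ^ 2) * (4 * (volume K + volume B) * ENNReal.ofReal (semi1 K v ^ 2))
      ≤ ENNReal.ofReal (D ^ 2) * (4 * (ENNReal.ofReal ((D / ρ) ^ 2) * volume B + volume B)
        * ENNReal.ofReal (semi1 K v ^ 2)) := by gcongr
    _ = (4 * (1 + ENNReal.ofReal ((D / ρ) ^ 2)) *
        (ENNReal.ofReal (D ^ 2) * ENNReal.ofReal (semi1 K v ^ 2))) * volume B := by ring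
    _ = _ := by
        rw [ENNReal.ofReal_mul (by positivity), ENNReal.ofReal_mul (by norm_num),
          ENNReal.ofReal_add (by norm_num) (by positivity), mul_pow,
          ENNReal.ofReal_mul (by positivity)]
        norm_num

/-! ### Sobolev norms as `L²` norms of families of derivatives -/

/-- The `L²(U)` norm. -/
def norm0 (U : Set Plane) (v : Fn) : ℝ := l2norm U fun _ : Unit => v

theorem norm0_nonneg (U : Set Plane) (v : Fn) : 0 ≤ norm0 U v := l2norm_nonneg _

theorem norm0_sq (U : Set Plane) (v : Fn) : norm0 U v ^ 2 = ∫ x in U, ‖v x‖ ^ 2 := by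
  rw [norm0, l2norm_sq]; simp

theorem norm0_congr {U : Set Plane} {v w : Fn} (h : v =ᵐ[volume.restrict U] w) :
    norm0 U v = norm0 U w := l2norm_congr fun _ => h

theorem norm0_add_le {U : Set Plane} {v w : Fn} (hv : MemL2 U v) (hw : MemL2 U w) :
    norm0 U (v + w) ≤ norm0 U v + norm0 U w :=
  l2norm_add_le (F := fun _ : Unit => v) (G := fun _ : Unit => w) (fun _ => hv) fun _ => hw

theorem norm_integral_mul_star_le {U : Set Plane} {v w : Fn} (hv : MemL2 U v) (hw : MemL2 U w) :
    ‖∫ x in U, v x * star (w x)‖ ≤ norm0 U v * norm0 U w := by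
  have := norm_l2ip_le (F := fun _ : Unit => v) (G := fun _ : Unit => w) (fun _ => hv) fun _ => hw
  simpa [l2ip, norm0] using this

/-- The gradient. -/
def grad (U : Set Plane) (v : Fn) : Fin 2 → Fn := fun i => wd U i v

/-- The Hessian. -/
def hessian (U : Set Plane) (v : Fn) : Fin 2 × Fin 2 → Fn := fun p => hess U v p.1 p.2

theorem semi1_eq (U : Set Plane) (v : Fn) : semi1 U v = l2norm U (grad U v) := rfl

theorem semi2_eq (U : Set Plane) (v : Fn) : semi2 U v = l2norm U (hessian U v) := by
  simp only [semi2, l2norm, hessian, Fintype.sum_prod_type]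

theorem aGrad_eq (U : Set Plane) (v w : Fn) : aGrad U v w = l2ip U (grad U v) (grad U w) := rfl

theorem aDelta_eq (U : Set Plane) (v w : Fn) :
    aDelta U v w = l2ip U (hessian U v) (hessian U w) := by
  simp only [aDelta, l2ip, hessian, Fintype.sum_prod_type]

theorem semi1_nonneg (U : Set Plane) (v : Fn) : 0 ≤ semi1 U v := l2norm_nonneg _

theorem semi2_nonneg (U : Set Plane) (v : Fn) : 0 ≤ semi2 U v := Real.sqrt_nonneg _

theorem MemH1.memL2_grad {U : Set Plane} {v : Fn} (h : MemH1 U v) (i : Fin 2) :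
    MemL2 U (grad U v i) := h.memL2_wd i

theorem MemH2.memL2_hessian {U : Set Plane} {v : Fn} (h : MemH2 U v) (p : Fin 2 × Fin 2) :
    MemL2 U (hessian U v p) := h.memL2_hess p.1 p.2

theorem grad_add {U : Set Plane} (hU : IsOpen U) {v w : Fn} (hv : MemH1 U v) (hw : MemH1 U w)
    (i : Fin 2) : grad U (v + w) i =ᵐ[volume.restrict U] (grad U v + grad U w) i :=
  wd_add hU hv hw i

theorem grad_smul {U : Set Plane} (hU : IsOpen U) {v : Fn} (hv : MemH1 U v) (c : ℂ)
    (i : Fin 2) : grad U (c • v) i =ᵐ[volume.restrict U] (c • grad U v) i :=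
  wd_smul hU hv c i

theorem hessian_add {U : Set Plane} (hU : IsOpen U) {v w : Fn} (hv : MemH2 U v) (hw : MemH2 U w)
    (p : Fin 2 × Fin 2) :
    hessian U (v + w) p =ᵐ[volume.restrict U] (hessian U v + hessian U w) p :=
  hess_add hU hv hw p.1 p.2

theorem hessian_smul {U : Set Plane} (hU : IsOpen U) {v : Fn} (hv : MemH2 U v) (c : ℂ)
    (p : Fin 2 × Fin 2) : hessian U (c • v) p =ᵐ[volume.restrict U] (c • hessian U v) p :=
  hess_smul hU hv c p.1 p.2

theorem semi1_congr {U : Set Plane} (hU : IsOpen U) {v w : Fn} (hv : MemH1 U v)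
    (h : v =ᵐ[volume.restrict U] w) : semi1 U v = semi1 U w :=
  l2norm_congr fun i => wd_congr hU hv h i

theorem semi2_congr {U : Set Plane} (hU : IsOpen U) {v w : Fn} (hv : MemH2 U v)
    (h : v =ᵐ[volume.restrict U] w) : semi2 U v = semi2 U w := by
  rw [semi2_eq, semi2_eq]
  exact l2norm_congr fun p => hess_congr hU hv h p.1 p.2

theorem semi1_add_le {U : Set Plane} (hU : IsOpen U) {v w : Fn} (hv : MemH1 U v)
    (hw : MemH1 U w) : semi1 U (v + w) ≤ semi1 U v + semi1 U w := by
  rw [semi1_eq, l2norm_congr (grad_add hU hv hw)]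
  exact l2norm_add_le hv.memL2_grad hw.memL2_grad

theorem semi2_add_le {U : Set Plane} (hU : IsOpen U) {v w : Fn} (hv : MemH2 U v)
    (hw : MemH2 U w) : semi2 U (v + w) ≤ semi2 U v + semi2 U w := by
  rw [semi2_eq, semi2_eq, semi2_eq, l2norm_congr (hessian_add hU hv hw)]
  exact l2norm_add_le hv.memL2_hessian hw.memL2_hessian

theorem semi1_smul {U : Set Plane} (hU : IsOpen U) {v : Fn} (hv : MemH1 U v) (c : ℂ) :
    semi1 U (c • v) = ‖c‖ * semi1 U v := by
  rw [semi1_eq, l2norm_congr (grad_smul hU hv c), l2norm_smul, semi1_eq]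

theorem semi2_smul {U : Set Plane} (hU : IsOpen U) {v : Fn} (hv : MemH2 U v) (c : ℂ) :
    semi2 U (c • v) = ‖c‖ * semi2 U v := by
  rw [semi2_eq, l2norm_congr (hessian_smul hU hv c), l2norm_smul, semi2_eq]

theorem sub_eq_add_smul (v w : Fn) : v - w = v + (-1 : ℂ) • w := by
  rw [neg_one_smul, sub_eq_add_neg]

theorem MemH1.sub {U : Set Plane} {v w : Fn} (hv : MemH1 U v) (hw : MemH1 U w) :
    MemH1 U (v - w) := by
  rw [sub_eq_add_smul]; exact hv.add (hw.smul _)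

theorem MemH2.sub {U : Set Plane} (hU : IsOpen U) {v w : Fn} (hv : MemH2 U v)
    (hw : MemH2 U w) : MemH2 U (v - w) := by
  rw [sub_eq_add_smul]; exact hv.add hU (hw.smul hU _)

theorem semi1_sub_le {U : Set Plane} (hU : IsOpen U) {v w : Fn} (hv : MemH1 U v)
    (hw : MemH1 U w) : semi1 U (v - w) ≤ semi1 U v + semi1 U w := by
  rw [sub_eq_add_smul]
  refine (semi1_add_le hU hv (hw.smul _)).trans_eq ?_
  rw [semi1_smul hU hw]; simp

theorem semi2_sub_le {U : Set Plane} (hU : IsOpen U) {v w : Fn} (hv : MemH2 U v)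
    (hw : MemH2 U w) : semi2 U (v - w) ≤ semi2 U v + semi2 U w := by
  rw [sub_eq_add_smul]
  refine (semi2_add_le hU hv (hw.smul hU _)).trans_eq ?_
  rw [semi2_smul hU hw]; simp

theorem l2norm_sumElim {ι κ : Type} [Fintype ι] [Fintype κ] {U : Set Plane} {F : ι → Fn}
    {G : κ → Fn} (hF : ∀ i, MemL2 U (F i)) (hG : ∀ i, MemL2 U (G i)) :
    l2norm U (Sum.elim F G) = Real.sqrt (l2norm U F ^ 2 + l2norm U G ^ 2) := by
  rw [← Real.sqrt_sq (l2norm_nonneg (Sum.elim F G)), l2norm_sq_eq_sum hF, l2norm_sq_eq_sum hG,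
    l2norm_sq_eq_sum (by rintro (i | i); exacts [hF i, hG i]), Fintype.sum_sum_type]
  rfl

/-- A function and its first derivatives. -/
def jet1 (U : Set Plane) (v : Fn) : Unit ⊕ Fin 2 → Fn := Sum.elim (fun _ => v) (grad U v)

/-- A function and its derivatives of order at most two. -/
def jet2 (U : Set Plane) (v : Fn) : (Unit ⊕ Fin 2) ⊕ Fin 2 × Fin 2 → Fn :=
  Sum.elim (jet1 U v) (hessian U v)

theorem MemH1.memL2_jet1 {U : Set Plane} {v : Fn} (h : MemH1 U v) (i : Unit ⊕ Fin 2) :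
    MemL2 U (jet1 U v i) := by
  rcases i with i | i
  exacts [h.1, h.memL2_wd i]

theorem MemH2.memL2_jet2 {U : Set Plane} {v : Fn} (h : MemH2 U v)
    (i : (Unit ⊕ Fin 2) ⊕ Fin 2 × Fin 2) : MemL2 U (jet2 U v i) := by
  rcases i with i | i
  exacts [h.1.memL2_jet1 i, h.memL2_hessian i]

theorem norm1_sq (U : Set Plane) (v : Fn) : norm1 U v ^ 2 = norm0 U v ^ 2 + semi1 U v ^ 2 := by
  rw [norm1, ← norm0_sq, Real.sq_sqrt (by positivity)]

theorem norm2_sq (U : Set Plane) (v : Fn) :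
    norm2 U v ^ 2 = norm0 U v ^ 2 + semi1 U v ^ 2 + semi2 U v ^ 2 := by
  rw [norm2, ← norm0_sq, Real.sq_sqrt (by positivity)]

theorem norm1_nonneg (U : Set Plane) (v : Fn) : 0 ≤ norm1 U v := Real.sqrt_nonneg _

theorem norm2_nonneg (U : Set Plane) (v : Fn) : 0 ≤ norm2 U v := Real.sqrt_nonneg _

theorem norm0_le_norm1 (U : Set Plane) (v : Fn) : norm0 U v ≤ norm1 U v :=
  le_of_sq_le_sq (by rw [norm1_sq]; nlinarith [sq_nonneg (semi1 U v)]) (norm1_nonneg _ _)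

theorem semi1_le_norm1 (U : Set Plane) (v : Fn) : semi1 U v ≤ norm1 U v :=
  le_of_sq_le_sq (by rw [norm1_sq]; nlinarith [sq_nonneg (norm0 U v)]) (norm1_nonneg _ _)

theorem norm1_le_norm2 (U : Set Plane) (v : Fn) : norm1 U v ≤ norm2 U v :=
  le_of_sq_le_sq (by rw [norm1_sq, norm2_sq]; nlinarith [sq_nonneg (semi2 U v)])
    (norm2_nonneg _ _)

theorem semi2_le_norm2 (U : Set Plane) (v : Fn) : semi2 U v ≤ norm2 U v :=
  le_of_sq_le_sq (by rw [norm2_sq]; nlinarith [sq_nonneg (norm0 U v), sq_nonneg (semi1 U v)])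
    (norm2_nonneg _ _)

theorem norm1_eq {U : Set Plane} {v : Fn} (h : MemH1 U v) : norm1 U v = l2norm U (jet1 U v) := by
  rw [jet1, l2norm_sumElim (fun _ => h.1) h.memL2_grad, norm1, ← norm0_sq]
  rfl

theorem norm2_eq {U : Set Plane} {v : Fn} (h : MemH2 U v) : norm2 U v = l2norm U (jet2 U v) := by
  rw [jet2, l2norm_sumElim h.1.memL2_jet1 h.memL2_hessian, ← norm1_eq h.1, norm1_sq, norm2,
    ← norm0_sq, semi2_eq]

theorem norm1_add_le {U : Set Plane} (hU : IsOpen U) {v w : Fn} (hv : MemH1 U v)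
    (hw : MemH1 U w) : norm1 U (v + w) ≤ norm1 U v + norm1 U w := by
  have h : ∀ i, jet1 U (v + w) i =ᵐ[volume.restrict U] (jet1 U v + jet1 U w) i := by
    rintro (i | i)
    exacts [EventuallyEq.rfl, grad_add hU hv hw i]
  rw [norm1_eq (hv.add hw), norm1_eq hv, norm1_eq hw, l2norm_congr h]
  exact l2norm_add_le hv.memL2_jet1 hw.memL2_jet1

theorem norm2_add_le {U : Set Plane} (hU : IsOpen U) {v w : Fn} (hv : MemH2 U v)
    (hw : MemH2 U w) : norm2 U (v + w) ≤ norm2 U v + norm2 U w := by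
  have h : ∀ i, jet2 U (v + w) i =ᵐ[volume.restrict U] (jet2 U v + jet2 U w) i := by
    rintro ((i | i) | i)
    exacts [EventuallyEq.rfl, grad_add hU hv.1 hw.1 i, hessian_add hU hv hw i]
  rw [norm2_eq (hv.add hU hw), norm2_eq hv, norm2_eq hw, l2norm_congr h]
  exact l2norm_add_le hv.memL2_jet2 hw.memL2_jet2

theorem norm1_smul {U : Set Plane} (hU : IsOpen U) {v : Fn} (hv : MemH1 U v) (c : ℂ) :
    norm1 U (c • v) = ‖c‖ * norm1 U v := by
  have h : ∀ i, jet1 U (c • v) i =ᵐ[volume.restrict U] (c • jet1 U v) i := by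
    rintro (i | i)
    exacts [EventuallyEq.rfl, grad_smul hU hv c i]
  rw [norm1_eq (hv.smul c), norm1_eq hv, l2norm_congr h, l2norm_smul]

theorem norm2_smul {U : Set Plane} (hU : IsOpen U) {v : Fn} (hv : MemH2 U v) (c : ℂ) :
    norm2 U (c • v) = ‖c‖ * norm2 U v := by
  have h : ∀ i, jet2 U (c • v) i =ᵐ[volume.restrict U] (c • jet2 U v) i := by
    rintro ((i | i) | i)
    exacts [EventuallyEq.rfl, grad_smul hU hv.1 c i, hessian_smul hU hv c i]
  rw [norm2_eq (hv.smul hU c), norm2_eq hv, l2norm_congr h, l2norm_smul]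

/-! ### The spaces `H¹₀` and `H²₀` and the Friedrichs inequalities -/

theorem IsTest.smul {U : Set Plane} {φ : Fn} (c : ℂ) (h : IsTest U φ) : IsTest U (c • φ) :=
  ⟨contDiff_const.smul h.1, h.2.1.smul_left (f := fun _ => c),
    (closure_mono (Function.support_const_smul_subset c φ)).trans h.2.2⟩

theorem MemH01.add {U : Set Plane} (hU : IsOpen U) (hb : Bornology.IsBounded U) {v w : Fn}
    (hv : MemH01 U v) (hw : MemH01 U w) : MemH01 U (v + w) := by
  obtain ⟨hv1, φ, hφ, hφt⟩ := hv
  obtain ⟨hw1, ψ, hψ, hψt⟩ := hw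
  refine ⟨hv1.add hw1, fun m => φ m + ψ m, fun m => (hφ m).add (hψ m), ?_⟩
  refine squeeze_zero (fun _ => norm1_nonneg _ _) (fun m => ?_)
    (by simpa using hφt.add hψt)
  rw [add_sub_add_comm]
  exact norm1_add_le hU (hv1.sub (memH1_of_contDiff hb (hφ m).1))
    (hw1.sub (memH1_of_contDiff hb (hψ m).1))

theorem MemH01.smul {U : Set Plane} (hU : IsOpen U) (hb : Bornology.IsBounded U) {v : Fn} (c : ℂ)
    (hv : MemH01 U v) : MemH01 U (c • v) := by
  obtain ⟨hv1, φ, hφ, hφt⟩ := hv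
  refine ⟨hv1.smul c, fun m => c • φ m, fun m => (hφ m).smul c, ?_⟩
  have : ∀ m, norm1 U (c • v - c • φ m) = ‖c‖ * norm1 U (v - φ m) := fun m => by
    rw [← smul_sub, norm1_smul hU (hv1.sub (memH1_of_contDiff hb (hφ m).1))]
  simp_rw [this]
  simpa using hφt.const_mul ‖c‖

theorem MemH02.add {U : Set Plane} (hU : IsOpen U) (hb : Bornology.IsBounded U) {v w : Fn}
    (hv : MemH02 U v) (hw : MemH02 U w) : MemH02 U (v + w) := by
  obtain ⟨hv1, φ, hφ, hφt⟩ := hv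
  obtain ⟨hw1, ψ, hψ, hψt⟩ := hw
  refine ⟨hv1.add hU hw1, fun m => φ m + ψ m, fun m => (hφ m).add (hψ m), ?_⟩
  refine squeeze_zero (fun _ => norm2_nonneg _ _) (fun m => ?_)
    (by simpa using hφt.add hψt)
  rw [add_sub_add_comm]
  exact norm2_add_le hU (hv1.sub hU (memH2_of_contDiff hU hb (hφ m).1))
    (hw1.sub hU (memH2_of_contDiff hU hb (hψ m).1))

theorem MemH02.smul {U : Set Plane} (hU : IsOpen U) (hb : Bornology.IsBounded U) {v : Fn} (c : ℂ)
    (hv : MemH02 U v) : MemH02 U (c • v) := by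
  obtain ⟨hv1, φ, hφ, hφt⟩ := hv
  refine ⟨hv1.smul hU c, fun m => c • φ m, fun m => (hφ m).smul c, ?_⟩
  have : ∀ m, norm2 U (c • v - c • φ m) = ‖c‖ * norm2 U (v - φ m) := fun m => by
    rw [← smul_sub, norm2_smul hU (hv1.sub hU (memH2_of_contDiff hU hb (hφ m).1))]
  simp_rw [this]
  simpa using hφt.const_mul ‖c‖

theorem MemH02.memH01 {U : Set Plane} {v : Fn} (hv : MemH02 U v) : MemH01 U v := by
  obtain ⟨hv1, φ, hφ, hφt⟩ := hv
  exact ⟨hv1.1, φ, hφ, squeeze_zero (fun _ => norm1_nonneg _ _) (fun _ => norm1_le_norm2 _ _) hφt⟩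

theorem norm0_le_l2norm {ι : Type} [Fintype ι] {U : Set Plane} {F : ι → Fn}
    (hF : ∀ i, MemL2 U (F i)) (i : ι) : norm0 U (F i) ≤ l2norm U F := by
  refine le_of_sq_le_sq ?_ (l2norm_nonneg _)
  rw [norm0_sq, l2norm_sq_eq_sum hF]
  exact Finset.single_le_sum (f := fun i => ∫ x in U, ‖F i x‖ ^ 2)
    (fun _ _ => integral_nonneg fun _ => sq_nonneg _) (Finset.mem_univ i)

theorem semi1_wd_le_semi2 {U : Set Plane} {v : Fn} (hv : MemH2 U v) (j : Fin 2) :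
    semi1 U (wd U j v) ≤ semi2 U v := by
  refine le_of_sq_le_sq ?_ (semi2_nonneg _ _)
  rw [semi2_eq, semi1_eq, l2norm_sq_eq_sum hv.memL2_hessian,
    l2norm_sq_eq_sum (hv.2 j).memL2_grad, Fintype.sum_prod_type]
  exact Finset.sum_le_sum fun i _ => Finset.single_le_sum
    (f := fun j => ∫ x in U, ‖hessian U v (i, j) x‖ ^ 2)
    (fun _ _ => integral_nonneg fun _ => sq_nonneg _) (Finset.mem_univ j)

theorem semi1_sq_eq {U : Set Plane} {v : Fn} (hv : MemH1 U v) :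
    semi1 U v ^ 2 = ∑ i, norm0 U (wd U i v) ^ 2 := by
  rw [semi1_eq, l2norm_sq_eq_sum hv.memL2_grad]
  exact Finset.sum_congr rfl fun i _ => (norm0_sq _ _).symm

theorem semi2_sq_eq {U : Set Plane} {v : Fn} (hv : MemH2 U v) :
    semi2 U v ^ 2 = ∑ j, semi1 U (wd U j v) ^ 2 := by
  rw [semi2_eq, l2norm_sq_eq_sum hv.memL2_hessian, Fintype.sum_prod_type, Finset.sum_comm]
  refine Finset.sum_congr rfl fun j _ => ?_
  rw [semi1_eq, l2norm_sq_eq_sum (hv.2 j).memL2_grad]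
  rfl

/-- Derivatives of the approximating test functions are test functions, and the `H¹` norm of a
derivative is at most the `H²` norm. -/
theorem MemH02.memH01_wd {U : Set Plane} (hU : IsOpen U) (hb : Bornology.IsBounded U) {v : Fn}
    (hv : MemH02 U v) (j : Fin 2) : MemH01 U (wd U j v) := by
  obtain ⟨hv1, φ, hφ, hφt⟩ := hv
  refine ⟨hv1.2 j, fun m => pd j (φ m), fun m => (hφ m).pd j, ?_⟩
  refine squeeze_zero (fun _ => norm1_nonneg _ _) (fun m => ?_) hφt
  have hφ2 := memH2_of_contDiff hU hb (hφ m).1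
  have hd := hv1.sub hU hφ2
  have e : wd U j v - pd j (φ m) =ᵐ[volume.restrict U] wd U j (v - φ m) := by
    have h1 := wd_add hU hv1.1 (hφ2.1.smul (-1)) j
    have h2 := wd_smul hU hφ2.1 (-1) j
    have h3 := wd_of_contDiff hU hb (hφ m).1 j
    rw [sub_eq_add_smul v]
    filter_upwards [h1, h2, h3] with x h1 h2 h3
    rw [h1, Pi.add_apply, h2]
    simp only [Pi.sub_apply, Pi.smul_apply, smul_eq_mul, h3]
    ring
  have h4 : norm1 U (wd U j v - pd j (φ m)) = norm1 U (wd U j (v - φ m)) := by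
    rw [norm1, norm1, ← norm0_sq, ← norm0_sq, norm0_congr e,
      semi1_congr hU ((hv1.2 j).sub (memH1_of_contDiff hb (contDiff_pd (hφ m).1 j))) e]
  rw [h4]
  refine le_of_sq_le_sq ?_ (norm2_nonneg _ _)
  rw [norm1_sq, norm2_sq]
  have h5 := semi1_wd_le_semi2 hd j
  have h6 : norm0 U (wd U j (v - φ m)) ≤ semi1 U (v - φ m) := norm0_le_l2norm hd.1.memL2_grad j
  have h7 := pow_le_pow_left₀ (semi1_nonneg _ _) h5 2
  have h8 := pow_le_pow_left₀ (norm0_nonneg _ _) h6 2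
  nlinarith [sq_nonneg (norm0 U (v - φ m))]

/-- Integration by parts of `1 = ∂₀ x₀` against `|φ|²` gives `∫ |φ|² = -∫ x₀ ∂₀|φ|²`, and `|x₀| ≤ R`
on the domain. -/
theorem integral_norm_sq_le_of_test {U : Set Plane} {R : ℝ} (hR : U ⊆ Metric.closedBall 0 R)
    {φ : Fn} (hφ : IsTest U φ) :
    ∫ x, ‖φ x‖ ^ 2 ≤ 4 * R ^ 2 * ∫ x, ‖pd 0 φ x‖ ^ 2 := by
  have hs : ContDiff ℝ ((⊤ : ℕ∞) : WithTop ℕ∞) fun x => star (φ x) :=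
    Complex.conjCLE.contDiff.comp hφ.1
  have ht : IsTest U fun x => φ x * star (φ x) :=
    ⟨hφ.1.mul hs, hφ.2.1.mul_right, (tsupport_mul_subset_left).trans hφ.2.2⟩
  have hc : ContDiff ℝ ((⊤ : ℕ∞) : WithTop ℕ∞) fun x : Plane => ((x 0 : ℝ) : ℂ) :=
    Complex.ofRealCLM.contDiff.comp (EuclideanSpace.proj (𝕜 := ℝ) (0 : Fin 2)).contDiff
  have hpc : ∀ x : Plane, pd 0 (fun x : Plane => ((x 0 : ℝ) : ℂ)) x = 1 := by
    intro x
    have h1 : HasFDerivAt (fun x : Plane => ((x 0 : ℝ) : ℂ))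
        (Complex.ofRealCLM.comp (EuclideanSpace.proj (𝕜 := ℝ) (0 : Fin 2))) x :=
      (Complex.ofRealCLM.comp (EuclideanSpace.proj (𝕜 := ℝ) (0 : Fin 2))).hasFDerivAt
    rw [pd, h1.fderiv]
    simp
  have hpm : ∀ x, pd 0 (fun x => φ x * star (φ x)) x =
      φ x * star (pd 0 φ x) + pd 0 φ x * star (φ x) := by
    intro x
    have h1 : HasFDerivAt φ (fderiv ℝ φ x) x := ((hφ.1.differentiable (by simp)) x).hasFDerivAt
    have h2 : HasFDerivAt (fun x => star (φ x))
        ((Complex.conjCLE : ℂ →L[ℝ] ℂ).comp (fderiv ℝ φ x)) x :=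
      (Complex.conjCLE : ℂ →L[ℝ] ℂ).hasFDerivAt.comp x h1
    have h3 : HasFDerivAt (fun x => φ x * star (φ x)) _ x := h1.mul h2
    rw [pd, h3.fderiv, pd]
    simp [mul_comm]
  have key := hasWeakPartial_of_contDiff (U := U) hc 0 _ ht
  rw [setIntegral_eq_of_test (ht.pd 0), setIntegral_eq_of_test ht] at key
  simp only [hpc, one_mul, hpm] at key
  have hint : Integrable fun x => ‖φ x‖ ^ 2 := by
    simpa using (hφ.memL2 (V := Set.univ)).integrable_norm_sq
  have hint' : Integrable fun x => ‖pd 0 φ x‖ ^ 2 := by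
    simpa using ((hφ.pd 0).memL2 (V := Set.univ)).integrable_norm_sq
  have e1 : ∫ x, φ x * star (φ x) = ((∫ x, ‖φ x‖ ^ 2 : ℝ) : ℂ) := by
    rw [← integral_complex_ofReal]
    congr 1; ext x
    rw [Complex.star_def, Complex.mul_conj, Complex.normSq_eq_norm_sq]
  rw [e1] at key
  -- Young's inequality weighted so that half of the left side can be absorbed; doubling `2 R²` then
  -- gives `4 R²`.
  have h3 : ∫ x, ‖φ x‖ ^ 2 ≤ ∫ x, (1 / 2 * ‖φ x‖ ^ 2 + 2 * R ^ 2 * ‖pd 0 φ x‖ ^ 2) := by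
    have h4 : ‖((∫ x, ‖φ x‖ ^ 2 : ℝ) : ℂ)‖ = ∫ x, ‖φ x‖ ^ 2 := by
      rw [Complex.norm_real, Real.norm_of_nonneg (integral_nonneg fun _ => sq_nonneg _)]
    rw [← h4, ← norm_neg, ← key]
    refine norm_integral_le_of_norm_le ((hint.const_mul _).add (hint'.const_mul _))
      (Eventually.of_forall fun x => ?_)
    by_cases hx : x ∈ U
    · have h5 : |x 0| ≤ R := by
        have h6 := hR hx
        rw [mem_closedBall_zero_iff] at h6
        exact (by simpa using PiLp.norm_apply_le x 0 : |x 0| ≤ ‖x‖).trans h6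
      have hR0 : 0 ≤ R := (abs_nonneg _).trans h5
      calc ‖((x 0 : ℝ) : ℂ) * (φ x * star (pd 0 φ x) + pd 0 φ x * star (φ x))‖
          ≤ |x 0| * (‖φ x‖ * ‖pd 0 φ x‖ + ‖pd 0 φ x‖ * ‖φ x‖) := by
            rw [norm_mul, Complex.norm_real, Real.norm_eq_abs]
            gcongr
            refine (norm_add_le _ _).trans_eq ?_
            simp
        _ ≤ R * (‖φ x‖ * ‖pd 0 φ x‖ + ‖pd 0 φ x‖ * ‖φ x‖) := by gcongr
        _ ≤ _ := by nlinarith [sq_nonneg (‖φ x‖ - 2 * R * ‖pd 0 φ x‖)]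
    · simp only [hφ.eq_zero hx, (hφ.pd 0).eq_zero hx]
      simp
  rw [integral_add (hint.const_mul _) (hint'.const_mul _), integral_const_mul,
    integral_const_mul] at h3
  linarith

/-- The Friedrichs inequality in `H¹₀`. -/
theorem norm0_le_mul_semi1 {U : Set Plane} (hU : IsOpen U) {R : ℝ} (hR0 : 0 ≤ R)
    (hR : U ⊆ Metric.closedBall 0 R) {v : Fn} (hv : MemH01 U v) :
    norm0 U v ≤ 2 * R * semi1 U v := by
  have hb : Bornology.IsBounded U := Metric.isBounded_closedBall.subset hR
  obtain ⟨hv1, φ, hφ, hφt⟩ := hv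
  have htest : ∀ m, norm0 U (φ m) ≤ 2 * R * semi1 U (φ m) := by
    intro m
    have hφ1 := memH1_of_contDiff hb (hφ m).1
    refine le_of_sq_le_sq ?_ (mul_nonneg (by positivity) (semi1_nonneg _ _))
    have h1 := integral_norm_sq_le_of_test hR (hφ m)
    have e : ∀ {ψ : Fn}, IsTest U ψ → ∫ x in U, ‖ψ x‖ ^ 2 = ∫ x, ‖ψ x‖ ^ 2 := fun hψ =>
      setIntegral_eq_integral_of_forall_compl_eq_zero fun x hx => by simp [hψ.eq_zero hx]
    have h2 : norm0 U (pd 0 (φ m)) ^ 2 ≤ semi1 U (φ m) ^ 2 := by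
      rw [norm0_congr (wd_of_contDiff hU hb (hφ m).1 0).symm]
      exact pow_le_pow_left₀ (norm0_nonneg _ _) (norm0_le_l2norm hφ1.memL2_grad 0) 2
    rw [norm0_sq, e ((hφ m).pd 0)] at h2
    rw [norm0_sq, e (hφ m), mul_pow]
    refine h1.trans ?_
    rw [mul_pow]
    nlinarith [sq_nonneg R]
  -- In the factor `1 + 2 R`, the 1 pays for replacing `v` by `φ m` in `L²` and `2 R` for the way
  -- back in the seminorm.
  have hle : ∀ m, norm0 U v ≤ (1 + 2 * R) * norm1 U (v - φ m) + 2 * R * semi1 U v := by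
    intro m
    have hφ1 := memH1_of_contDiff hb (hφ m).1
    have hd := hv1.sub hφ1
    have h1 : norm0 U v ≤ norm0 U (v - φ m) + norm0 U (φ m) := by
      have := norm0_add_le hd.1 hφ1.1
      rwa [sub_add_cancel] at this
    have h2 : semi1 U (φ m) ≤ semi1 U v + semi1 U (v - φ m) := by
      have := semi1_sub_le hU hv1 hd
      rwa [sub_sub_cancel] at this
    have h3 := norm0_le_norm1 U (v - φ m)
    have h4 := semi1_le_norm1 U (v - φ m)
    nlinarith [htest m, mul_le_mul_of_nonneg_left (h2.trans (add_le_add_right h4 _))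
      (by positivity : 0 ≤ 2 * R)]
  have hlim : Tendsto (fun m => (1 + 2 * R) * norm1 U (v - φ m) + 2 * R * semi1 U v) atTop
      (𝓝 (2 * R * semi1 U v)) := by
    simpa using (hφt.const_mul (1 + 2 * R)).add_const (2 * R * semi1 U v)
  exact ge_of_tendsto' hlim hle

/-- The Friedrichs inequality in `H²₀`. -/
theorem semi1_le_mul_semi2 {U : Set Plane} (hU : IsOpen U) {R : ℝ} (hR0 : 0 ≤ R)
    (hR : U ⊆ Metric.closedBall 0 R) {v : Fn} (hv : MemH02 U v) :
    semi1 U v ≤ 2 * R * semi2 U v := by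
  have hb : Bornology.IsBounded U := Metric.isBounded_closedBall.subset hR
  refine le_of_sq_le_sq ?_ (mul_nonneg (by positivity) (semi2_nonneg _ _))
  rw [semi1_sq_eq hv.1.1, mul_pow, semi2_sq_eq hv.1, Finset.mul_sum]
  refine Finset.sum_le_sum fun j _ => ?_
  rw [← mul_pow]
  exact pow_le_pow_left₀ (norm0_nonneg _ _)
    (norm0_le_mul_semi1 hU hR0 hR (hv.memH01_wd hU hb j)) 2

/-! ### Polynomials in two variables as functions -/

/-- Evaluation of a polynomial at the points of the plane. -/
def evalFn : MvPolynomial (Fin 2) ℂ →ₗ[ℂ] Fn where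
  toFun P x := MvPolynomial.eval (fun i => (x i : ℂ)) P
  map_add' P Q := by ext x; simp
  map_smul' c P := by ext x; simp [MvPolynomial.smul_eval]

theorem evalFn_apply (P : MvPolynomial (Fin 2) ℂ) (x : Plane) :
    evalFn P x = MvPolynomial.eval (fun i => (x i : ℂ)) P := rfl

/-- `ℙ_k` as a submodule. -/
def polySub (k : ℕ) : Submodule ℂ Fn :=
  (MvPolynomial.restrictTotalDegree (Fin 2) ℂ k).map evalFn

instance (k : ℕ) : FiniteDimensional ℂ (polySub k) := by
  unfold polySub; infer_instance

theorem mem_PolyFn_iff {k : ℕ} {p : Fn} :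
    p ∈ PolyFn k ↔ ∃ P : MvPolynomial (Fin 2) ℂ, P.totalDegree ≤ k ∧ p = evalFn P := by
  constructor
  · rintro ⟨P, h, e⟩
    exact ⟨P, h, funext e⟩
  · rintro ⟨P, h, rfl⟩
    exact ⟨P, h, fun _ => rfl⟩

theorem mem_polySub {k : ℕ} {p : Fn} : p ∈ polySub k ↔ p ∈ PolyFn k := by
  rw [polySub, Submodule.mem_map, mem_PolyFn_iff]
  simp only [MvPolynomial.mem_restrictTotalDegree, eq_comm]

theorem polyFn_add {k : ℕ} {p q : Fn} (hp : p ∈ PolyFn k) (hq : q ∈ PolyFn k) :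
    p + q ∈ PolyFn k :=
  mem_polySub.1 ((polySub k).add_mem (mem_polySub.2 hp) (mem_polySub.2 hq))

theorem polyFn_smul {k : ℕ} {p : Fn} (c : ℂ) (hp : p ∈ PolyFn k) : c • p ∈ PolyFn k :=
  mem_polySub.1 ((polySub k).smul_mem c (mem_polySub.2 hp))

theorem polyFn_sub {k : ℕ} {p q : Fn} (hp : p ∈ PolyFn k) (hq : q ∈ PolyFn k) :
    p - q ∈ PolyFn k :=
  mem_polySub.1 ((polySub k).sub_mem (mem_polySub.2 hp) (mem_polySub.2 hq))

theorem polyFn_zero (k : ℕ) : (0 : Fn) ∈ PolyFn k := mem_polySub.1 (polySub k).zero_mem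

theorem polyFn_mono {k l : ℕ} (h : k ≤ l) {p : Fn} (hp : p ∈ PolyFn k) : p ∈ PolyFn l := by
  obtain ⟨P, hP, e⟩ := hp
  exact ⟨P, hP.trans h, e⟩

theorem polyFn_const (k : ℕ) (c : ℂ) : (fun _ => c : Fn) ∈ PolyFn k :=
  ⟨MvPolynomial.C c, by simp, fun x => by simp⟩

theorem polyFn_coord (i : Fin 2) : (fun x => (x i : ℂ) : Fn) ∈ PolyFn 1 :=
  ⟨MvPolynomial.X i, by simp, fun x => by simp⟩

/-- Complex conjugation of functions. -/
def conjFn (p : Fn) : Fn := fun x => star (p x)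

theorem conjFn_conjFn (p : Fn) : conjFn (conjFn p) = p := by
  ext x; simp [conjFn]

theorem conjFn_add (p q : Fn) : conjFn (p + q) = conjFn p + conjFn q := by
  ext x; simp [conjFn]

theorem conjFn_smul (c : ℂ) (p : Fn) : conjFn (c • p) = star c • conjFn p := by
  ext x; simp [conjFn]

/-- Conjugation passes to the coefficients because the coordinates are real. It mediates between the
sesquilinear forms and the bilinear pairings used to construct projectors. -/
theorem polyFn_conj {k : ℕ} {p : Fn} (hp : p ∈ PolyFn k) : conjFn p ∈ PolyFn k := by
  obtain ⟨P, hP, e⟩ := hp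
  refine ⟨MvPolynomial.map (starRingEnd ℂ) P, ?_, fun x => ?_⟩
  · refine le_trans ?_ hP
    exact Finset.sup_mono (MvPolynomial.support_map_subset _ _)
  · rw [conjFn, e x, MvPolynomial.eval_map, Complex.star_def]
    have h := MvPolynomial.eval₂_comp_left (starRingEnd ℂ) (RingHom.id ℂ)
      (fun i : Fin 2 => (x i : ℂ)) P
    rw [MvPolynomial.eval₂_id] at h
    rw [h]
    congr 1
    ext i
    simp

theorem contDiff_evalFn (P : MvPolynomial (Fin 2) ℂ) :
    ContDiff ℝ ((⊤ : ℕ∞) : WithTop ℕ∞) (evalFn P) := by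
  induction P using MvPolynomial.induction_on with
  | C a => 
    have : evalFn (MvPolynomial.C a) = fun _ => a := by ext x; simp [evalFn_apply]
    rw [this]; exact contDiff_const
  | add p q hp hq => rw [map_add]; exact hp.add hq
  | mul_X p i hp =>
    have : evalFn (p * MvPolynomial.X i) = fun x => evalFn p x * (x i : ℂ) := by
      ext x; simp [evalFn_apply]
    rw [this]
    exact hp.mul (Complex.ofRealCLM.contDiff.comp (EuclideanSpace.proj (𝕜 := ℝ) i).contDiff)

theorem polyFn_contDiff {k : ℕ} {p : Fn} (hp : p ∈ PolyFn k) :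
    ContDiff ℝ ((⊤ : ℕ∞) : WithTop ℕ∞) p := by
  obtain ⟨P, -, rfl⟩ := mem_PolyFn_iff.1 hp
  exact contDiff_evalFn P

theorem pd_add {p q : Fn} (hp : ContDiff ℝ ((⊤ : ℕ∞) : WithTop ℕ∞) p)
    (hq : ContDiff ℝ ((⊤ : ℕ∞) : WithTop ℕ∞) q) (i : Fin 2) : pd i (p + q) = pd i p + pd i q := by
  ext x
  rw [pd, fderiv_add (hp.differentiable (by simp) x) (hq.differentiable (by simp) x)]
  rfl

theorem pd_smul {p : Fn} (hp : ContDiff ℝ ((⊤ : ℕ∞) : WithTop ℕ∞) p) (c : ℂ) (i : Fin 2) :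
    pd i (c • p) = c • pd i p := by
  ext x
  rw [pd, fderiv_const_smul (hp.differentiable (by simp) x)]
  rfl

theorem pd_mul {p q : Fn} (hp : ContDiff ℝ ((⊤ : ℕ∞) : WithTop ℕ∞) p)
    (hq : ContDiff ℝ ((⊤ : ℕ∞) : WithTop ℕ∞) q) (i : Fin 2) (x : Plane) :
    pd i (fun x => p x * q x) x = p x * pd i q x + pd i p x * q x := by
  have h : HasFDerivAt (fun x => p x * q x) _ x :=
    (hp.differentiable (by simp) x).hasFDerivAt.mul (hq.differentiable (by simp) x).hasFDerivAt
  rw [pd, h.fderiv]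
  simp [pd, mul_comm]

theorem pd_const (c : ℂ) (i : Fin 2) : pd i (fun _ => c) = 0 := by
  ext x; simp [pd]

theorem contDiff_coord (j : Fin 2) :
    ContDiff ℝ ((⊤ : ℕ∞) : WithTop ℕ∞) fun x : Plane => ((x j : ℝ) : ℂ) :=
  polyFn_contDiff (polyFn_coord j)

theorem pd_coord (i j : Fin 2) (x : Plane) :
    pd i (fun x : Plane => ((x j : ℝ) : ℂ)) x = if i = j then 1 else 0 := by
  have h1 : HasFDerivAt (fun x : Plane => ((x j : ℝ) : ℂ))
      (Complex.ofRealCLM.comp (EuclideanSpace.proj (𝕜 := ℝ) j)) x :=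
    (Complex.ofRealCLM.comp (EuclideanSpace.proj (𝕜 := ℝ) j)).hasFDerivAt
  rw [pd, h1.fderiv]
  by_cases h : i = j
  · subst h; simp
  · simp [h, Ne.symm h]

theorem pd_evalFn (i : Fin 2) (P : MvPolynomial (Fin 2) ℂ) :
    pd i (evalFn P) = evalFn (MvPolynomial.pderiv i P) := by
  induction P using MvPolynomial.induction_on with
  | C a =>
    have : evalFn (MvPolynomial.C a) = fun _ => a := by ext x; simp [evalFn_apply]
    rw [this, pd_const, MvPolynomial.pderiv_C, map_zero]
  | add p q hp hq =>
    rw [map_add, pd_add (contDiff_evalFn p) (contDiff_evalFn q), hp, hq, map_add, map_add]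
  | mul_X p j hp =>
    have : evalFn (p * MvPolynomial.X j) = fun x => evalFn p x * (x j : ℂ) := by
      ext x; simp [evalFn_apply]
    rw [this]
    ext x
    rw [pd_mul (contDiff_evalFn p) (contDiff_coord j), hp, pd_coord, evalFn_apply, evalFn_apply,
      evalFn_apply, MvPolynomial.pderiv_mul, MvPolynomial.pderiv_X]
    by_cases h : i = j
    · subst h; simp; ring
    · simp [h, Ne.symm h]

theorem totalDegree_pderiv_le {k : ℕ} (i : Fin 2) {P : MvPolynomial (Fin 2) ℂ}
    (hP : P.totalDegree ≤ k + 1) : (MvPolynomial.pderiv i P).totalDegree ≤ k := by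
  rw [MvPolynomial.as_sum P, map_sum]
  refine MvPolynomial.totalDegree_finsetSum_le fun s hs => ?_
  rw [MvPolynomial.pderiv_monomial]
  by_cases h : s i = 0
  · simp [h]
  · refine (MvPolynomial.totalDegree_monomial_le _ _).trans
      (?_ : ((s - Finsupp.single i 1).sum fun _ e => e) ≤ k)
    have h1 : (s.sum fun _ e => e) ≤ k + 1 := (MvPolynomial.le_totalDegree hs).trans hP
    have h2 : (s - Finsupp.single i 1) + Finsupp.single i 1 = s :=
      tsub_add_cancel_of_le (Finsupp.single_le_iff.2 (Nat.one_le_iff_ne_zero.2 h))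
    rw [← h2, Finsupp.sum_add_index' (fun _ => rfl) (fun _ _ _ => rfl),
      Finsupp.sum_single_index rfl] at h1
    omega

theorem polyFn_pd {k : ℕ} {p : Fn} (hp : p ∈ PolyFn (k + 1)) (i : Fin 2) : pd i p ∈ PolyFn k := by
  obtain ⟨P, hP, rfl⟩ := mem_PolyFn_iff.1 hp
  rw [pd_evalFn]
  exact mem_PolyFn_iff.2 ⟨_, totalDegree_pderiv_le i hP, rfl⟩

theorem polyFn_eq_const {p : Fn} (hp : p ∈ PolyFn 0) (x y : Plane) : p x = p y := by
  obtain ⟨P, hP, e⟩ := hp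
  rw [e, e, MvPolynomial.totalDegree_eq_zero_iff_eq_C.1 (Nat.le_zero.1 hP)]
  simp

theorem polyFn_pd_eq_zero {p : Fn} (hp : p ∈ PolyFn 0) (i : Fin 2) : pd i p = 0 := by
  have : p = fun _ => p 0 := funext fun x => polyFn_eq_const hp x 0
  rw [this, pd_const]

/-- A smooth function with constant partial derivatives is affine. -/
theorem eq_affine_of_pd_eq {p : Fn} (hp : ContDiff ℝ ((⊤ : ℕ∞) : WithTop ℕ∞) p) {c : Fin 2 → ℂ}
    (h : ∀ i x, pd i p x = c i) (x : Plane) : p x = p 0 + ∑ i, c i * (x i : ℂ) := by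
  have hl : ∀ i, ContDiff ℝ ((⊤ : ℕ∞) : WithTop ℕ∞) (c i • fun x : Plane => ((x i : ℝ) : ℂ)) :=
    fun i => contDiff_const.smul (contDiff_coord i)
  set l : Fn := (c 0 • fun x : Plane => ((x 0 : ℝ) : ℂ)) + (c 1 • fun x : Plane => ((x 1 : ℝ) : ℂ))
    with hldef
  have hld : ContDiff ℝ ((⊤ : ℕ∞) : WithTop ℕ∞) l := (hl 0).add (hl 1)
  have hpl : ∀ i x, pd i l x = c i := by
    intro i x
    rw [hldef, pd_add (hl 0) (hl 1), pd_smul (contDiff_coord 0), pd_smul (contDiff_coord 1)]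
    simp only [Pi.add_apply, Pi.smul_apply, pd_coord, smul_eq_mul]
    fin_cases i <;> simp
  have hd : ∀ x, fderiv ℝ (fun x => p x - l x) x = 0 := by
    intro x
    have e : fderiv ℝ (fun x => p x - l x) x = fderiv ℝ p x - fderiv ℝ l x :=
      fderiv_sub (hp.differentiable (by simp) x) (hld.differentiable (by simp) x)
    ext v
    rw [e, sub_apply, fderiv_apply_eq_sum, fderiv_apply_eq_sum]
    simp [h, hpl]
  have := is_const_of_fderiv_eq_zero (𝕜 := ℝ) ((hp.sub hld).differentiable (by simp)) hd x 0
  simp only [hldef, Pi.add_apply, Pi.smul_apply, smul_eq_mul, PiLp.zero_apply, Complex.ofReal_zero,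
    mul_zero, add_zero, sub_zero] at this
  rw [Fin.sum_univ_two, ← this]
  ring

theorem polyFn_affine (a : ℂ) (c : Fin 2 → ℂ) :
    (fun x => a + ∑ i, c i * (x i : ℂ) : Fn) ∈ PolyFn 1 := by
  have : (fun x => a + ∑ i, c i * (x i : ℂ) : Fn) = (fun _ => a) +
      (c 0 • (fun x => (x 0 : ℂ)) + c 1 • fun x => (x 1 : ℂ)) := by
    ext x; simp [Fin.sum_univ_two]
  rw [this]
  exact polyFn_add (polyFn_const 1 a)
    (polyFn_add (polyFn_smul _ (polyFn_coord 0)) (polyFn_smul _ (polyFn_coord 1)))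

theorem polyFn_eq_affine {p : Fn} (hp : p ∈ PolyFn 1) (x : Plane) :
    p x = p 0 + ∑ i, pd i p 0 * (x i : ℂ) :=
  eq_affine_of_pd_eq (polyFn_contDiff hp) (fun i x => polyFn_eq_const (polyFn_pd hp i) x 0) x

theorem polyFn_mem_one_of_pd_pd {p : Fn} (hp : p ∈ PolyFn 2)
    (h : ∀ i j x, pd i (pd j p) x = 0) : p ∈ PolyFn 1 := by
  have h1 : ∀ j x, pd j p x = pd j p 0 := fun j x => by
    simpa using eq_affine_of_pd_eq (c := 0) (polyFn_contDiff (polyFn_pd hp j)) (fun i x => h i j x) x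
  have : p = fun x => p 0 + ∑ i, pd i p 0 * (x i : ℂ) :=
    funext fun x => eq_affine_of_pd_eq (polyFn_contDiff hp) h1 x
  rw [this]
  exact polyFn_affine _ _

/-- A nondegenerate bilinear form on `ℙ_k` represents every linear functional. -/
theorem exists_poly_of_nondegenerate (k : ℕ) (T : Fn → Fn → ℂ)
    (add_left : ∀ p p' q, p ∈ PolyFn k → p' ∈ PolyFn k → q ∈ PolyFn k →
      T (p + p') q = T p q + T p' q)
    (smul_left : ∀ (c : ℂ) p q, p ∈ PolyFn k → q ∈ PolyFn k → T (c • p) q = c * T p q)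
    (add_right : ∀ p q q', p ∈ PolyFn k → q ∈ PolyFn k → q' ∈ PolyFn k →
      T p (q + q') = T p q + T p q')
    (smul_right : ∀ (c : ℂ) p q, p ∈ PolyFn k → q ∈ PolyFn k → T p (c • q) = c * T p q)
    (inj : ∀ p ∈ PolyFn k, (∀ q ∈ PolyFn k, T p q = 0) → p = 0)
    (L : Fn → ℂ) (L_add : ∀ q q', q ∈ PolyFn k → q' ∈ PolyFn k → L (q + q') = L q + L q')
    (L_smul : ∀ (c : ℂ) q, q ∈ PolyFn k → L (c • q) = c * L q) :
    ∃ p ∈ PolyFn k, ∀ q ∈ PolyFn k, T p q = L q := by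
  let B : polySub k →ₗ[ℂ] Module.Dual ℂ (polySub k) :=
    LinearMap.mk₂ ℂ (fun p q => T p q)
      (fun p p' q => add_left _ _ _ (mem_polySub.1 p.2) (mem_polySub.1 p'.2) (mem_polySub.1 q.2))
      (fun c p q => smul_left _ _ _ (mem_polySub.1 p.2) (mem_polySub.1 q.2))
      (fun p q q' => add_right _ _ _ (mem_polySub.1 p.2) (mem_polySub.1 q.2) (mem_polySub.1 q'.2))
      (fun c p q => smul_right _ _ _ (mem_polySub.1 p.2) (mem_polySub.1 q.2))
  let l : Module.Dual ℂ (polySub k) :=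
    { toFun := fun q => L q
      map_add' := fun q q' => L_add _ _ (mem_polySub.1 q.2) (mem_polySub.1 q'.2)
      map_smul' := fun c q => L_smul _ _ (mem_polySub.1 q.2) }
  have hB : Function.Injective B := by
    rw [← LinearMap.ker_eq_bot, LinearMap.ker_eq_bot']
    intro p hp
    exact Subtype.ext (inj p (mem_polySub.1 p.2) fun q hq =>
      congrArg (fun f : Module.Dual ℂ (polySub k) => f ⟨q, mem_polySub.2 hq⟩) hp)
  -- In finite dimension an injective map into the dual is onto.
  have hs : Function.Surjective B :=
    (LinearMap.injective_iff_surjective_of_finrank_eq_finrank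
      (Subspace.dual_finrank_eq).symm).1 hB
  obtain ⟨p, hp⟩ := hs l
  exact ⟨p, mem_polySub.1 p.2, fun q hq =>
    congrArg (fun f : Module.Dual ℂ (polySub k) => f ⟨q, mem_polySub.2 hq⟩) hp⟩

/-! ### The selected polynomial -/

/-- Existence alone gives the defining properties of a selected polynomial. Uniqueness enters only
where linearity of a projector or its value at polynomials is needed. -/
theorem polySelect_spec {k : ℕ} {cond : Fn → Prop} (h : ∃ p ∈ PolyFn k, cond p) :
    polySelect k cond ∈ PolyFn k ∧ cond (polySelect k cond) := by
  rw [polySelect, dif_pos h]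
  exact h.choose_spec

/-! ### The forms `∫ ∇φ·∇ψ̄` and `∫ D²u:D²v̄` -/

theorem aGrad_star (U : Set Plane) (v w : Fn) : aGrad U w v = star (aGrad U v w) :=
  l2ip_star _ _

theorem aGrad_add_left {U : Set Plane} (hU : IsOpen U) {v v' w : Fn} (hv : MemH1 U v)
    (hv' : MemH1 U v') (hw : MemH1 U w) : aGrad U (v + v') w = aGrad U v w + aGrad U v' w := by
  rw [aGrad_eq, l2ip_congr (grad_add hU hv hv') fun _ => EventuallyEq.rfl,
    l2ip_add hv.memL2_grad hv'.memL2_grad hw.memL2_grad]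
  rfl

theorem aGrad_smul_left {U : Set Plane} (hU : IsOpen U) {v : Fn} (hv : MemH1 U v) (c : ℂ)
    (w : Fn) : aGrad U (c • v) w = c * aGrad U v w := by
  rw [aGrad_eq, l2ip_congr (grad_smul hU hv c) fun _ => EventuallyEq.rfl, l2ip_smul]
  rfl

theorem aGrad_add_right {U : Set Plane} (hU : IsOpen U) {v w w' : Fn} (hv : MemH1 U v)
    (hw : MemH1 U w) (hw' : MemH1 U w') : aGrad U v (w + w') = aGrad U v w + aGrad U v w' := by
  rw [aGrad_star, aGrad_add_left hU hw hw' hv, star_add, ← aGrad_star, ← aGrad_star]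

theorem aGrad_smul_right {U : Set Plane} (hU : IsOpen U) {w : Fn} (hw : MemH1 U w) (c : ℂ)
    (v : Fn) : aGrad U v (c • w) = star c * aGrad U v w := by
  rw [aGrad_star, aGrad_smul_left hU hw, star_mul', ← aGrad_star]

theorem aGrad_sub_left {U : Set Plane} (hU : IsOpen U) {v v' w : Fn} (hv : MemH1 U v)
    (hv' : MemH1 U v') (hw : MemH1 U w) : aGrad U (v - v') w = aGrad U v w - aGrad U v' w := by
  rw [sub_eq_add_smul, aGrad_add_left hU hv (hv'.smul _) hw, aGrad_smul_left hU hv']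
  ring

theorem aGrad_self_re (U : Set Plane) (v : Fn) : (aGrad U v v).re = semi1 U v ^ 2 :=
  l2ip_self_re _

theorem norm_aGrad_le {U : Set Plane} {v w : Fn} (hv : MemH1 U v) (hw : MemH1 U w) :
    ‖aGrad U v w‖ ≤ semi1 U v * semi1 U w := norm_l2ip_le hv.memL2_grad hw.memL2_grad

theorem aDelta_star (U : Set Plane) (v w : Fn) : aDelta U w v = star (aDelta U v w) := by
  rw [aDelta_eq, aDelta_eq, l2ip_star]

theorem aDelta_add_left {U : Set Plane} (hU : IsOpen U) {v v' w : Fn} (hv : MemH2 U v)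
    (hv' : MemH2 U v') (hw : MemH2 U w) :
    aDelta U (v + v') w = aDelta U v w + aDelta U v' w := by
  rw [aDelta_eq, l2ip_congr (hessian_add hU hv hv') fun _ => EventuallyEq.rfl,
    l2ip_add hv.memL2_hessian hv'.memL2_hessian hw.memL2_hessian, aDelta_eq, aDelta_eq]

theorem aDelta_smul_left {U : Set Plane} (hU : IsOpen U) {v : Fn} (hv : MemH2 U v) (c : ℂ)
    (w : Fn) : aDelta U (c • v) w = c * aDelta U v w := by
  rw [aDelta_eq, l2ip_congr (hessian_smul hU hv c) fun _ => EventuallyEq.rfl, l2ip_smul, aDelta_eq]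

theorem aDelta_add_right {U : Set Plane} (hU : IsOpen U) {v w w' : Fn} (hv : MemH2 U v)
    (hw : MemH2 U w) (hw' : MemH2 U w') :
    aDelta U v (w + w') = aDelta U v w + aDelta U v w' := by
  rw [aDelta_star, aDelta_add_left hU hw hw' hv, star_add, ← aDelta_star, ← aDelta_star]

theorem aDelta_smul_right {U : Set Plane} (hU : IsOpen U) {w : Fn} (hw : MemH2 U w) (c : ℂ)
    (v : Fn) : aDelta U v (c • w) = star c * aDelta U v w := by
  rw [aDelta_star, aDelta_smul_left hU hw, star_mul', ← aDelta_star]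

theorem aDelta_sub_left {U : Set Plane} (hU : IsOpen U) {v v' w : Fn} (hv : MemH2 U v)
    (hv' : MemH2 U v') (hw : MemH2 U w) :
    aDelta U (v - v') w = aDelta U v w - aDelta U v' w := by
  rw [sub_eq_add_smul, aDelta_add_left hU hv (hv'.smul hU _) hw, aDelta_smul_left hU hv']
  ring

theorem aDelta_self_re (U : Set Plane) (v : Fn) : (aDelta U v v).re = semi2 U v ^ 2 := by
  rw [aDelta_eq, l2ip_self_re, semi2_eq]

theorem norm_aDelta_le {U : Set Plane} {v w : Fn} (hv : MemH2 U v) (hw : MemH2 U w) :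
    ‖aDelta U v w‖ ≤ semi2 U v * semi2 U w := by
  rw [aDelta_eq, semi2_eq, semi2_eq]
  exact norm_l2ip_le hv.memL2_hessian hw.memL2_hessian

theorem ae_eq_zero_of_l2norm_eq_zero {ι : Type} [Fintype ι] {U : Set Plane} {F : ι → Fn}
    (hF : ∀ i, MemL2 U (F i)) (h : l2norm U F = 0) (i : ι) : F i =ᵐ[volume.restrict U] 0 := by
  have h1 : norm0 U (F i) = 0 :=
    le_antisymm ((norm0_le_l2norm hF i).trans_eq h) (norm0_nonneg _ _)
  have h2 := norm0_sq U (F i)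
  rw [h1, zero_pow two_ne_zero, eq_comm,
    integral_eq_zero_iff_of_nonneg (fun _ => sq_nonneg _) (hF i).integrable_norm_sq] at h2
  filter_upwards [h2] with x hx
  simpa using hx

/-! ### Polynomials on an open set -/

theorem eqOn_zero_of_ae {U : Set Plane} (hU : IsOpen U) {p : Fn} (hp : Continuous p)
    (h : p =ᵐ[volume.restrict U] 0) : ∀ x ∈ U, p x = 0 :=
  Measure.eqOn_open_of_ae_eq h hU hp.continuousOn continuousOn_const

/-- Induction on the degree: the partial derivatives vanish on the open set too, hence everywhere,
so the polynomial is constant. -/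
theorem polyFn_eq_zero_of_eqOn {U : Set Plane} (hU : IsOpen U) (hne : U.Nonempty) {k : ℕ} {p : Fn}
    (hp : p ∈ PolyFn k) (h : ∀ x ∈ U, p x = 0) : p = 0 := by
  obtain ⟨x₀, hx₀⟩ := hne
  induction k generalizing p with
  | zero => exact funext fun x => (polyFn_eq_const hp x x₀).trans (h x₀ hx₀)
  | succ k ih =>
    have h1 : ∀ i, pd i p = 0 := by
      intro i
      refine ih (polyFn_pd hp i) fun x hx => ?_
      have h2 : p =ᶠ[𝓝 x] fun _ => 0 := by
        filter_upwards [hU.mem_nhds hx] with y hy using h y hy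
      rw [pd, h2.fderiv_eq]
      simp
    have h2 := eq_affine_of_pd_eq (c := 0) (polyFn_contDiff hp)
      (fun i x => by rw [h1 i]; rfl)
    have h3 : p 0 = 0 := by simpa [h x₀ hx₀] using (h2 x₀).symm
    exact funext fun x => by simpa [h3] using h2 x

theorem polyFn_eq_zero_of_ae {U : Set Plane} (hU : IsOpen U) (hne : U.Nonempty) {k : ℕ} {p : Fn}
    (hp : p ∈ PolyFn k) (h : p =ᵐ[volume.restrict U] 0) : p = 0 :=
  polyFn_eq_zero_of_eqOn hU hne hp (eqOn_zero_of_ae hU (polyFn_contDiff hp).continuous h)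

/-! ### Geometry of polygons -/

namespace Element

variable (K : Element)

theorem nonempty : K.carrier.Nonempty := K.isConnected.nonempty

theorem volume_pos : 0 < volume K.carrier := K.isOpen.measure_pos volume K.nonempty

theorem volume_lt_top : volume K.carrier < ⊤ := K.isBounded.measure_lt_top

theorem isFiniteMeasure : IsFiniteMeasure (volume.restrict K.carrier) :=
  ⟨by rw [Measure.restrict_apply_univ]; exact K.volume_lt_top⟩

theorem edgePt_eq (i : Fin K.N) (t : ℝ) :
    K.edgePt i t = K.poly i + t • (K.poly (finRotate K.N i) - K.poly i) := by
  rw [edgePt, Polygon.edgePath, AffineMap.lineMap_apply, vsub_eq_sub, vadd_eq_add, add_comm]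

theorem frontier_eq' : frontier K.carrier = ⋃ i, K.edgePt i '' Set.Icc (0 : ℝ) 1 := by
  rw [K.frontier_eq, Polygon.boundary]
  rfl

theorem edgePt_mem (i : Fin K.N) {t : ℝ} (ht : t ∈ Set.Icc (0 : ℝ) 1) :
    K.edgePt i t ∈ frontier K.carrier := by
  rw [K.frontier_eq']
  exact Set.mem_iUnion.2 ⟨i, t, ht, rfl⟩

theorem vertex_mem (i : Fin K.N) : K.poly i ∈ frontier K.carrier := by
  have := K.edgePt_mem i (t := 0) (by simp)
  rwa [edgePt_eq, zero_smul, add_zero] at this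

theorem continuous_edgePt (i : Fin K.N) : Continuous (K.edgePt i) := by
  have : K.edgePt i = fun t => K.poly i + t • (K.poly (finRotate K.N i) - K.poly i) :=
    funext (K.edgePt_eq i)
  rw [this]; fun_prop

/-- The vertices are distinct, and the cyclic shift on at least three indices has no fixed point. -/
theorem edgeLen_pos (i : Fin K.N) : 0 < K.edgeLen i := by
  rw [edgeLen, dist_pos]
  intro h
  have h1 := K.injective h
  have h2 := K.three_le
  obtain ⟨m, hm⟩ : ∃ m, K.N = m + 1 := ⟨K.N - 1, by omega⟩
  have key : ∀ (n m : ℕ) (_ : n = m + 1) (_ : 3 ≤ n) (i : Fin n), i ≠ finRotate n i := by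
    rintro n m rfl hn i hi
    rw [finRotate_apply] at hi
    have : (1 : Fin (m + 1)) = 0 := by simpa using hi.symm
    have h3 := congrArg Fin.val this
    rw [Fin.val_one', Fin.val_zero, Nat.mod_eq_of_lt (by omega)] at h3
    omega
  exact key K.N m hm h2 i h1

/-- No nonconstant affine function vanishes at all vertices. -/
theorem affine_vertices {a : ℝ} {c : Fin 2 → ℝ}
    (h : ∀ i, a + ∑ j, c j * K.poly i j = 0) : c = 0 := by
  set l : Plane → ℝ := fun x => a + ∑ j, c j * x j with hl
  have hlc : Continuous l := by fun_prop
  -- An affine function that vanishes at both ends of an edge vanishes along it, and the edges make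
  -- up the frontier.
  have hfr : ∀ x ∈ frontier K.carrier, l x = 0 := by
    intro x hx
    rw [K.frontier_eq'] at hx
    obtain ⟨i, t, -, rfl⟩ := Set.mem_iUnion.1 hx
    have h1 := h i
    have h2 := h (finRotate K.N i)
    simp only [hl, edgePt_eq, Fin.sum_univ_two, PiLp.add_apply, PiLp.smul_apply, PiLp.sub_apply,
      smul_eq_mul] at h1 h2 ⊢
    linear_combination (1 - t) * h1 + t * h2
  have hcomp : IsCompact (closure K.carrier) := K.isBounded.isCompact_closure
  have hbd : ∀ x, x ∈ closure K.carrier → x ∉ K.carrier → l x = 0 := fun x hx hx' =>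
    hfr x ⟨hx, by rwa [K.isOpen.interior_eq]⟩
  by_contra hc
  have hc2 : 0 < ∑ j, c j * c j := by
    obtain ⟨j, hj⟩ := Function.ne_iff.1 hc
    exact Finset.sum_pos' (fun _ _ => mul_self_nonneg _)
      ⟨j, Finset.mem_univ j, mul_self_pos.2 hj⟩
  -- A small step along `±c` strictly raises or lowers the function, so it has no extremum in the
  -- open set. Both extrema over the closure then lie on the frontier, where the function is zero,
  -- and it would be constant.
  have hmove : ∀ x ∈ K.carrier, ∀ s : ℝ, s ≠ 0 → ∃ y ∈ K.carrier, 0 < s * (l y - l x) := by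
    intro x hx s hs
    have ht : Tendsto (fun e : ℝ => x + (s * e) • (WithLp.toLp 2 c : Plane)) (𝓝[>] 0) (𝓝 x) := by
      have : Continuous fun e : ℝ => x + (s * e) • (WithLp.toLp 2 c : Plane) := by fun_prop
      simpa using (this.tendsto 0).mono_left nhdsWithin_le_nhds
    obtain ⟨e, he1, he2⟩ := ((ht.eventually (K.isOpen.mem_nhds hx)).and
      self_mem_nhdsWithin).exists
    refine ⟨_, he1, ?_⟩
    have h1 : l (x + (s * e) • (WithLp.toLp 2 c : Plane)) - l x = s * e * ∑ j, c j * c j := by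
      simp only [hl, Fin.sum_univ_two, PiLp.add_apply, PiLp.smul_apply, smul_eq_mul]
      ring
    rw [h1]
    have he3 : 0 < e := he2
    have hs2 : 0 < s * s := mul_self_pos.2 hs
    have : s * (s * e * ∑ j, c j * c j) = (s * s) * (e * ∑ j, c j * c j) := by ring
    rw [this]
    positivity
  have hle : ∀ x ∈ K.carrier, l x ≤ 0 := by
    obtain ⟨x, hx, hmax⟩ := hcomp.exists_isMaxOn K.nonempty.closure hlc.continuousOn
    have hx' : x ∉ K.carrier := by
      intro hx'
      obtain ⟨y, hy, hlt⟩ := hmove x hx' 1 one_ne_zero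
      have := hmax (subset_closure hy)
      simp only [Set.mem_ofPred_eq] at this
      linarith
    intro y hy
    rw [← hbd x hx hx']
    exact hmax (subset_closure hy)
  have hge : ∀ x ∈ K.carrier, 0 ≤ l x := by
    obtain ⟨x, hx, hmin⟩ := hcomp.exists_isMinOn K.nonempty.closure hlc.continuousOn
    have hx' : x ∉ K.carrier := by
      intro hx'
      obtain ⟨y, hy, hlt⟩ := hmove x hx' (-1) (by norm_num)
      have := hmin (subset_closure hy)
      simp only [Set.mem_ofPred_eq] at this
      linarith
    intro y hy
    rw [← hbd x hx hx']
    exact hmin (subset_closure hy)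
  obtain ⟨x, hx⟩ := K.nonempty
  obtain ⟨y, hy, hlt⟩ := hmove x hx 1 one_ne_zero
  linarith [hle y hy, hge x hx]

theorem polyFn_eq_zero_of_vertices {p : Fn} (hp : p ∈ PolyFn 1) (h : ∀ i, p (K.poly i) = 0) :
    p = 0 := by
  have hre : (fun j => (pd j p 0).re) = 0 := by
    refine K.affine_vertices (a := (p 0).re) fun i => ?_
    have := congrArg Complex.re ((polyFn_eq_affine hp (K.poly i)).symm.trans (h i))
    simpa [Fin.sum_univ_two] using this
  have him : (fun j => (pd j p 0).im) = 0 := by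
    refine K.affine_vertices (a := (p 0).im) fun i => ?_
    have := congrArg Complex.im ((polyFn_eq_affine hp (K.poly i)).symm.trans (h i))
    simpa [Fin.sum_univ_two] using this
  have hz : ∀ j, pd j p 0 = 0 := fun j =>
    Complex.ext (congrFun hre j) (congrFun him j)
  have h1 : ∀ x, p x = p 0 := fun x => by
    rw [polyFn_eq_affine hp x]; simp [hz]
  have h2 := h ⟨0, by have := K.three_le; omega⟩
  rw [h1] at h2
  exact funext fun x => (h1 x).trans h2

theorem memH1_polyFn {k : ℕ} {p : Fn} (hp : p ∈ PolyFn k) : MemH1 K.carrier p :=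
  memH1_of_contDiff K.isBounded (polyFn_contDiff hp)

theorem memH2_polyFn {k : ℕ} {p : Fn} (hp : p ∈ PolyFn k) : MemH2 K.carrier p :=
  memH2_of_contDiff K.isOpen K.isBounded (polyFn_contDiff hp)

end Element

/-! ### Boundary values -/

theorem volume_ball_inter_pos (K : Element) {x : Plane} (hx : x ∈ closure K.carrier) {r : ℝ}
    (hr : 0 < r) : volume (Metric.ball x r ∩ K.carrier) ≠ 0 := by
  refine ((Metric.isOpen_ball.inter K.isOpen).measure_pos volume ?_).ne'
  exact mem_closure_iff_nhds.1 hx _ (Metric.ball_mem_nhds x hr)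

theorem integrableOn_ball_inter {U : Set Plane} {v : Fn} (hv : MemL2 U v) (x : Plane) (r : ℝ) :
    IntegrableOn v (Metric.ball x r ∩ U) := by
  have h1 : MemL2 (Metric.ball x r ∩ U) v := hv.mono Set.inter_subset_right
  have : IsFiniteMeasure (volume.restrict (Metric.ball x r ∩ U)) := ⟨by
    rw [Measure.restrict_apply_univ]
    exact (measure_mono Set.inter_subset_left).trans_lt measure_ball_lt_top⟩
  exact MemLp.integrable (by norm_num) h1

theorem HasBdryValue.add {U : Set Plane} {v w : Fn} (hv : MemL2 U v) (hw : MemL2 U w)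
    {x : Plane} {c d : ℂ} (h : HasBdryValue U v x c) (h' : HasBdryValue U w x d) :
    HasBdryValue U (v + w) x (c + d) := by
  refine (Tendsto.add h h').congr fun r => ?_
  rw [setAverage_eq, setAverage_eq, setAverage_eq, ← smul_add]
  congr 1
  exact (integral_add (integrableOn_ball_inter hv x r) (integrableOn_ball_inter hw x r)).symm

theorem HasBdryValue.smul {U : Set Plane} {v : Fn} {x : Plane} {d : ℂ} (c : ℂ)
    (h : HasBdryValue U v x d) : HasBdryValue U (c • v) x (c * d) := by
  refine (Tendsto.const_mul c h).congr fun r => ?_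
  rw [setAverage_eq, setAverage_eq]
  simp only [Pi.smul_apply]
  rw [integral_smul, smul_comm, smul_eq_mul]

theorem HasBdryValue.congr {U : Set Plane} {v w : Fn} {x : Plane} {d : ℂ}
    (h : HasBdryValue U v x d) (e : v =ᵐ[volume.restrict U] w) : HasBdryValue U w x d := by
  refine Tendsto.congr (fun r => ?_) h
  rw [setAverage_eq, setAverage_eq]
  congr 1
  exact integral_congr_ae (ae_restrict_of_ae_restrict_of_subset Set.inter_subset_right e)

theorem HasBdryValue.bdryValue_eq {U : Set Plane} {v : Fn} {x : Plane} {d : ℂ}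
    (h : HasBdryValue U v x d) : bdryValue U v x = d := Tendsto.limUnder_eq h

/-- Averages over a set of positive measure remain in any closed ball containing the values, by
convexity. -/
theorem hasBdryValue_of_continuous (K : Element) {v : Fn} (hv : Continuous v) {x : Plane}
    (hx : x ∈ frontier K.carrier) : HasBdryValue K.carrier v x (v x) := by
  rw [HasBdryValue, Metric.tendsto_nhds]
  intro ε hε
  obtain ⟨δ, hδ, hball⟩ := Metric.continuousAt_iff.1 hv.continuousAt (ε / 2) (half_pos hε)
  filter_upwards [Ioo_mem_nhdsGT hδ] with r hr
  have hmem : (⨍ y in Metric.ball x r ∩ K.carrier, v y) ∈ Metric.closedBall (v x) (ε / 2) := by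
    refine (convex_closedBall (v x) (ε / 2)).set_average_mem Metric.isClosed_closedBall
      (volume_ball_inter_pos K (frontier_subset_closure hx) hr.1)
      ((measure_mono Set.inter_subset_left).trans_lt measure_ball_lt_top).ne ?_
      (integrableOn_ball_inter (memL2_of_continuous K.isBounded hv) x r)
    filter_upwards [ae_restrict_mem (Metric.isOpen_ball.inter K.isOpen).measurableSet] with y hy
    exact (hball (lt_trans hy.1 hr.2)).le
  exact (Metric.mem_closedBall.1 hmem).trans_lt (half_lt_self hε)

/-! ### Existence and uniqueness of the projections -/

namespace Element

variable (K : Element)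

theorem memL2_polyFn {k : ℕ} {p : Fn} (hp : p ∈ PolyFn k) : MemL2 K.carrier p :=
  memL2_of_continuous K.isBounded (polyFn_contDiff hp).continuous

theorem integral_add_mul {v v' q : Fn} (hv : MemL2 K.carrier v) (hv' : MemL2 K.carrier v')
    (hq : MemL2 K.carrier q) : ∫ x in K.carrier, (v + v') x * q x =
      (∫ x in K.carrier, v x * q x) + ∫ x in K.carrier, v' x * q x := by
  simp only [Pi.add_apply, add_mul]
  exact integral_add (hv.integrable_mul hq) (hv'.integrable_mul hq)

theorem integral_smul_mul (c : ℂ) (v q : Fn) : ∫ x in K.carrier, (c • v) x * q x =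
      c * ∫ x in K.carrier, v x * q x := by
  simp only [Pi.smul_apply, smul_eq_mul, mul_assoc]
  exact integral_const_mul _ _

theorem integral_mul_comm (v q : Fn) : ∫ x in K.carrier, v x * q x =
    ∫ x in K.carrier, q x * v x := by simp only [mul_comm]

/-- Testing with the conjugate of `p` gives the square of its norm. -/
theorem polyFn_eq_zero_of_integral {k : ℕ} {p : Fn} (hp : p ∈ PolyFn k)
    (h : ∀ q ∈ PolyFn k, ∫ x in K.carrier, p x * q x = 0) : p = 0 := by
  have h1 : l2ip K.carrier (fun _ : Unit => p) (fun _ : Unit => p) = 0 := by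
    simpa [l2ip, conjFn] using h _ (polyFn_conj hp)
  have h2 : l2norm K.carrier (fun _ : Unit => p) = 0 := by
    have := l2ip_self_re (U := K.carrier) (fun _ : Unit => p)
    rw [h1, Complex.zero_re] at this
    exact pow_eq_zero_iff two_ne_zero |>.1 this.symm
  exact polyFn_eq_zero_of_ae K.isOpen K.nonempty hp
    (ae_eq_zero_of_l2norm_eq_zero (fun _ => K.memL2_polyFn hp) h2 ())

theorem projL2_spec (k : ℕ) {w : Fn} (hw : MemL2 K.carrier w) :
    projL2 K k w ∈ PolyFn k ∧ ∀ q ∈ PolyFn k,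
      ∫ x in K.carrier, projL2 K k w x * q x = ∫ x in K.carrier, w x * q x := by
  refine polySelect_spec (exists_poly_of_nondegenerate k
    (fun p q => ∫ x in K.carrier, p x * q x) ?_ ?_ ?_ ?_ ?_
    (fun q => ∫ x in K.carrier, w x * q x) ?_ ?_)
  · intro p p' q hp hp' hq
    exact K.integral_add_mul (K.memL2_polyFn hp) (K.memL2_polyFn hp') (K.memL2_polyFn hq)
  · intro c p q _ _
    exact K.integral_smul_mul c p q
  · intro p q q' hp hq hq'
    simp only [K.integral_mul_comm p]
    exact K.integral_add_mul (K.memL2_polyFn hq) (K.memL2_polyFn hq') (K.memL2_polyFn hp)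
  · intro c p q _ _
    simp only [K.integral_mul_comm p]
    exact K.integral_smul_mul c q p
  · intro p hp h
    exact K.polyFn_eq_zero_of_integral hp h
  · intro q q' hq hq'
    simp only [K.integral_mul_comm w]
    exact K.integral_add_mul (K.memL2_polyFn hq) (K.memL2_polyFn hq') hw
  · intro c q _
    simp only [K.integral_mul_comm w]
    exact K.integral_smul_mul c q w

/-! ### Kernels of the seminorms on polynomials, and the gradient projections -/

theorem pd_eq_zero_of_semi1 {k : ℕ} {p : Fn} (hp : p ∈ PolyFn k) (h : semi1 K.carrier p = 0)
    (i : Fin 2) (x : Plane) : pd i p x = 0 := by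
  have h1 := ae_eq_zero_of_l2norm_eq_zero (K.memH1_polyFn hp).memL2_grad h i
  have h2 : pd i p = 0 := by
    refine polyFn_eq_zero_of_ae K.isOpen K.nonempty
      (polyFn_pd (polyFn_mono (Nat.le_succ k) hp) i) ?_
    exact (wd_of_contDiff K.isOpen K.isBounded (polyFn_contDiff hp) i).symm.trans h1
  rw [h2]; rfl

theorem pd_pd_eq_zero_of_semi2 {p : Fn} (hp : p ∈ PolyFn 2) (h : semi2 K.carrier p = 0)
    (i j : Fin 2) (x : Plane) : pd i (pd j p) x = 0 := by
  rw [semi2_eq] at h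
  have h1 := ae_eq_zero_of_l2norm_eq_zero (K.memH2_polyFn hp).memL2_hessian h (i, j)
  have h2 : pd i (pd j p) = 0 := by
    refine polyFn_eq_zero_of_ae K.isOpen K.nonempty (polyFn_pd (polyFn_pd hp j) i) ?_
    exact (hess_of_contDiff K.isOpen K.isBounded (polyFn_contDiff hp) i j).symm.trans h1
  rw [h2]; rfl

theorem aGrad_const_right (v : Fn) (c : ℂ) : aGrad K.carrier v (fun _ => c) = 0 := by
  have h : ∀ i, grad K.carrier (fun _ => c) i =ᵐ[volume.restrict K.carrier] 0 := fun i => by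
    have := wd_of_contDiff K.isOpen K.isBounded (v := fun _ => c) contDiff_const i
    rwa [pd_const] at this
  rw [aGrad_eq, l2ip_congr (G' := fun _ => 0) (fun _ => EventuallyEq.rfl) h]
  simp [l2ip]

theorem eq_const_of_aGrad {k : ℕ} {p : Fn} (hp : p ∈ PolyFn k)
    (h : aGrad K.carrier p p = 0) : ∀ x, p x = p 0 := by
  have h1 := aGrad_self_re K.carrier p
  rw [h, Complex.zero_re] at h1
  have h2 : semi1 K.carrier p = 0 := pow_eq_zero_iff two_ne_zero |>.1 h1.symm
  intro x
  have := eq_affine_of_pd_eq (c := 0) (polyFn_contDiff hp)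
    (fun i x => by rw [K.pd_eq_zero_of_semi1 hp h2 i x]; rfl) x
  simpa using this

theorem eq_zero_of_aGrad {k : ℕ} {m : Fn → ℂ}
    (m_smul : ∀ (c : ℂ) p, p ∈ PolyFn k → m (c • p) = c * m p) (m_one : m (fun _ => 1) ≠ 0)
    {p : Fn} (hp : p ∈ PolyFn k) (h : aGrad K.carrier p p = 0) (hm : m p = 0) : p = 0 := by
  have h1 := K.eq_const_of_aGrad hp h
  have h2 : p = p 0 • fun _ => (1 : ℂ) := funext fun x => by simp [h1 x]
  rw [h2, m_smul _ _ (polyFn_const k 1)] at hm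
  rcases mul_eq_zero.1 hm with h3 | h3
  · rw [h2, h3, zero_smul]
  · exact absurd h3 m_one

/-- Both gradient projectors are covered, with `m` the integral over the element or over its
boundary. Adding `m p * m q` to the gradient form yields one nondegenerate bilinear form; testing
with 1, on which the gradient vanishes, recovers the two conditions separately. The prescribed value
`d` is arbitrary, so a projection exists even for a function whose boundary integral is not known to
be a genuine trace integral. -/
theorem exists_grad_projection (k : ℕ) {m : Fn → ℂ}
    (m_add : ∀ p q, p ∈ PolyFn k → q ∈ PolyFn k → m (p + q) = m p + m q)
    (m_smul : ∀ (c : ℂ) p, p ∈ PolyFn k → m (c • p) = c * m p) (m_one : m (fun _ => 1) ≠ 0)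
    {w : Fn} (hw : MemH1 K.carrier w) (d : ℂ) :
    ∃ p ∈ PolyFn k, (∀ q ∈ PolyFn k, aGrad K.carrier p q = aGrad K.carrier w q) ∧ m p = d := by
  have hU := K.isOpen
  have hP : ∀ {p : Fn}, p ∈ PolyFn k → MemH1 K.carrier p := fun hp => K.memH1_polyFn hp
  have hconj1 : conjFn (fun _ => 1) = fun _ => 1 := by ext x; simp [conjFn]
  obtain ⟨p, hp, h⟩ := exists_poly_of_nondegenerate k
    (fun p q => aGrad K.carrier p (conjFn q) + m p * m q)
    (by
      intro p p' q hp hp' hq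
      simp only [aGrad_add_left hU (hP hp) (hP hp') (hP (polyFn_conj hq)), m_add p p' hp hp']
      ring)
    (by
      intro c p q hp hq
      simp only [aGrad_smul_left hU (hP hp), m_smul c p hp]
      ring)
    (by
      intro p q q' hp hq hq'
      simp only [conjFn_add, m_add q q' hq hq',
        aGrad_add_right hU (hP hp) (hP (polyFn_conj hq)) (hP (polyFn_conj hq'))]
      ring)
    (by
      intro c p q hp hq
      simp only [conjFn_smul, m_smul c q hq, aGrad_smul_right hU (hP (polyFn_conj hq)), star_star]
      ring)
    (by
      intro p hp h
      have h1 := h _ (polyFn_const k 1)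
      rw [hconj1, K.aGrad_const_right, zero_add] at h1
      have hmp : m p = 0 := (mul_eq_zero.1 h1).resolve_right m_one
      have h2 := h _ (polyFn_conj hp)
      rw [conjFn_conjFn, hmp, zero_mul, add_zero] at h2
      exact K.eq_zero_of_aGrad m_smul m_one hp h2 hmp)
    (fun q => aGrad K.carrier w (conjFn q) + d * m q)
    (by
      intro q q' hq hq'
      simp only [conjFn_add, m_add q q' hq hq',
        aGrad_add_right hU hw (hP (polyFn_conj hq)) (hP (polyFn_conj hq'))]
      ring)
    (by
      intro c q hq
      simp only [conjFn_smul, m_smul c q hq, aGrad_smul_right hU (hP (polyFn_conj hq)), star_star]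
      ring)
  have hm : m p = d := by
    have h1 := h _ (polyFn_const k 1)
    rw [hconj1, K.aGrad_const_right, K.aGrad_const_right, zero_add, zero_add] at h1
    exact mul_right_cancel₀ m_one h1
  refine ⟨p, hp, fun q hq => ?_, hm⟩
  have h1 := h _ (polyFn_conj hq)
  rw [conjFn_conjFn, hm] at h1
  exact add_right_cancel h1

theorem projGrad2_spec {w : Fn} (hw : MemH1 K.carrier w) :
    projGrad2 K w ∈ PolyFn 2 ∧
      ∀ q ∈ PolyFn 2, aGrad K.carrier (projGrad2 K w) q = aGrad K.carrier w q := by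
  have := polySelect_spec (K.exists_grad_projection 2 (m := fun p => ∫ x in K.carrier, p x)
    (by
      intro p q hp hq
      have := K.isFiniteMeasure
      exact integral_add (MemLp.integrable (by norm_num) (K.memL2_polyFn hp))
        (MemLp.integrable (by norm_num) (K.memL2_polyFn hq)))
    (by
      intro c p _
      exact integral_const_mul _ _)
    (by
      rw [integral_const, measureReal_restrict_apply_univ]
      have : volume.real K.carrier ≠ 0 :=
        (ENNReal.toReal_pos K.volume_pos.ne' K.volume_lt_top.ne).ne'
      simpa using this)
    hw (∫ x in K.carrier, w x))
  exact ⟨this.1, this.2.1⟩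

/-! ### Boundary integrals -/

/-- `ψ` has a continuous trace. -/
def HasContTrace (ψ : Fn) : Prop :=
  MemL2 K.carrier ψ ∧ ∃ b : Fn, ContinuousOn b (frontier K.carrier) ∧
    ∀ i, ∀ᵐ t ∂(volume.restrict (Set.Icc (0 : ℝ) 1)),
      HasBdryValue K.carrier ψ (K.edgePt i t) (b (K.edgePt i t))

theorem bdryInt_eq {ψ b : Fn}
    (h : ∀ i, ∀ᵐ t ∂(volume.restrict (Set.Icc (0 : ℝ) 1)),
      HasBdryValue K.carrier ψ (K.edgePt i t) (b (K.edgePt i t))) :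
    K.bdryInt ψ = ∑ i, (K.edgeLen i : ℂ) * ∫ t in Set.Icc (0 : ℝ) 1, b (K.edgePt i t) := by
  refine Finset.sum_congr rfl fun i _ => ?_
  rw [intervalIntegral.integral_of_le zero_le_one, ← integral_Icc_eq_integral_Ioc]
  congr 1
  refine integral_congr_ae ?_
  filter_upwards [h i] with t ht using ht.bdryValue_eq

theorem integrableOn_edge {b : Fn} (hb : ContinuousOn b (frontier K.carrier)) (i : Fin K.N) :
    IntegrableOn (fun t => b (K.edgePt i t)) (Set.Icc (0 : ℝ) 1) :=
  (hb.comp (K.continuous_edgePt i).continuousOn fun _ ht => K.edgePt_mem i ht).integrableOn_Icc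

/-- Boundary values are limits selected by `limUnder`; additivity is ensured where both limits
exist, which is why traces along almost every edge point are required. -/
theorem bdryInt_add {ψ χ : Fn} (h : K.HasContTrace ψ) (h' : K.HasContTrace χ) :
    K.bdryInt (ψ + χ) = K.bdryInt ψ + K.bdryInt χ := by
  obtain ⟨h2, b, hb, hv⟩ := h
  obtain ⟨h2', b', hb', hv'⟩ := h'
  have hs : ∀ i, ∀ᵐ t ∂(volume.restrict (Set.Icc (0 : ℝ) 1)),
      HasBdryValue K.carrier (ψ + χ) (K.edgePt i t) ((b + b') (K.edgePt i t)) := fun i => by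
    filter_upwards [hv i, hv' i] with t h1 h3 using h1.add h2 h2' h3
  rw [K.bdryInt_eq hs, K.bdryInt_eq hv, K.bdryInt_eq hv', ← Finset.sum_add_distrib]
  refine Finset.sum_congr rfl fun i _ => ?_
  rw [← mul_add]
  congr 1
  exact integral_add (K.integrableOn_edge hb i) (K.integrableOn_edge hb' i)

theorem bdryInt_smul {ψ : Fn} (c : ℂ) (h : K.HasContTrace ψ) :
    K.bdryInt (c • ψ) = c * K.bdryInt ψ := by
  obtain ⟨h2, b, hb, hv⟩ := h
  have hs : ∀ i, ∀ᵐ t ∂(volume.restrict (Set.Icc (0 : ℝ) 1)),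
      HasBdryValue K.carrier (c • ψ) (K.edgePt i t) ((c • b) (K.edgePt i t)) := fun i => by
    filter_upwards [hv i] with t h1 using h1.smul c
  rw [K.bdryInt_eq hs, K.bdryInt_eq hv, Finset.mul_sum]
  refine Finset.sum_congr rfl fun i _ => ?_
  simp only [Pi.smul_apply, smul_eq_mul]
  rw [integral_const_mul]
  ring

theorem hasContTrace_polyFn {k : ℕ} {p : Fn} (hp : p ∈ PolyFn k) : K.HasContTrace p :=
  ⟨K.memL2_polyFn hp, p, (polyFn_contDiff hp).continuous.continuousOn, fun i => by
    filter_upwards [ae_restrict_mem (measurableSet_Icc (a := (0 : ℝ)) (b := 1))] with t ht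
    exact hasBdryValue_of_continuous K (polyFn_contDiff hp).continuous (K.edgePt_mem i ht)⟩

theorem bdryInt_one : K.bdryInt (fun _ => 1) ≠ 0 := by
  have h : K.bdryInt (fun _ => 1) = ((∑ i, K.edgeLen i : ℝ) : ℂ) := by
    rw [K.bdryInt_eq (b := fun _ => 1) (fun i => by
      filter_upwards [ae_restrict_mem (measurableSet_Icc (a := (0 : ℝ)) (b := 1))] with t ht
      exact hasBdryValue_of_continuous K continuous_const (K.edgePt_mem i ht))]
    push_cast
    simp
  rw [h, Complex.ofReal_ne_zero]
  have : Nonempty (Fin K.N) := ⟨⟨0, by have := K.three_le; omega⟩⟩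
  exact (Finset.sum_pos (fun i _ => K.edgeLen_pos i) Finset.univ_nonempty).ne'

theorem bdryInt_add_polyFn {k : ℕ} (p q : Fn) (hp : p ∈ PolyFn k) (hq : q ∈ PolyFn k) :
    K.bdryInt (p + q) = K.bdryInt p + K.bdryInt q :=
  K.bdryInt_add (K.hasContTrace_polyFn hp) (K.hasContTrace_polyFn hq)

theorem bdryInt_smul_polyFn {k : ℕ} (c : ℂ) (p : Fn) (hp : p ∈ PolyFn k) :
    K.bdryInt (c • p) = c * K.bdryInt p :=
  K.bdryInt_smul c (K.hasContTrace_polyFn hp)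

theorem projGrad1_spec {w : Fn} (hw : MemH1 K.carrier w) :
    projGrad1 K w ∈ PolyFn 1 ∧
      (∀ q ∈ PolyFn 1, aGrad K.carrier (projGrad1 K w) q = aGrad K.carrier w q) ∧
      K.bdryInt (projGrad1 K w) = K.bdryInt w :=
  polySelect_spec (K.exists_grad_projection 1 K.bdryInt_add_polyFn K.bdryInt_smul_polyFn
    K.bdryInt_one hw _)

theorem projGrad1_eq {w p : Fn} (hw : MemH1 K.carrier w) (hp : p ∈ PolyFn 1)
    (h : ∀ q ∈ PolyFn 1, aGrad K.carrier p q = aGrad K.carrier w q)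
    (hb : K.bdryInt p = K.bdryInt w) : projGrad1 K w = p := by
  obtain ⟨h1, h2, h3⟩ := K.projGrad1_spec hw
  have hd := polyFn_sub h1 hp
  refine sub_eq_zero.1 (K.eq_zero_of_aGrad K.bdryInt_smul_polyFn K.bdryInt_one hd ?_ ?_)
  · rw [aGrad_sub_left K.isOpen (K.memH1_polyFn h1) (K.memH1_polyFn hp) (K.memH1_polyFn hd),
      h2 _ hd, h _ hd, sub_self]
  · rw [sub_eq_add_smul, K.bdryInt_add_polyFn _ _ h1 (polyFn_smul _ hp),
      K.bdryInt_smul_polyFn _ _ hp, h3, hb]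
    ring

/-! ### The projection `Π_2^Δ` -/

/-- The linear part of a function at the origin. -/
def linPart (q : Fn) : Fn := fun x => q 0 + ∑ i, pd i q 0 * (x i : ℂ)

theorem linPart_mem (q : Fn) : linPart q ∈ PolyFn 1 := polyFn_affine _ _

theorem linPart_eq {q : Fn} (hq : q ∈ PolyFn 1) : linPart q = q :=
  funext fun x => (polyFn_eq_affine hq x).symm

theorem linPart_add {k : ℕ} {p q : Fn} (hp : p ∈ PolyFn k) (hq : q ∈ PolyFn k) :
    linPart (p + q) = linPart p + linPart q := by
  ext x
  simp only [linPart, pd_add (polyFn_contDiff hp) (polyFn_contDiff hq), Pi.add_apply, add_mul,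
    Finset.sum_add_distrib]
  ring

theorem linPart_smul {k : ℕ} {p : Fn} (c : ℂ) (hp : p ∈ PolyFn k) :
    linPart (c • p) = c • linPart p := by
  ext x
  simp only [linPart, pd_smul (polyFn_contDiff hp), Pi.smul_apply, smul_eq_mul, mul_add,
    Finset.mul_sum, mul_assoc]

theorem aDelta_linear_right (v : Fn) {q : Fn} (hq : q ∈ PolyFn 1) :
    aDelta K.carrier v q = 0 := by
  have h : ∀ p, hessian K.carrier q p =ᵐ[volume.restrict K.carrier] 0 := fun p => by
    have := hess_of_contDiff K.isOpen K.isBounded (polyFn_contDiff hq) p.1 p.2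
    rwa [polyFn_pd_eq_zero (polyFn_pd hq p.2)] at this
  rw [aDelta_eq, l2ip_congr (G' := fun _ => 0) (fun _ => EventuallyEq.rfl) h]
  simp [l2ip]

/-- A vanishing Hessian makes `p` affine. Testing the vertex sum with its conjugate shows that it
vanishes at all vertices, and these do not lie on a line. -/
theorem eq_zero_of_aDelta {p : Fn} (hp : p ∈ PolyFn 2) (h : aDelta K.carrier p p = 0)
    (hv : ∀ q ∈ PolyFn 1, ∑ i, p (K.poly i) * q (K.poly i) = 0) : p = 0 := by
  have h1 := aDelta_self_re K.carrier p
  rw [h, Complex.zero_re] at h1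
  have h2 : semi2 K.carrier p = 0 := pow_eq_zero_iff two_ne_zero |>.1 h1.symm
  have h3 : p ∈ PolyFn 1 := polyFn_mem_one_of_pd_pd hp (K.pd_pd_eq_zero_of_semi2 hp h2)
  refine K.polyFn_eq_zero_of_vertices h3 fun i => ?_
  have h4 := hv _ (polyFn_conj h3)
  have h5 : ∑ i, ‖p (K.poly i)‖ ^ 2 = 0 := by
    have h6 : ((∑ i, ‖p (K.poly i)‖ ^ 2 : ℝ) : ℂ) = 0 := by
      rw [← h4]
      push_cast
      refine Finset.sum_congr rfl fun i _ => ?_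
      rw [conjFn, Complex.star_def, Complex.mul_conj, Complex.normSq_eq_norm_sq]
      push_cast; rfl
    exact_mod_cast h6
  have h6 := (Finset.sum_eq_zero_iff_of_nonneg fun i _ => sq_nonneg _).1 h5 i (Finset.mem_univ i)
  simpa using h6

/-- The Hessian condition is tested with `ℙ_2`, the vertex condition only with `ℙ_1`. Inserting
`linPart q`, which is `q` itself on `ℙ_1`, puts both into a single bilinear form on `ℙ_2`. For
affine `q` the Hessian term drops out and leaves the vertex condition, which then cancels for
general `q`. -/
theorem exists_delta_projection {w : Fn} (hw : MemH2 K.carrier w) (d : Fin K.N → ℂ) :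
    ∃ p ∈ PolyFn 2, (∀ q ∈ PolyFn 2, aDelta K.carrier p q = aDelta K.carrier w q) ∧
      ∀ q ∈ PolyFn 1, ∑ i, p (K.poly i) * q (K.poly i) = ∑ i, d i * q (K.poly i) := by
  have hU := K.isOpen
  have hP : ∀ {p : Fn}, p ∈ PolyFn 2 → MemH2 K.carrier p := fun hp => K.memH2_polyFn hp
  obtain ⟨p, hp, h⟩ := exists_poly_of_nondegenerate 2
    (fun p q => aDelta K.carrier p (conjFn q) + ∑ i, p (K.poly i) * linPart q (K.poly i))
    (by
      intro p p' q hp hp' hq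
      simp only [aDelta_add_left hU (hP hp) (hP hp') (hP (polyFn_conj hq)), Pi.add_apply, add_mul,
        Finset.sum_add_distrib]
      ring)
    (by
      intro c p q hp hq
      simp only [aDelta_smul_left hU (hP hp), Pi.smul_apply, smul_eq_mul, mul_add, Finset.mul_sum,
        mul_assoc])
    (by
      intro p q q' hp hq hq'
      simp only [conjFn_add, linPart_add hq hq', Pi.add_apply, mul_add, Finset.sum_add_distrib,
        aDelta_add_right hU (hP hp) (hP (polyFn_conj hq)) (hP (polyFn_conj hq'))]
      ring)
    (by
      intro c p q hp hq
      simp only [conjFn_smul, linPart_smul c hq, aDelta_smul_right hU (hP (polyFn_conj hq)),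
        star_star, Pi.smul_apply, smul_eq_mul, mul_add, Finset.mul_sum]
      simp only [mul_left_comm])
    (by
      intro p hp h
      have hv : ∀ q ∈ PolyFn 1, ∑ i, p (K.poly i) * q (K.poly i) = 0 := by
        intro q hq
        have h1 := h q (polyFn_mono one_le_two hq)
        rwa [K.aDelta_linear_right p (polyFn_conj hq), zero_add, linPart_eq hq] at h1
      refine K.eq_zero_of_aDelta hp ?_ hv
      have h1 := h _ (polyFn_conj hp)
      rwa [conjFn_conjFn, hv _ (linPart_mem _), add_zero] at h1)
    (fun q => aDelta K.carrier w (conjFn q) + ∑ i, d i * linPart q (K.poly i))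
    (by
      intro q q' hq hq'
      simp only [conjFn_add, linPart_add hq hq', Pi.add_apply, mul_add, Finset.sum_add_distrib,
        aDelta_add_right hU hw (hP (polyFn_conj hq)) (hP (polyFn_conj hq'))]
      ring)
    (by
      intro c q hq
      simp only [conjFn_smul, linPart_smul c hq, aDelta_smul_right hU (hP (polyFn_conj hq)),
        star_star, Pi.smul_apply, smul_eq_mul, mul_add, Finset.mul_sum]
      simp only [mul_left_comm])
  have hv : ∀ q ∈ PolyFn 1, ∑ i, p (K.poly i) * q (K.poly i) = ∑ i, d i * q (K.poly i) := by
    intro q hq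
    have h1 := h q (polyFn_mono one_le_two hq)
    rwa [K.aDelta_linear_right p (polyFn_conj hq), K.aDelta_linear_right w (polyFn_conj hq),
      zero_add, zero_add, linPart_eq hq] at h1
  refine ⟨p, hp, fun q hq => ?_, hv⟩
  have h1 := h _ (polyFn_conj hq)
  rw [conjFn_conjFn, hv _ (linPart_mem _)] at h1
  exact add_right_cancel h1

theorem projDelta_spec {w : Fn} (hw : MemH2 K.carrier w) :
    projDelta K w ∈ PolyFn 2 ∧
      (∀ q ∈ PolyFn 2, aDelta K.carrier (projDelta K w) q = aDelta K.carrier w q) ∧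
      ∀ q ∈ PolyFn 1, ∑ i, projDelta K w (K.poly i) * q (K.poly i)
        = ∑ i, bdryValue K.carrier w (K.poly i) * q (K.poly i) :=
  polySelect_spec (K.exists_delta_projection hw _)

theorem projDelta_eq {w p : Fn} (hw : MemH2 K.carrier w) (hp : p ∈ PolyFn 2)
    (h : ∀ q ∈ PolyFn 2, aDelta K.carrier p q = aDelta K.carrier w q)
    (hb : ∀ q ∈ PolyFn 1, ∑ i, p (K.poly i) * q (K.poly i)
        = ∑ i, bdryValue K.carrier w (K.poly i) * q (K.poly i)) : projDelta K w = p := by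
  obtain ⟨h1, h2, h3⟩ := K.projDelta_spec hw
  have hd := polyFn_sub h1 hp
  refine sub_eq_zero.1 (K.eq_zero_of_aDelta hd ?_ fun q hq => ?_)
  · rw [aDelta_sub_left K.isOpen (K.memH2_polyFn h1) (K.memH2_polyFn hp) (K.memH2_polyFn hd),
      h2 _ hd, h _ hd, sub_self]
  · simp only [Pi.sub_apply, sub_mul, Finset.sum_sub_distrib, h3 q hq, hb q hq, sub_self]

end Element

/-! ### Stabilized forms -/

/-- The algebraic properties of a local space `S` with a form `a`, a projection `P` orthogonal
with respect to `a`, and a stabilizing form `s`. -/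
structure IsStabilized (S : Fn → Prop) (a s : Fn → Fn → ℂ) (P : Fn → Fn) (c₀ c₁ : ℝ) : Prop where
  add_mem : ∀ v w, S v → S w → S (v + w)
  smul_mem : ∀ (c : ℂ) v, S v → S (c • v)
  proj_mem : ∀ v, S v → S (P v)
  proj_add : ∀ v w, S v → S w → P (v + w) = P v + P w
  proj_smul : ∀ (c : ℂ) v, S v → P (c • v) = c • P v
  proj_proj : ∀ v, S v → P (P v) = P v
  a_add : ∀ v v' w, S v → S v' → S w → a (v + v') w = a v w + a v' w
  a_smul : ∀ (c : ℂ) v w, S v → S w → a (c • v) w = c * a v w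
  a_herm : ∀ v w, S v → S w → a w v = star (a v w)
  a_nonneg : ∀ v, S v → 0 ≤ (a v v).re
  orth : ∀ v w, S v → S w → a (P v) (P w) = a v (P w)
  s_add : ∀ v v' w, S v → S v' → S w → s (v + v') w = s v w + s v' w
  s_smul : ∀ (c : ℂ) v w, S v → S w → s (c • v) w = c * s v w
  s_herm : ∀ v w, S v → S w → s w v = star (s v w)
  s_nonneg : ∀ v, S v → 0 ≤ (s v v).re
  stab : ∀ v, S v → P v = 0 → c₀ * (a v v).re ≤ (s v v).re ∧ (s v v).re ≤ c₁ * (a v v).re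

namespace IsStabilized

variable {S : Fn → Prop} {a s : Fn → Fn → ℂ} {P : Fn → Fn} {c₀ c₁ : ℝ}

/-- The stabilized form. -/
def form (a s : Fn → Fn → ℂ) (P : Fn → Fn) (u v : Fn) : ℂ :=
  a (P u) (P v) + s (u - P u) (v - P v)

theorem sub_mem (h : IsStabilized S a s P c₀ c₁) {v w : Fn} (hv : S v) (hw : S w) :
    S (v - w) := by
  rw [sub_eq_add_smul]
  exact h.add_mem _ _ hv (h.smul_mem _ _ hw)

theorem res_mem (h : IsStabilized S a s P c₀ c₁) {v : Fn} (hv : S v) : S (v - P v) :=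
  h.sub_mem hv (h.proj_mem v hv)

theorem proj_sub (h : IsStabilized S a s P c₀ c₁) {v w : Fn} (hv : S v) (hw : S w) :
    P (v - w) = P v - P w := by
  rw [sub_eq_add_smul, h.proj_add _ _ hv (h.smul_mem _ _ hw), h.proj_smul _ _ hw,
    ← sub_eq_add_smul]

theorem proj_res (h : IsStabilized S a s P c₀ c₁) {v : Fn} (hv : S v) : P (v - P v) = 0 := by
  rw [h.proj_sub hv (h.proj_mem v hv), h.proj_proj v hv, sub_self]

theorem a_sub (h : IsStabilized S a s P c₀ c₁) {v v' w : Fn} (hv : S v) (hv' : S v')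
    (hw : S w) : a (v - v') w = a v w - a v' w := by
  rw [sub_eq_add_smul, h.a_add _ _ _ hv (h.smul_mem _ _ hv') hw, h.a_smul _ _ _ hv' hw]
  ring

theorem a_res (h : IsStabilized S a s P c₀ c₁) {v w : Fn} (hv : S v) (hw : S w) :
    a (v - P v) (P w) = 0 := by
  rw [h.a_sub hv (h.proj_mem v hv) (h.proj_mem w hw), h.orth v w hv hw, sub_self]

/-- The cross terms vanish because `v - P v` is orthogonal to the range of the projection. -/
theorem pythagoras (h : IsStabilized S a s P c₀ c₁) {v : Fn} (hv : S v) :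
    (a v v).re = (a (P v) (P v)).re + (a (v - P v) (v - P v)).re := by
  have hp := h.proj_mem v hv
  have hr := h.res_mem hv
  have h1 : a (v - P v) (v - P v) = a v v - a (P v) v := by
    rw [h.a_herm _ _ (h.res_mem hv) hr, h.a_sub hv hp hr, h.a_herm _ v hr hv,
      h.a_herm _ (P v) hr hp, h.a_sub hv hp hv, h.a_sub hv hp hp, h.orth v v hv hv, sub_self,
      star_zero, sub_zero, star_star]
  have h2 : (a (P v) v).re = (a (P v) (P v)).re := by
    rw [h.orth v v hv hv, h.a_herm _ (P v) hv hp, Complex.star_def, Complex.conj_re]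
  rw [h1, Complex.sub_re, h2]
  ring

theorem form_add (h : IsStabilized S a s P c₀ c₁) {u u' v : Fn} (hu : S u) (hu' : S u')
    (hv : S v) : form a s P (u + u') v = form a s P u v + form a s P u' v := by
  have e : u + u' - (P u + P u') = (u - P u) + (u' - P u') := by abel
  rw [form, form, form, h.proj_add _ _ hu hu', e,
    h.a_add _ _ _ (h.proj_mem u hu) (h.proj_mem u' hu') (h.proj_mem v hv),
    h.s_add _ _ _ (h.res_mem hu) (h.res_mem hu') (h.res_mem hv)]
  ring

theorem form_smul (h : IsStabilized S a s P c₀ c₁) (c : ℂ) {u v : Fn} (hu : S u)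
    (hv : S v) : form a s P (c • u) v = c * form a s P u v := by
  rw [form, form, h.proj_smul _ _ hu, ← smul_sub, h.a_smul _ _ _ (h.proj_mem u hu)
    (h.proj_mem v hv), h.s_smul _ _ _ (h.res_mem hu) (h.res_mem hv)]
  ring

theorem form_sub (h : IsStabilized S a s P c₀ c₁) {u u' v : Fn} (hu : S u) (hu' : S u')
    (hv : S v) : form a s P (u - u') v = form a s P u v - form a s P u' v := by
  rw [sub_eq_add_smul, h.form_add hu (h.smul_mem _ _ hu') hv, h.form_smul _ hu' hv]
  ring

theorem form_herm (h : IsStabilized S a s P c₀ c₁) {u v : Fn} (hu : S u) (hv : S v) :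
    form a s P v u = star (form a s P u v) := by
  rw [form, form, star_add, ← h.a_herm _ _ (h.proj_mem u hu) (h.proj_mem v hv),
    ← h.s_herm _ _ (h.res_mem hu) (h.res_mem hv)]

theorem form_smul_right (h : IsStabilized S a s P c₀ c₁) (c : ℂ) {u v : Fn} (hu : S u)
    (hv : S v) : form a s P u (c • v) = star c * form a s P u v := by
  rw [h.form_herm (h.smul_mem c v hv) hu, h.form_smul c hv hu, star_mul', ← h.form_herm hv hu]

/-- The stabilization bound is available for `v - P v`, which the projection annihilates;
`pythagoras` recombines the two parts. -/
theorem min_mul_le_form (h : IsStabilized S a s P c₀ c₁) {v : Fn} (hv : S v) :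
    min 1 c₀ * (a v v).re ≤ (form a s P v v).re := by
  have h1 := (h.stab _ (h.res_mem hv) (h.proj_res hv)).1
  have h2 := h.a_nonneg _ (h.proj_mem v hv)
  have h3 := h.a_nonneg _ (h.res_mem hv)
  rw [form, Complex.add_re, h.pythagoras hv]
  nlinarith [mul_le_mul_of_nonneg_right (min_le_left 1 c₀) h2,
    mul_le_mul_of_nonneg_right (min_le_right 1 c₀) h3]

theorem form_le_max_mul (h : IsStabilized S a s P c₀ c₁) {v : Fn} (hv : S v) :
    (form a s P v v).re ≤ max 1 c₁ * (a v v).re := by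
  have h1 := (h.stab _ (h.res_mem hv) (h.proj_res hv)).2
  have h2 := h.a_nonneg _ (h.proj_mem v hv)
  have h3 := h.a_nonneg _ (h.res_mem hv)
  rw [form, Complex.add_re, h.pythagoras hv]
  nlinarith [mul_le_mul_of_nonneg_right (le_max_left 1 c₁) h2,
    mul_le_mul_of_nonneg_right (le_max_right 1 c₁) h3]

/-- Cauchy–Schwarz for the stabilized form itself, so that only its diagonal has to be compared with
that of `a`. -/
theorem norm_form_le (h : IsStabilized S a s P c₀ c₁) {u v : Fn} (hu : S u) (hv : S v) :
    ‖form a s P u v‖ ≤ max 1 c₁ * (Real.sqrt (a u u).re * Real.sqrt (a v v).re) := by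
  have h1 := norm_sq_le_of_semidefinite S (form a s P) h.add_mem h.smul_mem
    (fun _ _ _ h1 h2 h3 => h.form_add h1 h2 h3) (fun c _ _ h1 h2 => h.form_smul c h1 h2)
    (fun _ _ h1 h2 => h.form_herm h1 h2)
    (fun w hw => add_nonneg (h.a_nonneg _ (h.proj_mem w hw)) (h.s_nonneg _ (h.res_mem hw)))
    hu hv
  have hm : (0 : ℝ) ≤ max 1 c₁ := zero_le_one.trans (le_max_left _ _)
  refine le_of_sq_le_sq ?_ (mul_nonneg hm (mul_nonneg (Real.sqrt_nonneg _) (Real.sqrt_nonneg _)))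
  rw [mul_pow, mul_pow, Real.sq_sqrt (h.a_nonneg u hu), Real.sq_sqrt (h.a_nonneg v hv)]
  calc _ ≤ _ := h1
    _ ≤ (max 1 c₁ * (a u u).re) * (max 1 c₁ * (a v v).re) :=
        mul_le_mul (h.form_le_max_mul hu) (h.form_le_max_mul hv)
          (add_nonneg (h.a_nonneg _ (h.proj_mem v hv)) (h.s_nonneg _ (h.res_mem hv)))
          (mul_nonneg hm (h.a_nonneg u hu))
    _ = _ := by ring

/-- Consistency: the stabilization sees only `p - P p = 0`, and orthogonality removes the projection
from the other argument. -/
theorem form_eq_of_proj_eq (h : IsStabilized S a s P c₀ c₁) {p v : Fn} (hp : S p) (e : P p = p)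
    (hv : S v) : form a s P p v = a p v := by
  -- Zero is written as a multiple of `p` because `s` is only known to be homogeneous on `S`.
  have h0 : p - P p = (0 : ℂ) • p := by rw [e, sub_self, zero_smul]
  have h1 : a p (P v) = a p v := by
    have h2 := h.a_res hv hp
    rw [e, h.a_sub hv (h.proj_mem v hv) hp, sub_eq_zero] at h2
    rw [h.a_herm v p hv hp, h2, ← h.a_herm _ _ (h.proj_mem v hv) hp]
  rw [form, h0, h.s_smul _ _ _ hp (h.res_mem hv), e, h1]
  ring

end IsStabilized

/-! ### The local virtual element spaces -/

theorem IsEdgePoly.add {K : Element} {i : Fin K.N} {k : ℕ} {b b' : Plane → ℂ}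
    (h : IsEdgePoly K i k b) (h' : IsEdgePoly K i k b') : IsEdgePoly K i k (b + b') := by
  obtain ⟨P, hP, e⟩ := h
  obtain ⟨P', hP', e'⟩ := h'
  exact ⟨P + P', Polynomial.natDegree_add_le_of_degree_le hP hP', fun t ht => by
    rw [Pi.add_apply, e t ht, e' t ht, Polynomial.eval_add]⟩

theorem IsEdgePoly.smul {K : Element} {i : Fin K.N} {k : ℕ} {b : Plane → ℂ} (c : ℂ)
    (h : IsEdgePoly K i k b) : IsEdgePoly K i k (c • b) := by
  obtain ⟨P, hP, e⟩ := h
  exact ⟨Polynomial.C c * P, (Polynomial.natDegree_C_mul_le c P).trans hP, fun t ht => by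
    rw [Pi.smul_apply, e t ht, Polynomial.eval_mul, Polynomial.eval_C, smul_eq_mul]⟩

/-- Substituting the affine parametrization of the edge for the coordinates does not raise the
degree. -/
theorem isEdgePoly_of_polyFn {K : Element} (i : Fin K.N) {k l : ℕ} (hkl : k ≤ l) {p : Fn}
    (hp : p ∈ PolyFn k) : IsEdgePoly K i l p := by
  obtain ⟨P, hP, e⟩ := hp
  let f : Fin 2 → Polynomial ℂ := fun j => Polynomial.C ((K.poly i j : ℝ) : ℂ) +
    Polynomial.C ((K.poly (finRotate K.N i) j - K.poly i j : ℝ) : ℂ) * Polynomial.X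
  have hf : ∀ j, (f j).natDegree ≤ 1 := fun j => by
    refine Polynomial.natDegree_add_le_of_degree_le (by simp) ?_
    exact Polynomial.natDegree_C_mul_le _ _ |>.trans Polynomial.natDegree_X_le
  refine ⟨MvPolynomial.aeval f P, ?_, fun t _ => ?_⟩
  · refine le_trans ?_ (hP.trans hkl)
    rw [MvPolynomial.aeval_def, MvPolynomial.eval₂_eq]
    refine Polynomial.natDegree_sum_le_of_forall_le _ _ fun s hs => ?_
    refine (Polynomial.natDegree_C_mul_le _ _).trans ?_
    refine (Polynomial.natDegree_prod_le _ _).trans ?_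
    refine le_trans (Finset.sum_le_sum fun j _ => ?_) (MvPolynomial.le_totalDegree hs)
    refine Polynomial.natDegree_pow_le.trans ?_
    simpa using Nat.mul_le_mul_left (s j) (hf j)
  · rw [e, ← Polynomial.coe_evalRingHom, MvPolynomial.aeval_def, MvPolynomial.hom_eval₂]
    rw [← MvPolynomial.eval₂_id]
    congr 1
    · ext a; simp
    · ext j
      simp only [f, Element.edgePt_eq]
      simp
      ring

theorem lap_eq (φ : Fn) : lap φ = pd 0 (pd 0 φ) + pd 1 (pd 1 φ) := by
  ext x; simp [lap, Fin.sum_univ_two]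

theorem IsTest.lap {U : Set Plane} {φ : Fn} (h : IsTest U φ) : IsTest U (lap φ) := by
  rw [lap_eq]
  exact ((h.pd 0).pd 0).add ((h.pd 1).pd 1)

namespace Element

variable (K : Element)

theorem edgeNormal_add (i : Fin K.N) (G G' : Fin 2 → Fn) :
    K.edgeNormal i (G + G') = K.edgeNormal i G + K.edgeNormal i G' := by
  ext x; simp only [edgeNormal, Pi.add_apply]; ring

theorem edgeNormal_smul (i : Fin K.N) (c : ℂ) (G : Fin 2 → Fn) :
    K.edgeNormal i (c • G) = c • K.edgeNormal i G := by
  ext x; simp only [edgeNormal, Pi.smul_apply, smul_eq_mul]; ring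

theorem integral_polyFn_mul_lap {k : ℕ} {p : Fn} (hp : p ∈ PolyFn k) {φ : Fn}
    (hφ : IsTest K.carrier φ) :
    ∫ x in K.carrier, p x * lap φ x = ∫ x in K.carrier, lap p x * φ x := by
  have hc := polyFn_contDiff hp
  have h : ∀ i, ∫ x in K.carrier, p x * pd i (pd i φ) x =
      ∫ x in K.carrier, pd i (pd i p) x * φ x := fun i => by
    rw [hasWeakPartial_of_contDiff hc i _ (hφ.pd i),
      hasWeakPartial_of_contDiff (contDiff_pd hc i) i _ hφ, neg_neg]
  have hi : ∀ i, Integrable (fun x => p x * pd i (pd i φ) x) (volume.restrict K.carrier) :=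
    fun i => (K.memL2_polyFn hp).integrable_mul ((hφ.pd i).pd i).memL2
  have hi' : ∀ i, Integrable (fun x => pd i (pd i p) x * φ x) (volume.restrict K.carrier) :=
    fun i => (memL2_of_continuous K.isBounded
      (contDiff_pd (contDiff_pd hc i) i).continuous).integrable_mul hφ.memL2
  simp only [lap, Finset.mul_sum, Finset.sum_mul]
  rw [integral_finsetSum _ fun i _ => hi i, integral_finsetSum _ fun i _ => hi' i]
  exact Finset.sum_congr rfl fun i _ => h i

end Element

theorem lap_polyFn_eq_zero {p : Fn} (hp : p ∈ PolyFn 1) : lap p = 0 := by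
  rw [lap_eq, polyFn_pd_eq_zero (polyFn_pd hp 0), polyFn_pd_eq_zero (polyFn_pd hp 1), add_zero]

theorem lap_polyFn_mem {p : Fn} (hp : p ∈ PolyFn 2) : lap p ∈ PolyFn 0 := by
  rw [lap_eq]
  exact polyFn_add (polyFn_pd (polyFn_pd hp 0) 0) (polyFn_pd (polyFn_pd hp 1) 1)

theorem MemWtilde.add {K : Element} {v w : Fn} (hv : MemWtilde K v) (hw : MemWtilde K w) :
    MemWtilde K (v + w) := by
  obtain ⟨h1, ⟨q, hq, hq'⟩, ⟨b, hb, hbv, hbe⟩, G, hG, hGv, hGe⟩ := hv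
  obtain ⟨k1, ⟨r, hr, hr'⟩, ⟨d, hd, hdv, hde⟩, H, hH, hHv, hHe⟩ := hw
  refine ⟨h1.add K.isOpen k1, ⟨q + r, polyFn_add hq hr, fun φ hφ => ?_⟩,
    ⟨b + d, hb.add hd, fun x hx => (hbv x hx).add h1.1.1 k1.1.1 (hdv x hx),
      fun i => (hbe i).add (hde i)⟩,
    ⟨G + H, fun j => (hG j).add (hH j), fun j i => ?_, fun i => ?_⟩⟩
  · rw [K.integral_add_mul h1.1.1 k1.1.1 hφ.lap.lap.memL2, hq' φ hφ, hr' φ hφ,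
      K.integral_add_mul (K.memL2_polyFn hq) (K.memL2_polyFn hr) hφ.memL2]
  · filter_upwards [hGv j i, hHv j i] with t ht ht'
    exact (ht.add (h1.1.memL2_wd j) (k1.1.memL2_wd j) ht').congr (wd_add K.isOpen h1.1 k1.1 j).symm
  · rw [K.edgeNormal_add]
    exact (hGe i).add (hHe i)

theorem MemWtilde.smul {K : Element} {v : Fn} (c : ℂ) (hv : MemWtilde K v) :
    MemWtilde K (c • v) := by
  obtain ⟨h1, ⟨q, hq, hq'⟩, ⟨b, hb, hbv, hbe⟩, G, hG, hGv, hGe⟩ := hv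
  refine ⟨h1.smul K.isOpen c, ⟨c • q, polyFn_smul c hq, fun φ hφ => ?_⟩,
    ⟨c • b, continuousOn_const.smul hb, fun x hx => (hbv x hx).smul c, fun i => (hbe i).smul c⟩,
    ⟨c • G, fun j => (hG j).const_smul c, fun j i => ?_, fun i => ?_⟩⟩
  · rw [K.integral_smul_mul, hq' φ hφ, K.integral_smul_mul]
  · filter_upwards [hGv j i] with t ht
    exact (ht.smul c).congr (wd_smul K.isOpen h1.1 c j).symm
  · rw [K.edgeNormal_smul]
    exact (hGe i).smul c

/-- The bilaplacian datum is 0, as the Laplacian of a quadratic polynomial is constant. Smoothness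
gives the boundary values, and the normal derivative along an edge is affine. -/
theorem memWtilde_polyFn (K : Element) {p : Fn} (hp : p ∈ PolyFn 2) : MemWtilde K p := by
  have hc := polyFn_contDiff hp
  refine ⟨K.memH2_polyFn hp, ⟨0, polyFn_zero 2, fun φ hφ => ?_⟩,
    ⟨p, hc.continuous.continuousOn, fun x hx => hasBdryValue_of_continuous K hc.continuous hx,
      fun i => isEdgePoly_of_polyFn i (by norm_num) hp⟩,
    ⟨fun j => pd j p, fun j => (contDiff_pd hc j).continuous.continuousOn, fun j i => ?_,
      fun i => ?_⟩⟩
  · rw [K.integral_polyFn_mul_lap hp hφ.lap, K.integral_polyFn_mul_lap (lap_polyFn_mem hp) hφ,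
      lap_polyFn_eq_zero (polyFn_mono zero_le_one (lap_polyFn_mem hp))]
  · filter_upwards [ae_restrict_mem (measurableSet_Icc (a := (0 : ℝ)) (b := 1))] with t ht
    exact (hasBdryValue_of_continuous K (contDiff_pd hc j).continuous (K.edgePt_mem i ht)).congr
      (wd_of_contDiff K.isOpen K.isBounded hc j).symm
  · have h : K.edgeNormal i (fun j => pd j p) =
        (((K.poly (finRotate K.N i)) 1 - (K.poly i) 1 : ℝ) : ℂ) • pd 0 p
          + (-(((K.poly (finRotate K.N i)) 0 - (K.poly i) 0 : ℝ) : ℂ)) • pd 1 p := by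
      ext x
      simp only [Element.edgeNormal, Pi.add_apply, Pi.smul_apply, smul_eq_mul]
      ring
    rw [h]
    exact isEdgePoly_of_polyFn i le_rfl
      (polyFn_add (polyFn_smul _ (polyFn_pd hp 0)) (polyFn_smul _ (polyFn_pd hp 1)))

theorem MemVtilde.add {K : Element} {v w : Fn} (hv : MemVtilde K v) (hw : MemVtilde K w) :
    MemVtilde K (v + w) := by
  obtain ⟨h1, ⟨q, hq, hq'⟩, b, hb, hbv, hbe⟩ := hv
  obtain ⟨k1, ⟨r, hr, hr'⟩, d, hd, hdv, hde⟩ := hw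
  refine ⟨h1.add k1, ⟨q + r, polyFn_add hq hr, fun φ hφ => ?_⟩,
    ⟨b + d, hb.add hd, fun i => ?_, fun i => (hbe i).add (hde i)⟩⟩
  · rw [K.integral_add_mul h1.1 k1.1 hφ.lap.memL2, hq' φ hφ, hr' φ hφ,
      K.integral_add_mul (K.memL2_polyFn hq) (K.memL2_polyFn hr) hφ.memL2]
  · filter_upwards [hbv i, hdv i] with t ht ht' using ht.add h1.1 k1.1 ht'

theorem MemVtilde.smul {K : Element} {v : Fn} (c : ℂ) (hv : MemVtilde K v) :
    MemVtilde K (c • v) := by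
  obtain ⟨h1, ⟨q, hq, hq'⟩, b, hb, hbv, hbe⟩ := hv
  refine ⟨h1.smul c, ⟨c • q, polyFn_smul c hq, fun φ hφ => ?_⟩,
    ⟨c • b, continuousOn_const.smul hb, fun i => ?_, fun i => (hbe i).smul c⟩⟩
  · rw [K.integral_smul_mul, hq' φ hφ, K.integral_smul_mul]
  · filter_upwards [hbv i] with t ht using ht.smul c

theorem memVtilde_polyFn (K : Element) {p : Fn} (hp : p ∈ PolyFn 1) : MemVtilde K p := by
  refine ⟨K.memH1_polyFn hp, ⟨0, polyFn_zero 1, fun φ hφ => ?_⟩, p,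
    (polyFn_contDiff hp).continuous.continuousOn, fun i => ?_,
    fun i => isEdgePoly_of_polyFn i le_rfl hp⟩
  · rw [K.integral_polyFn_mul_lap hp hφ, lap_polyFn_eq_zero hp]
  · filter_upwards [ae_restrict_mem (measurableSet_Icc (a := (0 : ℝ)) (b := 1))] with t ht
    exact hasBdryValue_of_continuous K (polyFn_contDiff hp).continuous (K.edgePt_mem i ht)

/-! ### Linearity of the projections on the local spaces -/

theorem MemWtilde.bdryValue_add {K : Element} {v w : Fn} (hv : MemWtilde K v)
    (hw : MemWtilde K w) {x : Plane} (hx : x ∈ frontier K.carrier) :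
    bdryValue K.carrier (v + w) x = bdryValue K.carrier v x + bdryValue K.carrier w x := by
  obtain ⟨h1, -, ⟨b, -, hbv, -⟩, -⟩ := hv
  obtain ⟨k1, -, ⟨d, -, hdv, -⟩, -⟩ := hw
  rw [((hbv x hx).add h1.1.1 k1.1.1 (hdv x hx)).bdryValue_eq, (hbv x hx).bdryValue_eq,
    (hdv x hx).bdryValue_eq]

theorem MemWtilde.bdryValue_smul {K : Element} {v : Fn} (hv : MemWtilde K v) (c : ℂ)
    {x : Plane} (hx : x ∈ frontier K.carrier) :
    bdryValue K.carrier (c • v) x = c * bdryValue K.carrier v x := by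
  obtain ⟨h1, -, ⟨b, -, hbv, -⟩, -⟩ := hv
  rw [((hbv x hx).smul c).bdryValue_eq, (hbv x hx).bdryValue_eq]

/-- By uniqueness it suffices that both sides have the same moments. The vertex moments are additive
because the preliminary space guarantees a boundary value at every vertex. -/
theorem projDelta_add {K : Element} {v w : Fn} (hv : MemWtilde K v) (hw : MemWtilde K w) :
    projDelta K (v + w) = projDelta K v + projDelta K w := by
  obtain ⟨h1, h2, h3⟩ := K.projDelta_spec hv.1
  obtain ⟨k1, k2, k3⟩ := K.projDelta_spec hw.1
  refine K.projDelta_eq (hv.add hw).1 (polyFn_add h1 k1) (fun q hq => ?_) fun q hq => ?_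
  · rw [aDelta_add_left K.isOpen (K.memH2_polyFn h1) (K.memH2_polyFn k1) (K.memH2_polyFn hq),
      aDelta_add_left K.isOpen hv.1 hw.1 (K.memH2_polyFn hq), h2 q hq, k2 q hq]
  · simp only [Pi.add_apply, hv.bdryValue_add hw (K.vertex_mem _), add_mul,
      Finset.sum_add_distrib, h3 q hq, k3 q hq]

theorem projDelta_smul {K : Element} {v : Fn} (hv : MemWtilde K v) (c : ℂ) :
    projDelta K (c • v) = c • projDelta K v := by
  obtain ⟨h1, h2, h3⟩ := K.projDelta_spec hv.1
  refine K.projDelta_eq (hv.smul c).1 (polyFn_smul c h1) (fun q hq => ?_) fun q hq => ?_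
  · rw [aDelta_smul_left K.isOpen (K.memH2_polyFn h1), aDelta_smul_left K.isOpen hv.1, h2 q hq]
  · simp only [Pi.smul_apply, smul_eq_mul, hv.bdryValue_smul c (K.vertex_mem _), mul_assoc,
      ← Finset.mul_sum, h3 q hq]

theorem projDelta_polyFn {K : Element} {p : Fn} (hp : p ∈ PolyFn 2) : projDelta K p = p :=
  K.projDelta_eq (K.memH2_polyFn hp) hp (fun _ _ => rfl) fun q _ =>
    Finset.sum_congr rfl fun i _ => by
      rw [(hasBdryValue_of_continuous K (polyFn_contDiff hp).continuous
        (K.vertex_mem i)).bdryValue_eq]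

theorem MemVtilde.hasContTrace {K : Element} {v : Fn} (hv : MemVtilde K v) : K.HasContTrace v := by
  obtain ⟨h1, -, b, hb, hbv, -⟩ := hv
  exact ⟨h1.1, b, hb, hbv⟩

theorem projGrad1_add {K : Element} {v w : Fn} (hv : MemVtilde K v) (hw : MemVtilde K w) :
    projGrad1 K (v + w) = projGrad1 K v + projGrad1 K w := by
  obtain ⟨h1, h2, h3⟩ := K.projGrad1_spec hv.1
  obtain ⟨k1, k2, k3⟩ := K.projGrad1_spec hw.1
  refine K.projGrad1_eq (hv.add hw).1 (polyFn_add h1 k1) (fun q hq => ?_) ?_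
  · rw [aGrad_add_left K.isOpen (K.memH1_polyFn h1) (K.memH1_polyFn k1) (K.memH1_polyFn hq),
      aGrad_add_left K.isOpen hv.1 hw.1 (K.memH1_polyFn hq), h2 q hq, k2 q hq]
  · rw [K.bdryInt_add_polyFn _ _ h1 k1, K.bdryInt_add hv.hasContTrace hw.hasContTrace, h3, k3]

theorem projGrad1_smul {K : Element} {v : Fn} (hv : MemVtilde K v) (c : ℂ) :
    projGrad1 K (c • v) = c • projGrad1 K v := by
  obtain ⟨h1, h2, h3⟩ := K.projGrad1_spec hv.1
  refine K.projGrad1_eq (hv.smul c).1 (polyFn_smul c h1) (fun q hq => ?_) ?_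
  · rw [aGrad_smul_left K.isOpen (K.memH1_polyFn h1), aGrad_smul_left K.isOpen hv.1, h2 q hq]
  · rw [K.bdryInt_smul_polyFn _ _ h1, K.bdryInt_smul c hv.hasContTrace, h3]

theorem projGrad1_polyFn {K : Element} {p : Fn} (hp : p ∈ PolyFn 1) : projGrad1 K p = p :=
  K.projGrad1_eq (K.memH1_polyFn hp) hp (fun _ _ => rfl) rfl

theorem MemWK.memH2 {K : Element} {v : Fn} (hv : MemWK K v) : MemH2 K.carrier v := hv.1.1

theorem MemVK.memH1 {K : Element} {v : Fn} (hv : MemVK K v) : MemH1 K.carrier v := hv.1.1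

theorem MemWK.add {K : Element} {v w : Fn} (hv : MemWK K v) (hw : MemWK K w) :
    MemWK K (v + w) := by
  refine ⟨hv.1.add hw.1, fun q hq => ?_⟩
  have h1 := (K.projDelta_spec hv.memH2).1
  have h2 := (K.projDelta_spec hw.memH2).1
  rw [projDelta_add hv.1 hw.1, K.integral_add_mul (K.memL2_polyFn h1) (K.memL2_polyFn h2)
    (K.memL2_polyFn hq), hv.2 q hq, hw.2 q hq,
    K.integral_add_mul hv.memH2.1.1 hw.memH2.1.1 (K.memL2_polyFn hq)]

theorem MemWK.smul {K : Element} {v : Fn} (c : ℂ) (hv : MemWK K v) : MemWK K (c • v) := by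
  refine ⟨hv.1.smul c, fun q hq => ?_⟩
  rw [projDelta_smul hv.1, K.integral_smul_mul, hv.2 q hq, K.integral_smul_mul]

theorem memWK_polyFn (K : Element) {p : Fn} (hp : p ∈ PolyFn 2) : MemWK K p :=
  ⟨memWtilde_polyFn K hp, fun _ _ => by rw [projDelta_polyFn hp]⟩

theorem MemVK.add {K : Element} {v w : Fn} (hv : MemVK K v) (hw : MemVK K w) :
    MemVK K (v + w) := by
  refine ⟨hv.1.add hw.1, fun q hq => ?_⟩
  have h1 := (K.projGrad1_spec hv.memH1).1
  have h2 := (K.projGrad1_spec hw.memH1).1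
  rw [projGrad1_add hv.1 hw.1, K.integral_add_mul (K.memL2_polyFn h1) (K.memL2_polyFn h2)
    (K.memL2_polyFn hq), hv.2 q hq, hw.2 q hq,
    K.integral_add_mul hv.memH1.1 hw.memH1.1 (K.memL2_polyFn hq)]

theorem MemVK.smul {K : Element} {v : Fn} (c : ℂ) (hv : MemVK K v) : MemVK K (c • v) := by
  refine ⟨hv.1.smul c, fun q hq => ?_⟩
  rw [projGrad1_smul hv.1, K.integral_smul_mul, hv.2 q hq, K.integral_smul_mul]

theorem memVK_polyFn (K : Element) {p : Fn} (hp : p ∈ PolyFn 1) : MemVK K p :=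
  ⟨memVtilde_polyFn K hp, fun _ _ => by rw [projGrad1_polyFn hp]⟩

/-- Definiteness speaks only of nonzero classes; on the zero class `v` may be replaced by `0 • v`,
where the form vanishes. -/
theorem IsPosDefForm.nonneg {U : Set Plane} {S : Fn → Prop} {s : Fn → Fn → ℂ}
    (h : IsPosDefForm U S s) (hS : ∀ (c : ℂ) v, S v → S (c • v)) {v : Fn} (hv : S v) :
    0 ≤ (s v v).re := by
  by_cases h0 : v =ᵐ[volume.restrict U] 0
  · have h1 : v =ᵐ[volume.restrict U] (0 : ℂ) • v := by rw [zero_smul]; exact h0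
    rw [h.congr v _ v hv (hS 0 v hv) hv h1, h.smul _ _ _ hv hv]
    simp
  · exact (h.pos v hv h0).le

theorem IsStabDelta.isStabilized {K : Element} {c₀ c₁ : ℝ} {s : Fn → Fn → ℂ}
    (h : IsStabDelta K c₀ c₁ s) :
    IsStabilized (MemWK K) (aDelta K.carrier) s (projDelta K) c₀ c₁ where
  add_mem _ _ hv hw := hv.add hw
  smul_mem c _ hv := hv.smul c
  proj_mem _ hv := memWK_polyFn K (K.projDelta_spec hv.memH2).1
  proj_add _ _ hv hw := projDelta_add hv.1 hw.1
  proj_smul c _ hv := projDelta_smul hv.1 c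
  proj_proj _ hv := projDelta_polyFn (K.projDelta_spec hv.memH2).1
  a_add _ _ _ hv hv' hw := aDelta_add_left K.isOpen hv.memH2 hv'.memH2 hw.memH2
  a_smul c _ w hv _ := aDelta_smul_left K.isOpen hv.memH2 c w
  a_herm v w _ _ := aDelta_star _ v w
  a_nonneg v _ := by rw [aDelta_self_re]; exact sq_nonneg _
  orth _ _ hv hw := (K.projDelta_spec hv.memH2).2.1 _ (K.projDelta_spec hw.memH2).1
  s_add := h.1.add
  s_smul := h.1.smul
  s_herm := h.1.herm
  s_nonneg _ hv := h.1.nonneg (fun c _ hv => hv.smul c) hv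
  stab := h.2

theorem IsStabGrad.isStabilized {K : Element} {c₂ c₃ : ℝ} {s : Fn → Fn → ℂ}
    (h : IsStabGrad K c₂ c₃ s) :
    IsStabilized (MemVK K) (aGrad K.carrier) s (projGrad1 K) c₂ c₃ where
  add_mem _ _ hv hw := hv.add hw
  smul_mem c _ hv := hv.smul c
  proj_mem _ hv := memVK_polyFn K (K.projGrad1_spec hv.memH1).1
  proj_add _ _ hv hw := projGrad1_add hv.1 hw.1
  proj_smul c _ hv := projGrad1_smul hv.1 c
  proj_proj _ hv := projGrad1_polyFn (K.projGrad1_spec hv.memH1).1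
  a_add _ _ _ hv hv' hw := aGrad_add_left K.isOpen hv.memH1 hv'.memH1 hw.memH1
  a_smul c _ w hv _ := aGrad_smul_left K.isOpen hv.memH1 c w
  a_herm v w _ _ := aGrad_star _ v w
  a_nonneg v _ := by rw [aGrad_self_re]; exact sq_nonneg _
  orth _ _ hv hw := (K.projGrad1_spec hv.memH1).2.1 _ (K.projGrad1_spec hw.memH1).1
  s_add := h.1.add
  s_smul := h.1.smul
  s_herm := h.1.herm
  s_nonneg _ hv := h.1.nonneg (fun c _ hv => hv.smul c) hv
  stab := h.2

/-! ### Local error estimates -/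

namespace Element

variable (K : Element)

theorem diam_pos : 0 < K.diam := by
  obtain ⟨x, hx⟩ := K.nonempty
  obtain ⟨ε, hε, hball⟩ := Metric.isOpen_iff.1 K.isOpen x hx
  have hy : x + EuclideanSpace.single (0 : Fin 2) (ε / 2) ∈ K.carrier := by
    apply hball
    rw [Metric.mem_ball, dist_eq_norm, add_sub_cancel_left, PiLp.norm_single,
      Real.norm_of_nonneg (by positivity)]
    linarith
  have h := Metric.dist_le_diam_of_mem K.isBounded hy hx
  rw [dist_eq_norm, add_sub_cancel_left, PiLp.norm_single,
    Real.norm_of_nonneg (by positivity)] at h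
  exact (half_pos hε).trans_le h

/-- `K` satisfies the Poincaré inequality with constant `C` relative to its diameter. -/
def Poincare (C : ℝ) : Prop :=
  ∀ v, MemH1 K.carrier v → ∃ c : ℂ,
    norm0 K.carrier (v - fun _ => c) ≤ C * K.diam * semi1 K.carrier v

/-- The star ball has radius `CT * h_K`, so the ratio of diameter to radius is `1 / CT` whatever the
element. -/
theorem poincare_of_starConvex {CT : ℝ} (hCT : 0 < CT)
    (h : ∃ x₀, ∀ y ∈ Metric.ball x₀ (CT * K.diam), StarConvex ℝ y K.carrier) :
    K.Poincare (Real.sqrt (4 * (1 + (1 / CT) ^ 2))) := by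
  intro v hv
  obtain ⟨x₀, hx₀⟩ := h
  have hd := K.diam_pos
  obtain ⟨c, hc⟩ := exists_integral_norm_sub_sq_le K.isOpen K.isBounded (mul_pos hCT hd)
    K.nonempty hx₀ hv
  refine ⟨c, le_of_sq_le_sq ?_ (mul_nonneg (mul_nonneg (Real.sqrt_nonneg _) hd.le)
    (semi1_nonneg _ _))⟩
  rw [norm0_sq, mul_assoc, mul_pow, Real.sq_sqrt (by positivity)]
  have e : Metric.diam K.carrier / (CT * K.diam) = 1 / CT := by
    change K.diam / (CT * K.diam) = 1 / CT
    field_simp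
  rw [e] at hc
  exact hc

/-- Best approximation: the residual is orthogonal to `ℙ_k`, which contains the constant of the
Poincaré inequality. -/
theorem norm0_sub_projL2_le {C : ℝ} (hP : K.Poincare C) (k : ℕ) {v : Fn}
    (hv : MemH1 K.carrier v) :
    norm0 K.carrier (v - projL2 K k v) ≤ C * K.diam * semi1 K.carrier v := by
  obtain ⟨c, hc⟩ := hP v hv
  refine le_trans ?_ hc
  obtain ⟨h1, h2⟩ := K.projL2_spec k hv.1
  have hpc := polyFn_const k c
  set r := v - projL2 K k v with hr
  set d : Fn := v - fun _ => c with hd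
  have hr2 : MemL2 K.carrier r := hv.1.sub (K.memL2_polyFn h1)
  have hd2 : MemL2 K.carrier d := hv.1.sub (K.memL2_polyFn hpc)
  have horth : ∀ q ∈ PolyFn k, ∫ x in K.carrier, r x * q x = 0 := by
    intro q hq
    have hq2 := K.memL2_polyFn hq
    simp only [hr, Pi.sub_apply, sub_mul]
    rw [integral_sub (hv.1.integrable_mul hq2) ((K.memL2_polyFn h1).integrable_mul hq2), h2 q hq,
      sub_self]
  have e : ∫ x in K.carrier, r x * star (r x) = ∫ x in K.carrier, r x * star (d x) := by
    have h3 := horth _ (polyFn_conj (polyFn_sub hpc h1))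
    have h4 : ∀ x, r x * star (r x) = r x * star (d x) +
        r x * conjFn ((fun _ => c) - projL2 K k v) x := by
      intro x
      simp only [hr, hd, conjFn, Pi.sub_apply, star_sub]
      ring
    simp_rw [h4]
    rw [integral_add (hr2.integrable_mul_star hd2)
      (hr2.integrable_mul (K.memL2_polyFn (polyFn_conj (polyFn_sub hpc h1)))), h3, add_zero]
  have h5 : norm0 K.carrier r ^ 2 = ‖∫ x in K.carrier, r x * star (r x)‖ := by
    have h6 := l2ip_self (U := K.carrier) (fun _ : Unit => r)
    simp only [l2ip, Fintype.univ_ofSubsingleton, Finset.sum_const, Finset.card_singleton,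
      one_smul] at h6
    rw [h6, Complex.norm_real, Real.norm_of_nonneg (sq_nonneg _)]
    rfl
  have h6 := norm_integral_mul_star_le hr2 hd2
  rw [← e, ← h5, sq] at h6
  by_cases h0 : norm0 K.carrier r = 0
  · rw [h0]; exact norm0_nonneg _ _
  · exact le_of_mul_le_mul_left h6 (lt_of_le_of_ne (norm0_nonneg _ _) (Ne.symm h0))

theorem norm0_wlap_le {v : Fn} (hv : MemH2 K.carrier v) :
    norm0 K.carrier (wlap K.carrier v) ≤ 2 * semi2 K.carrier v := by
  have : wlap K.carrier v = hess K.carrier v 0 0 + hess K.carrier v 1 1 := by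
    ext x; simp [wlap]
  have h1 := norm0_add_le (hv.memL2_hess 0 0) (hv.memL2_hess 1 1)
  have h2 : norm0 K.carrier (hess K.carrier v 0 0) ≤ l2norm K.carrier (hessian K.carrier v) :=
    norm0_le_l2norm hv.memL2_hessian (0, 0)
  have h3 : norm0 K.carrier (hess K.carrier v 1 1) ≤ l2norm K.carrier (hessian K.carrier v) :=
    norm0_le_l2norm hv.memL2_hessian (1, 1)
  rw [this, semi2_eq]
  linarith

theorem integral_projL2_star {k l : ℕ} (hlk : l ≤ k) {w v : Fn} (hw : MemL2 K.carrier w)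
    (hv : MemL2 K.carrier v) :
    ∫ x in K.carrier, projL2 K k w x * star (projL2 K l v x) =
      ∫ x in K.carrier, w x * star (projL2 K l v x) :=
  (K.projL2_spec k hw).2 _ (polyFn_conj (polyFn_mono hlk (K.projL2_spec l hv).1))

/-- Since `l ≤ k`, the projector on `w` can be dropped and only `v - Π_l v` remains. The factor
`h_K` comes from `v` alone, so `w` may be merely square integrable, as the Laplacian of `f` is. -/
theorem norm_integral_projL2_sub_le {C : ℝ} (hP : K.Poincare C) {k l : ℕ} (hlk : l ≤ k) {w v : Fn}
    (hw : MemL2 K.carrier w) (hv : MemH1 K.carrier v) :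
    ‖(∫ x in K.carrier, projL2 K k w x * star (projL2 K l v x)) -
        ∫ x in K.carrier, w x * star (v x)‖ ≤
      C * K.diam * (norm0 K.carrier w * semi1 K.carrier v) := by
  have hp := K.memL2_polyFn (K.projL2_spec l hv.1).1
  rw [K.integral_projL2_star hlk hw hv.1, norm_sub_rev,
    ← integral_sub (hw.integrable_mul_star hv.1) (hw.integrable_mul_star hp)]
  have e : ∀ x, w x * star (v x) - w x * star (projL2 K l v x) =
      w x * star ((v - projL2 K l v) x) := fun x => by
    rw [Pi.sub_apply, star_sub, mul_sub]
  simp_rw [e]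
  refine (norm_integral_mul_star_le hw (hv.1.sub hp)).trans ?_
  have := mul_le_mul_of_nonneg_left (K.norm0_sub_projL2_le hP l hv) (norm0_nonneg K.carrier w)
  linarith

/-- The mirrored case by conjugation: the derivative is now spent on the first factor, and the
Laplacian of the test function may sit in the second. -/
theorem norm_integral_star_projL2_sub_le {C : ℝ} (hP : K.Poincare C) {k : ℕ} {w v : Fn}
    (hw : MemH1 K.carrier w) (hv : MemL2 K.carrier v) :
    ‖(∫ x in K.carrier, projL2 K k w x * star (projL2 K k v x)) -
        ∫ x in K.carrier, w x * star (v x)‖ ≤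
      C * K.diam * (semi1 K.carrier w * norm0 K.carrier v) := by
  have hs : ∀ f g : Fn, ∫ x in K.carrier, f x * star (g x) =
      star (∫ x in K.carrier, g x * star (f x)) := fun f g => by
    rw [Complex.star_def, ← integral_conj]
    congr 1; ext x; simp [mul_comm]
  rw [hs (projL2 K k w), hs w, ← star_sub, norm_star, mul_comm (semi1 _ _)]
  exact K.norm_integral_projL2_sub_le hP le_rfl hv hw

/-- The gradient of `p` consists of the constants that the Poincaré inequality assigns to the two
partial derivatives of `v`. -/
theorem exists_semi1_sub_le {C : ℝ} (hC : 0 ≤ C) (hP : K.Poincare C) {v : Fn}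
    (hv : MemH2 K.carrier v) :
    ∃ p ∈ PolyFn 1, semi1 K.carrier (v - p) ≤ C * K.diam * semi2 K.carrier v := by
  choose c hc using fun j => hP _ (hv.2 j)
  have hp := polyFn_affine 0 c
  refine ⟨_, hp, ?_⟩
  set p : Fn := fun x => 0 + ∑ i, c i * (x i : ℂ) with hpdef
  have hp1 := K.memH1_polyFn hp
  have hpd : ∀ j, pd j p = fun _ => c j := by
    intro j
    have h0 : p = (fun _ => 0) + ((c 0 • fun x : Plane => ((x 0 : ℝ) : ℂ)) +
        (c 1 • fun x : Plane => ((x 1 : ℝ) : ℂ))) := by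
      ext x; simp [hpdef, Fin.sum_univ_two]
    have s0 := polyFn_contDiff (polyFn_smul (c 0) (polyFn_coord 0))
    have s1 := polyFn_contDiff (polyFn_smul (c 1) (polyFn_coord 1))
    have s01 := polyFn_contDiff (polyFn_add (polyFn_smul (c 0) (polyFn_coord 0))
      (polyFn_smul (c 1) (polyFn_coord 1)))
    rw [h0, pd_add contDiff_const s01, pd_add s0 s1, pd_smul (contDiff_coord 0),
      pd_smul (contDiff_coord 1), pd_const]
    ext x
    simp only [Pi.add_apply, Pi.smul_apply, pd_coord, smul_eq_mul, Pi.zero_apply]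
    fin_cases j <;> simp
  have hd := K.diam_pos
  refine le_of_sq_le_sq ?_ (mul_nonneg (mul_nonneg hC hd.le) (semi2_nonneg _ _))
  rw [semi1_sq_eq (hv.1.sub hp1), mul_pow, semi2_sq_eq hv, Finset.mul_sum]
  refine Finset.sum_le_sum fun j _ => ?_
  rw [← mul_pow]
  refine pow_le_pow_left₀ (norm0_nonneg _ _) (le_trans (le_of_eq (norm0_congr ?_)) (hc j)) 2
  have h1 := wd_add K.isOpen hv.1 (hp1.smul (-1)) j
  have h2 := wd_smul K.isOpen hp1 (-1) j
  have h3 := wd_of_contDiff K.isOpen K.isBounded (polyFn_contDiff hp) j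
  rw [sub_eq_add_smul v]
  filter_upwards [h1, h2, h3] with x h1 h2 h3
  rw [h1, Pi.add_apply, h2, Pi.smul_apply, h3, hpd]
  simp [sub_eq_add_neg]

theorem semi1_sub_projGrad1_le {g : Fn} (hg : MemH1 K.carrier g) :
    semi1 K.carrier (g - projGrad1 K g) ≤ semi1 K.carrier g := by
  obtain ⟨h1, h2, -⟩ := K.projGrad1_spec hg
  have hp := K.memH1_polyFn h1
  have hr := hg.sub hp
  have h3 : aGrad K.carrier (g - projGrad1 K g) (projGrad1 K g) = 0 := by
    rw [aGrad_sub_left K.isOpen hg hp hp, h2 _ h1, sub_self]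
  have h4 : aGrad K.carrier (g - projGrad1 K g) g =
      aGrad K.carrier (g - projGrad1 K g) (g - projGrad1 K g) := by
    have h5 := aGrad_add_right K.isOpen hr hr hp
    rwa [sub_add_cancel, h3, add_zero] at h5
  have h5 := (Complex.re_le_norm _).trans (norm_aGrad_le hr hg)
  rw [h4, aGrad_self_re, sq] at h5
  by_cases h0 : semi1 K.carrier (g - projGrad1 K g) = 0
  · rw [h0]; exact semi1_nonneg _ _
  · exact le_of_mul_le_mul_left h5 (lt_of_le_of_ne (semi1_nonneg _ _) (Ne.symm h0))

/-- As `Π_1^∇ g` is in `ℙ_2`, the projection of `v` can be dropped. The residual of `g` is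
gradient-orthogonal to `ℙ_1`, so an affine `p` may be subtracted from `v`. The order in `h_K` comes
from the second derivatives of `v`, and `g` needs only `H¹`. -/
theorem norm_aGrad_proj_sub_le {C : ℝ} (hC : 0 ≤ C) (hP : K.Poincare C) {g v : Fn}
    (hg : MemH1 K.carrier g) (hv : MemH2 K.carrier v) :
    ‖aGrad K.carrier (projGrad1 K g) (projGrad2 K v) - aGrad K.carrier g v‖ ≤
      C * K.diam * (semi1 K.carrier g * semi2 K.carrier v) := by
  obtain ⟨h1, h2, -⟩ := K.projGrad1_spec hg
  obtain ⟨k1, k2⟩ := K.projGrad2_spec hv.1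
  obtain ⟨p, hp, hpe⟩ := K.exists_semi1_sub_le hC hP hv
  have hG := K.memH1_polyFn h1
  have hp1 := K.memH1_polyFn hp
  have hr := hg.sub hG
  have e1 : aGrad K.carrier (projGrad1 K g) (projGrad2 K v) =
      aGrad K.carrier (projGrad1 K g) v := by
    rw [aGrad_star, k2 _ (polyFn_mono one_le_two h1), ← aGrad_star]
  have e2 : aGrad K.carrier (g - projGrad1 K g) p = 0 := by
    rw [aGrad_sub_left K.isOpen hg hG hp1, h2 _ hp, sub_self]
  have e3 : aGrad K.carrier g v - aGrad K.carrier (projGrad1 K g) v =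
      aGrad K.carrier (g - projGrad1 K g) (v - p) := by
    rw [← aGrad_sub_left K.isOpen hg hG hv.1]
    have h5 := aGrad_add_right K.isOpen hr (hv.1.sub hp1) hp1
    rwa [sub_add_cancel, e2, add_zero] at h5
  rw [e1, norm_sub_rev, e3]
  refine (norm_aGrad_le hr (hv.1.sub hp1)).trans ?_
  refine (mul_le_mul (K.semi1_sub_projGrad1_le hg) hpe (semi1_nonneg _ _)
    (semi1_nonneg _ _)).trans_eq ?_
  ring

/-- The local error of `b_h`. -/
theorem norm_bhK_sub_le {C : ℝ} (hC : 0 ≤ C) (hP : K.Poincare C) (n : ℝ) {f g v ψ : Fn}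
    (hf : MemH2 K.carrier f) (hg : MemH1 K.carrier g) (hv : MemH2 K.carrier v)
    (hψ : MemH1 K.carrier ψ) :
    ‖bhK K n f g v ψ - bForm K.carrier n f g v ψ‖ ≤
      (‖(n : ℂ) / ((n : ℂ) - 1)‖ + ‖1 / ((n : ℂ) - 1)‖ + 1) * C * K.diam *
        (2 * (semi2 K.carrier f * semi1 K.carrier v) + 2 * (semi1 K.carrier f * semi2 K.carrier v)
          + semi1 K.carrier g * semi2 K.carrier v + norm0 K.carrier f * semi1 K.carrier ψ) := by
  have hd := K.diam_pos
  set α := (n : ℂ) / ((n : ℂ) - 1)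
  set β := 1 / ((n : ℂ) - 1)
  have t1 := K.norm_integral_projL2_sub_le hP (le_refl 2) hf.memL2_wlap hv.1
  have t2 := K.norm_integral_star_projL2_sub_le hP (k := 2) hf.1 hv.memL2_wlap
  have t3 := K.norm_aGrad_proj_sub_le hC hP hg hv
  have t4 := K.norm_integral_projL2_sub_le hP one_le_two hf.1.1 hψ
  have w1 := K.norm0_wlap_le hf
  have w2 := K.norm0_wlap_le hv
  have hCd : 0 ≤ C * K.diam := mul_nonneg hC hd.le
  replace t1 := t1.trans (mul_le_mul_of_nonneg_left
    (mul_le_mul_of_nonneg_right w1 (semi1_nonneg _ _)) hCd)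
  replace t2 := t2.trans (mul_le_mul_of_nonneg_left
    (mul_le_mul_of_nonneg_left w2 (semi1_nonneg _ _)) hCd)
  have hx1 : 0 ≤ C * K.diam * (semi2 K.carrier f * semi1 K.carrier v) :=
    mul_nonneg hCd (mul_nonneg (semi2_nonneg _ _) (semi1_nonneg _ _))
  have hx2 : 0 ≤ C * K.diam * (semi1 K.carrier f * semi2 K.carrier v) :=
    mul_nonneg hCd (mul_nonneg (semi1_nonneg _ _) (semi2_nonneg _ _))
  have hx3 : 0 ≤ C * K.diam * (semi1 K.carrier g * semi2 K.carrier v) :=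
    mul_nonneg hCd (mul_nonneg (semi1_nonneg _ _) (semi2_nonneg _ _))
  have hx4 : 0 ≤ C * K.diam * (norm0 K.carrier f * semi1 K.carrier ψ) :=
    mul_nonneg hCd (mul_nonneg (norm0_nonneg _ _) (semi1_nonneg _ _))
  rw [bhK, bForm]
  -- The rest is arithmetic of complex numbers: the letters `A` stand for projected terms, the
  -- letters `B` for exact ones.
  generalize (∫ x in K.carrier, projL2 K 2 (wlap K.carrier f) x * star (projL2 K 2 v x)) = A1 at *
  generalize (∫ x in K.carrier, projL2 K 2 f x * star (projL2 K 2 (wlap K.carrier v) x)) = A2 at *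
  generalize (∫ x in K.carrier, projL2 K 2 f x * star (projL2 K 1 ψ x)) = A4 at *
  generalize aGrad K.carrier (projGrad1 K g) (projGrad2 K v) = A3 at *
  generalize (∫ x in K.carrier, wlap K.carrier f x * star (v x)) = B1 at *
  generalize (∫ x in K.carrier, f x * star (wlap K.carrier v x)) = B2 at *
  generalize (∫ x in K.carrier, f x * star (ψ x)) = B4 at *
  generalize aGrad K.carrier g v = B3 at *
  have e : α * A1 + β * A2 - A3 + α * A4 - (α * B1 + β * B2 - B3 + α * B4) =
      α * (A1 - B1) + β * (A2 - B2) - (A3 - B3) + α * (A4 - B4) := by ring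
  rw [e]
  have h1 : ‖α * (A1 - B1) + β * (A2 - B2) - (A3 - B3) + α * (A4 - B4)‖ ≤
      ‖α‖ * ‖A1 - B1‖ + ‖β‖ * ‖A2 - B2‖ + ‖A3 - B3‖ + ‖α‖ * ‖A4 - B4‖ := by
    refine (norm_add_le _ _).trans (add_le_add ((norm_sub_le _ _).trans (add_le_add
      ((norm_add_le _ _).trans ?_) le_rfl)) (norm_mul _ _).le)
    rw [norm_mul, norm_mul]
  refine h1.trans ?_
  have ha := norm_nonneg α
  have hb := norm_nonneg β
  have m1 := mul_le_mul_of_nonneg_left t1 ha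
  have m2 := mul_le_mul_of_nonneg_left t2 hb
  have m4 := mul_le_mul_of_nonneg_left t4 ha
  nlinarith [mul_nonneg ha hx1, mul_nonneg ha hx2, mul_nonneg ha hx3, mul_nonneg ha hx4,
    mul_nonneg hb hx1, mul_nonneg hb hx2, mul_nonneg hb hx3, mul_nonneg hb hx4]

/-- Each edge lies on a line, a proper affine subspace of the plane. -/
theorem volume_frontier : volume (frontier K.carrier) = 0 := by
  rw [K.frontier_eq', measure_iUnion_null_iff]
  intro i
  set d := K.poly (finRotate K.N i) - K.poly i
  let L : AffineSubspace ℝ Plane := AffineSubspace.mk' (K.poly i) (Submodule.span ℝ {d})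
  have hL : L ≠ ⊤ := by
    intro h
    have h1 : L.direction = ⊤ := by rw [h, AffineSubspace.direction_top]
    rw [AffineSubspace.direction_mk'] at h1
    have h2 := finrank_span_le_card (R := ℝ) ({d} : Set Plane)
    rw [h1, finrank_top, finrank_euclideanSpace, Fintype.card_fin] at h2
    simp at h2
  refine measure_mono_null ?_ (Measure.addHaar_affineSubspace volume L hL)
  rintro _ ⟨t, -, rfl⟩
  rw [K.edgePt_eq]
  change _ ∈ AffineSubspace.mk' (K.poly i) (Submodule.span ℝ {d})
  rw [AffineSubspace.mem_mk', vsub_eq_sub, add_sub_cancel_left]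
  exact Submodule.smul_mem _ _ (Submodule.mem_span_singleton_self d)

end Element

/-! ### Sums over the elements of a mesh -/

namespace Mesh

variable {Ω : Set Plane} (𝒯 : Mesh Ω)

/-- The closures of the elements cover the domain, so a point in no element lies on one of finitely
many null frontiers. -/
theorem ae_eq_iUnion : Ω =ᵐ[volume] ⋃ k, (𝒯.elt k).carrier := by
  refine EventuallyLE.antisymm ?_ (Set.iUnion_subset 𝒯.subset).eventuallyLE
  rw [ae_le_set]
  refine measure_mono_null (t := ⋃ k, frontier (𝒯.elt k).carrier) ?_
    (measure_iUnion_null fun k => (𝒯.elt k).volume_frontier)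
  rintro x ⟨hx, hx'⟩
  have h := subset_closure hx
  rw [𝒯.cover] at h
  obtain ⟨k, hk⟩ := Set.mem_iUnion.1 h
  refine Set.mem_iUnion.2 ⟨k, hk, fun h => hx' (Set.mem_iUnion.2 ⟨k, interior_subset h⟩)⟩

theorem integral_eq_sum {E : Type*} [NormedAddCommGroup E] [NormedSpace ℝ E] {f : Plane → E}
    (hf : IntegrableOn f Ω) : ∫ x in Ω, f x = ∑ k, ∫ x in (𝒯.elt k).carrier, f x := by
  rw [setIntegral_congr_set 𝒯.ae_eq_iUnion]
  exact integral_iUnion_fintype (fun k => (𝒯.elt k).isOpen.measurableSet)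
    (fun k l h => 𝒯.disjoint k l h) fun k => hf.mono_set (𝒯.subset k)

theorem l2ip_eq_sum {ι : Type} [Fintype ι] {F G : ι → Fn} {F' G' : Fin 𝒯.card → ι → Fn}
    (hF : ∀ i, MemL2 Ω (F i)) (hG : ∀ i, MemL2 Ω (G i))
    (hF' : ∀ k i, F' k i =ᵐ[volume.restrict (𝒯.elt k).carrier] F i)
    (hG' : ∀ k i, G' k i =ᵐ[volume.restrict (𝒯.elt k).carrier] G i) :
    l2ip Ω F G = ∑ k, l2ip (𝒯.elt k).carrier (F' k) (G' k) := by
  rw [l2ip, 𝒯.integral_eq_sum (integrable_finsetSum _ fun i _ => (hF i).integrable_mul_star (hG i))]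
  exact Finset.sum_congr rfl fun k _ => (l2ip_congr (hF' k) (hG' k)).symm

theorem integral_mul_star_eq_sum {v w : Fn} {v' w' : Fin 𝒯.card → Fn}
    (hv : MemL2 Ω v) (hw : MemL2 Ω w)
    (hv' : ∀ k, v' k =ᵐ[volume.restrict (𝒯.elt k).carrier] v)
    (hw' : ∀ k, w' k =ᵐ[volume.restrict (𝒯.elt k).carrier] w) :
    ∫ x in Ω, v x * star (w x) = ∑ k, ∫ x in (𝒯.elt k).carrier, v' k x * star (w' k x) := by
  have := 𝒯.l2ip_eq_sum (F := fun _ : Unit => v) (G := fun _ => w) (F' := fun k _ => v' k)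
    (G' := fun k _ => w' k) (fun _ => hv) (fun _ => hw) (fun k _ => hv' k) fun k _ => hw' k
  simpa [l2ip] using this

theorem aGrad_eq_sum {v w : Fn} (hv : MemH1 Ω v) (hw : MemH1 Ω w) :
    aGrad Ω v w = ∑ k, aGrad (𝒯.elt k).carrier v w :=
  𝒯.l2ip_eq_sum hv.memL2_grad hw.memL2_grad
    (fun k => wd_mono (𝒯.elt k).isOpen (𝒯.subset k) hv)
    fun k => wd_mono (𝒯.elt k).isOpen (𝒯.subset k) hw

theorem aDelta_eq_sum {v w : Fn} (hv : MemH2 Ω v) (hw : MemH2 Ω w) :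
    aDelta Ω v w = ∑ k, aDelta (𝒯.elt k).carrier v w := by
  simp only [aDelta_eq]
  exact 𝒯.l2ip_eq_sum hv.memL2_hessian hw.memL2_hessian
    (fun k p => hess_mono (𝒯.elt k).isOpen (𝒯.subset k) hv p.1 p.2)
    fun k p => hess_mono (𝒯.elt k).isOpen (𝒯.subset k) hw p.1 p.2

theorem semi1_eq_sqrt_sum {v : Fn} (hv : MemH1 Ω v) :
    semi1 Ω v = Real.sqrt (∑ k, semi1 (𝒯.elt k).carrier v ^ 2) := by
  simp only [← aGrad_self_re]
  rw [← Complex.re_sum, ← 𝒯.aGrad_eq_sum hv hv, aGrad_self_re, Real.sqrt_sq (semi1_nonneg _ _)]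

theorem semi2_eq_sqrt_sum {v : Fn} (hv : MemH2 Ω v) :
    semi2 Ω v = Real.sqrt (∑ k, semi2 (𝒯.elt k).carrier v ^ 2) := by
  simp only [← aDelta_self_re]
  rw [← Complex.re_sum, ← 𝒯.aDelta_eq_sum hv hv, aDelta_self_re, Real.sqrt_sq (semi2_nonneg _ _)]

theorem norm0_eq_sqrt_sum {v : Fn} (hv : MemL2 Ω v) :
    norm0 Ω v = Real.sqrt (∑ k, norm0 (𝒯.elt k).carrier v ^ 2) := by
  have h : ∀ U, norm0 U v ^ 2 = (l2ip U (fun _ : Unit => v) fun _ => v).re := fun U =>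
    (l2ip_self_re _).symm
  simp only [h]
  rw [← Complex.re_sum, ← 𝒯.l2ip_eq_sum (F := fun _ : Unit => v) (G := fun _ : Unit => v)
    (fun _ => hv) (fun _ => hv) (fun _ _ => EventuallyEq.rfl) fun _ _ => EventuallyEq.rfl, ← h,
    Real.sqrt_sq (norm0_nonneg _ _)]

theorem wlap_mono (k : Fin 𝒯.card) {v : Fn} (hv : MemH2 Ω v) :
    wlap (𝒯.elt k).carrier v =ᵐ[volume.restrict (𝒯.elt k).carrier] wlap Ω v := by
  filter_upwards [hess_mono (𝒯.elt k).isOpen (𝒯.subset k) hv 0 0,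
    hess_mono (𝒯.elt k).isOpen (𝒯.subset k) hv 1 1] with x h0 h1
  simp only [wlap, Fin.sum_univ_two, h0, h1]

theorem bForm_eq_sum (n : ℝ) {f g v ψ : Fn} (hf : MemH2 Ω f) (hg : MemH1 Ω g) (hv : MemH2 Ω v)
    (hψ : MemH1 Ω ψ) : bForm Ω n f g v ψ = ∑ k, bForm (𝒯.elt k).carrier n f g v ψ := by
  have hr : ∀ w : Fn, ∀ k, w =ᵐ[volume.restrict (𝒯.elt k).carrier] w := fun _ _ => EventuallyEq.rfl
  simp only [bForm, Finset.sum_add_distrib, Finset.sum_sub_distrib, ← Finset.mul_sum]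
  rw [𝒯.integral_mul_star_eq_sum hf.memL2_wlap hv.1.1 (fun k => 𝒯.wlap_mono k hf) (hr v),
    𝒯.integral_mul_star_eq_sum hf.1.1 hv.memL2_wlap (hr f) (fun k => 𝒯.wlap_mono k hv),
    𝒯.aGrad_eq_sum hg hv.1, 𝒯.integral_mul_star_eq_sum hf.1.1 hψ.1 (hr f) (hr ψ)]

theorem diam_le_size (k : Fin 𝒯.card) : (𝒯.elt k).diam ≤ 𝒯.size :=
  le_ciSup (f := fun k => (𝒯.elt k).diam) (Set.finite_range _).bddAbove k

theorem size_nonneg : 0 ≤ 𝒯.size := Real.iSup_nonneg fun k => (𝒯.elt k).diam_pos.le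

/-- The error of `b_h`. -/
theorem norm_bhForm_sub_le {C : ℝ} (hC : 0 ≤ C) (hP : ∀ k, (𝒯.elt k).Poincare C) (n : ℝ)
    {f g v ψ : Fn} (hf : MemH2 Ω f) (hg : MemH1 Ω g) (hv : MemH2 Ω v) (hψ : MemH1 Ω ψ) :
    ‖bhForm 𝒯 n f g v ψ - bForm Ω n f g v ψ‖ ≤
      (‖(n : ℂ) / ((n : ℂ) - 1)‖ + ‖1 / ((n : ℂ) - 1)‖ + 1) * C * 𝒯.size *
        (2 * (semi2 Ω f * semi1 Ω v) + 2 * (semi1 Ω f * semi2 Ω v)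
          + semi1 Ω g * semi2 Ω v + norm0 Ω f * semi1 Ω ψ) := by
  set c := ‖(n : ℂ) / ((n : ℂ) - 1)‖ + ‖1 / ((n : ℂ) - 1)‖ + 1
  have hcC : 0 ≤ c * C := mul_nonneg (by positivity) hC
  rw [𝒯.bForm_eq_sum n hf hg hv hψ, bhForm, ← Finset.sum_sub_distrib]
  refine (norm_sum_le _ _).trans ?_
  have hloc : ∀ k ∈ Finset.univ, ‖bhK (𝒯.elt k) n f g v ψ - bForm (𝒯.elt k).carrier n f g v ψ‖ ≤
      c * C * 𝒯.size * (2 * (semi2 (𝒯.elt k).carrier f * semi1 (𝒯.elt k).carrier v)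
        + 2 * (semi1 (𝒯.elt k).carrier f * semi2 (𝒯.elt k).carrier v)
        + semi1 (𝒯.elt k).carrier g * semi2 (𝒯.elt k).carrier v
        + norm0 (𝒯.elt k).carrier f * semi1 (𝒯.elt k).carrier ψ) := by
    intro k _
    have hK := (𝒯.elt k).isOpen
    have hs := 𝒯.subset k
    refine ((𝒯.elt k).norm_bhK_sub_le hC (hP k) n (hf.mono hK hs) (hg.mono hs) (hv.mono hK hs)
      (hψ.mono hs)).trans ?_
    refine mul_le_mul_of_nonneg_right (mul_le_mul_of_nonneg_left (𝒯.diam_le_size k) hcC) ?_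
    have s1 := semi1_nonneg (𝒯.elt k).carrier
    have s2 := semi2_nonneg (𝒯.elt k).carrier
    exact add_nonneg (add_nonneg (add_nonneg (mul_nonneg zero_le_two (mul_nonneg (s2 f) (s1 v)))
      (mul_nonneg zero_le_two (mul_nonneg (s1 f) (s2 v)))) (mul_nonneg (s1 g) (s2 v)))
      (mul_nonneg (norm0_nonneg _ _) (s1 ψ))
  refine (Finset.sum_le_sum hloc).trans ?_
  rw [← Finset.mul_sum]
  refine mul_le_mul_of_nonneg_left ?_ (mul_nonneg hcC 𝒯.size_nonneg)
  simp only [Finset.sum_add_distrib, ← Finset.mul_sum]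
  -- Cauchy–Schwarz over the elements turns sums of products of local seminorms into products of
  -- global ones.
  rw [𝒯.semi2_eq_sqrt_sum hf, 𝒯.semi1_eq_sqrt_sum hv.1, 𝒯.semi1_eq_sqrt_sum hf.1,
    𝒯.semi2_eq_sqrt_sum hv, 𝒯.semi1_eq_sqrt_sum hg, 𝒯.norm0_eq_sqrt_sum hf.1.1,
    𝒯.semi1_eq_sqrt_sum hψ]
  gcongr <;> exact Real.sum_mul_le_sqrt_mul_sqrt _ _ _

end Mesh

/-! ### An abstract error estimate -/

/-- The Strang estimate for the sum of finitely many stabilized forms. -/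
theorem IsStabilized.sqrt_sum_le {m : ℕ} {S : Fin m → Fn → Prop} {a s : Fin m → Fn → Fn → ℂ}
    {P : Fin m → Fn → Fn} {c₀ c₁ : ℝ} (h : ∀ k, IsStabilized (S k) (a k) (s k) (P k) c₀ c₁)
    {uh uI : Fn} (huh : ∀ k, S k uh) (huI : ∀ k, S k uI) {p : Fin m → Fn} (hp : ∀ k, S k (p k))
    (hPp : ∀ k, P k (p k) = p k) {au : Fin m → ℂ} {ρ η : Fin m → ℝ} {E : ℝ} (hE : 0 ≤ E)
    (hρ : ∀ k, ‖a k (p k) (uh - uI) - au k‖ ≤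
      ρ k * Real.sqrt (a k (uh - uI) (uh - uI)).re)
    (hη : ∀ k, Real.sqrt (a k (uI - p k) (uI - p k)).re ≤ η k + ρ k)
    (hres : ‖∑ k, form (a k) (s k) (P k) uh (uh - uI) - ∑ k, au k‖ ≤
      E * Real.sqrt (∑ k, (a k (uh - uI) (uh - uI)).re)) :
    min 1 c₀ * Real.sqrt (∑ k, (a k (uh - uI) (uh - uI)).re) ≤
      E + max 1 c₁ * Real.sqrt (∑ k, η k ^ 2) + (max 1 c₁ + 1) * Real.sqrt (∑ k, ρ k ^ 2) := by
  -- The exact solution need not lie in the local spaces. It is present only through the numbers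
  -- `au`, standing for the exact form at `δ`, and through `ρ` and `η`, its distances to `p` and to
  -- `uI`.
  set δ := uh - uI with hδ
  have hSδ : ∀ k, S k δ := fun k => (h k).sub_mem (huh k) (huI k)
  set M := max 1 c₁ with hM
  have hM0 : 0 ≤ M := zero_le_one.trans (le_max_left _ _)
  set r : Fin m → ℝ := fun k => Real.sqrt (a k δ δ).re with hr
  have hr0 : ∀ k, 0 ≤ r k := fun k => Real.sqrt_nonneg _
  have hr2 : ∀ k, r k ^ 2 = (a k δ δ).re := fun k => Real.sq_sqrt ((h k).a_nonneg δ (hSδ k))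
  simp only [← hr2] at hres ⊢
  set D := Real.sqrt (∑ k, r k ^ 2) with hD
  have hD0 : 0 ≤ D := Real.sqrt_nonneg _
  have hD2 : D * D = ∑ k, r k ^ 2 :=
    Real.mul_self_sqrt (Finset.sum_nonneg fun k _ => sq_nonneg _)
  have hpk : ∀ k, form (a k) (s k) (P k) uI δ =
      form (a k) (s k) (P k) (uI - p k) δ + a k (p k) δ := fun k => by
    rw [(h k).form_sub (huI k) (hp k) (hSδ k),
      (h k).form_eq_of_proj_eq (hp k) (hPp k) (hSδ k), sub_add_cancel]
  -- The core of the Strang argument: by consistency the discrete form at `p` is the exact one, so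
  -- the exact solution can be inserted and removed.
  have hsplit : ∑ k, form (a k) (s k) (P k) δ δ =
      (∑ k, form (a k) (s k) (P k) uh δ - ∑ k, au k)
        - ∑ k, (form (a k) (s k) (P k) (uI - p k) δ + (a k (p k) δ - au k)) := by
    rw [← Finset.sum_sub_distrib, ← Finset.sum_sub_distrib]
    refine Finset.sum_congr rfl fun k _ => ?_
    rw [show form (a k) (s k) (P k) δ δ = form (a k) (s k) (P k) uh δ -
      form (a k) (s k) (P k) uI δ from (h k).form_sub (huh k) (huI k) (hSδ k), hpk k]
    ring
  have hlow : min 1 c₀ * (D * D) ≤ ‖∑ k, form (a k) (s k) (P k) δ δ‖ := by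
    refine le_trans ?_ (Complex.re_le_norm _)
    rw [hD2, Finset.mul_sum, Complex.re_sum]
    exact Finset.sum_le_sum fun k _ => by rw [hr2]; exact (h k).min_mul_le_form (hSδ k)
  have hup : ‖∑ k, (form (a k) (s k) (P k) (uI - p k) δ + (a k (p k) δ - au k))‖ ≤
      (M * Real.sqrt (∑ k, η k ^ 2) + (M + 1) * Real.sqrt (∑ k, ρ k ^ 2)) * D := by
    refine (norm_sum_le _ _).trans ?_
    have h1 : ∀ k ∈ Finset.univ, ‖form (a k) (s k) (P k) (uI - p k) δ + (a k (p k) δ - au k)‖ ≤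
        M * (η k * r k) + (M + 1) * (ρ k * r k) := fun k _ => by
      refine (norm_add_le _ _).trans ?_
      have h2 := (h k).norm_form_le ((h k).sub_mem (huI k) (hp k)) (hSδ k)
      have h3 := mul_le_mul_of_nonneg_left (mul_le_mul_of_nonneg_right (hη k) (hr0 k)) hM0
      have h4 := hρ k
      linarith
    refine (Finset.sum_le_sum h1).trans ?_
    rw [Finset.sum_add_distrib, ← Finset.mul_sum, ← Finset.mul_sum]
    have h2 := mul_le_mul_of_nonneg_left (Real.sum_mul_le_sqrt_mul_sqrt Finset.univ η r) hM0
    have h3 := mul_le_mul_of_nonneg_left (Real.sum_mul_le_sqrt_mul_sqrt Finset.univ ρ r)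
      (add_nonneg hM0 zero_le_one)
    linarith
  have hmain : min 1 c₀ * (D * D) ≤ (E + (M * Real.sqrt (∑ k, η k ^ 2) +
      (M + 1) * Real.sqrt (∑ k, ρ k ^ 2))) * D := by
    rw [hsplit] at hlow
    refine hlow.trans ((norm_sub_le _ _).trans ?_)
    rw [add_mul]
    exact add_le_add hres hup
  -- The bound is quadratic in `D` on the left and linear on the right; one factor is cancelled
  -- unless `D` vanishes.
  rcases hD0.eq_or_lt with h0 | h0
  · rw [← h0, mul_zero]
    have := Real.sqrt_nonneg (∑ k, η k ^ 2)
    have := Real.sqrt_nonneg (∑ k, ρ k ^ 2)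
    positivity
  · rw [← mul_assoc] at hmain
    linarith [le_of_mul_le_mul_right hmain h0]

/-! ### Norm equivalences -/

theorem norm1_le_mul_semi1 {U : Set Plane} (hU : IsOpen U) {R : ℝ} (hR0 : 0 ≤ R)
    (hR : U ⊆ Metric.closedBall 0 R) {v : Fn} (hv : MemH01 U v) :
    norm1 U v ≤ (1 + 2 * R) * semi1 U v := by
  have h0 := norm0_le_mul_semi1 hU hR0 hR hv
  have h1 := semi1_nonneg U v
  have h2 := norm0_nonneg U v
  refine le_trans (b := norm0 U v + semi1 U v) (le_of_sq_le_sq ?_ (add_nonneg h2 h1)) (by linarith)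
  rw [norm1_sq]
  nlinarith [mul_nonneg h1 h2]

theorem norm2_le_mul_semi2 {U : Set Plane} (hU : IsOpen U) {R : ℝ} (hR0 : 0 ≤ R)
    (hR : U ⊆ Metric.closedBall 0 R) {v : Fn} (hv : MemH02 U v) :
    norm2 U v ≤ (1 + 2 * R + 4 * R ^ 2) * semi2 U v := by
  have h0 := norm0_le_mul_semi1 hU hR0 hR hv.memH01
  have h1 := semi1_le_mul_semi2 hU hR0 hR hv
  have h2 := mul_le_mul_of_nonneg_left h1 (mul_nonneg zero_le_two hR0)
  have n0 := norm0_nonneg U v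
  have n1 := semi1_nonneg U v
  have n2 := semi2_nonneg U v
  refine le_trans (b := norm0 U v + semi1 U v + semi2 U v)
    (le_of_sq_le_sq ?_ (add_nonneg (add_nonneg n0 n1) n2)) (by linarith)
  rw [norm2_sq]
  nlinarith [mul_nonneg n0 n1, mul_nonneg n0 n2, mul_nonneg n1 n2]

theorem norm2_le_prodNorm (U : Set Plane) (v ψ : Fn) : norm2 U v ≤ prodNorm U v ψ :=
  Real.le_sqrt_of_sq_le (le_add_of_nonneg_right (sq_nonneg _))

theorem norm1_le_prodNorm (U : Set Plane) (v ψ : Fn) : norm1 U ψ ≤ prodNorm U v ψ :=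
  Real.le_sqrt_of_sq_le (le_add_of_nonneg_left (sq_nonneg _))

theorem prodNorm_le (U : Set Plane) (v ψ : Fn) : prodNorm U v ψ ≤ norm2 U v + norm1 U ψ := by
  have h2 := norm2_nonneg U v
  have h1 := norm1_nonneg U ψ
  refine Real.sqrt_le_iff.2 ⟨add_nonneg h2 h1, ?_⟩
  nlinarith [mul_nonneg h2 h1]

theorem MemH01.sub {U : Set Plane} (hU : IsOpen U) (hb : Bornology.IsBounded U) {v w : Fn}
    (hv : MemH01 U v) (hw : MemH01 U w) : MemH01 U (v - w) := by
  rw [sub_eq_add_smul]; exact hv.add hU hb (hw.smul hU hb _)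

theorem MemH02.sub {U : Set Plane} (hU : IsOpen U) (hb : Bornology.IsBounded U) {v w : Fn}
    (hv : MemH02 U v) (hw : MemH02 U w) : MemH02 U (v - w) := by
  rw [sub_eq_add_smul]; exact hv.add hU hb (hw.smul hU hb _)

/-! ### The global virtual element spaces -/

section global

variable {Ω : Set Plane} {𝒯 : Mesh Ω}

theorem MemW.smul (hΩ : IsOpen Ω) (hb : Bornology.IsBounded Ω) {v : Fn} (c : ℂ)
    (hv : MemW 𝒯 v) : MemW 𝒯 (c • v) :=
  ⟨hv.1.smul hΩ hb c, fun k => (hv.2 k).smul c⟩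

theorem MemW.sub (hΩ : IsOpen Ω) (hb : Bornology.IsBounded Ω) {v w : Fn} (hv : MemW 𝒯 v)
    (hw : MemW 𝒯 w) : MemW 𝒯 (v - w) := by
  refine ⟨hv.1.sub hΩ hb hw.1, fun k => ?_⟩
  rw [sub_eq_add_smul]
  exact (hv.2 k).add ((hw.2 k).smul _)

theorem MemV.smul (hΩ : IsOpen Ω) (hb : Bornology.IsBounded Ω) {v : Fn} (c : ℂ)
    (hv : MemV 𝒯 v) : MemV 𝒯 (c • v) :=
  ⟨hv.1.smul hΩ hb c, fun k => (hv.2 k).smul c⟩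

theorem MemV.sub (hΩ : IsOpen Ω) (hb : Bornology.IsBounded Ω) {v w : Fn} (hv : MemV 𝒯 v)
    (hw : MemV 𝒯 w) : MemV 𝒯 (v - w) := by
  refine ⟨hv.1.sub hΩ hb hw.1, fun k => ?_⟩
  rw [sub_eq_add_smul]
  exact (hv.2 k).add ((hw.2 k).smul _)

/-! ### Consistency errors -/

variable {n c₀ c₁ c₂ c₃ C R : ℝ} {sΔ sG : Fin 𝒯.card → Fn → Fn → ℂ} {f g u φ uh φh : Fn}

/-- Testing with `(δ, 0)` isolates the fourth-order equation. Dividing out the common factor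
`1/(n-1)` costs `|n - 1|`, whatever the sign. In `4 R + 3`, the term `4 R` stems from the Friedrichs
bound on `|δ|₁` and 3 from the terms already containing `|δ|₂`. -/
theorem norm_sum_ahDelta_sub_le (hΩ : IsOpen Ω) (hR0 : 0 ≤ R) (hR : Ω ⊆ Metric.closedBall 0 R)
    (hC : 0 ≤ C) (hP : ∀ k, (𝒯.elt k).Poincare C) (hn : n ≠ 1)
    (hsG : ∀ k, IsStabGrad (𝒯.elt k) c₂ c₃ (sG k)) (hf : MemH02 Ω f) (hg : MemH01 Ω g)
    (hT : IsT Ω n f g u φ) (hTh : IsTh 𝒯 n sΔ sG f g uh φh) {δ : Fn} (hδ : MemW 𝒯 δ) :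
    ‖∑ k, ahDelta (𝒯.elt k) (sΔ k) uh δ - aDelta Ω u δ‖ ≤
      |n - 1| * ((‖(n : ℂ) / ((n : ℂ) - 1)‖ + ‖1 / ((n : ℂ) - 1)‖ + 1) * C * (4 * R + 3)) *
        (𝒯.size * prodNorm Ω f g) * semi2 Ω δ := by
  have hb : Bornology.IsBounded Ω := Metric.isBounded_closedBall.subset hR
  have hn' : (n : ℂ) - 1 ≠ 0 := by
    rw [sub_ne_zero]; exact_mod_cast hn
  -- The zero test function is a multiple of `φh`, so its membership and the vanishing of every form
  -- at it follow from homogeneity.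
  have hψ : MemV 𝒯 ((0 : ℂ) • φh) := hTh.2.1.smul hΩ hb 0
  have h1 := hT.2.2 δ _ hδ.1 hψ.1
  have h2 := hTh.2.2 δ _ hδ hψ
  have h3 := 𝒯.norm_bhForm_sub_le hC hP n hf.1 hg.1 hδ.1.1 hψ.1.1
  rw [← h1, ← h2, aForm, aGrad_smul_right hΩ hTh.2.1.1.1, star_zero, zero_mul, add_zero,
    semi1_smul hΩ hTh.2.1.1.1, norm_zero, zero_mul, mul_zero, add_zero, ahForm] at h3
  have h4 : ∀ k, ahGrad (𝒯.elt k) (sG k) φh ((0 : ℂ) • φh) = 0 := fun k => by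
    have := (hsG k).isStabilized.form_smul_right 0 (hTh.2.1.2 k) (hTh.2.1.2 k)
    rwa [star_zero, zero_mul] at this
  simp only [h4, add_zero] at h3
  rw [← Finset.mul_sum, ← mul_sub, norm_mul] at h3
  have h5 : ‖1 / ((n : ℂ) - 1)‖ * |n - 1| = 1 := by
    rw [← Real.norm_eq_abs, ← Complex.norm_real, Complex.ofReal_sub, Complex.ofReal_one, ← norm_mul,
      one_div_mul_cancel hn', norm_one]
  set c := ‖(n : ℂ) / ((n : ℂ) - 1)‖ + ‖1 / ((n : ℂ) - 1)‖ + 1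
  have hc : 0 ≤ c * C * 𝒯.size := mul_nonneg (mul_nonneg (by positivity) hC) 𝒯.size_nonneg
  have n1 := norm2_le_prodNorm Ω f g
  have n2 := norm1_le_prodNorm Ω f g
  have hN : 0 ≤ prodNorm Ω f g := Real.sqrt_nonneg _
  have f2 := (semi2_le_norm2 Ω f).trans n1
  have f1 := ((semi1_le_norm1 Ω f).trans (norm1_le_norm2 Ω f)).trans n1
  have g1 := (semi1_le_norm1 Ω g).trans n2
  have d1 := semi1_le_mul_semi2 hΩ hR0 hR hδ.1
  have d2 := semi2_nonneg Ω δ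
  have m1 := mul_le_mul f2 d1 (semi1_nonneg _ _) hN
  have m2 := mul_le_mul_of_nonneg_right f1 d2
  have m3 := mul_le_mul_of_nonneg_right g1 d2
  have h6 := mul_le_mul_of_nonneg_left (h3.trans (mul_le_mul_of_nonneg_left
    (show 2 * (semi2 Ω f * semi1 Ω δ) + 2 * (semi1 Ω f * semi2 Ω δ) + semi1 Ω g * semi2 Ω δ ≤
      prodNorm Ω f g * (4 * R + 3) * semi2 Ω δ by linarith) hc)) (abs_nonneg (n - 1))
  rw [← mul_assoc, mul_comm |n - 1|, h5, one_mul] at h6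
  refine h6.trans_eq ?_
  ring

/-- Testing with `(0, δ)` leaves in the error of `b_h` only the term pairing `f` with `δ`. -/
theorem norm_sum_ahGrad_sub_le (hΩ : IsOpen Ω) (hb : Bornology.IsBounded Ω)
    (hC : 0 ≤ C) (hP : ∀ k, (𝒯.elt k).Poincare C)
    (hsΔ : ∀ k, IsStabDelta (𝒯.elt k) c₀ c₁ (sΔ k)) (hf : MemH02 Ω f) (hg : MemH01 Ω g)
    (hT : IsT Ω n f g u φ) (hTh : IsTh 𝒯 n sΔ sG f g uh φh) {δ : Fn} (hδ : MemV 𝒯 δ) :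
    ‖∑ k, ahGrad (𝒯.elt k) (sG k) φh δ - aGrad Ω φ δ‖ ≤
      ((‖(n : ℂ) / ((n : ℂ) - 1)‖ + ‖1 / ((n : ℂ) - 1)‖ + 1) * C) *
        (𝒯.size * prodNorm Ω f g) * semi1 Ω δ := by
  have hv : MemW 𝒯 ((0 : ℂ) • uh) := hTh.1.smul hΩ hb 0
  have h1 := hT.2.2 _ δ hv.1 hδ.1
  have h2 := hTh.2.2 _ δ hv hδ
  have h3 := 𝒯.norm_bhForm_sub_le hC hP n hf.1 hg.1 hv.1.1 hδ.1.1
  rw [← h1, ← h2, aForm, aDelta_smul_right hΩ hTh.1.1.1, star_zero, zero_mul, mul_zero, zero_add,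
    semi1_smul hΩ hTh.1.1.1.1, semi2_smul hΩ hTh.1.1.1, norm_zero, zero_mul, zero_mul, mul_zero,
    mul_zero, mul_zero, mul_zero, mul_zero, add_zero, add_zero, zero_add, ahForm] at h3
  have h4 : ∀ k, ahDelta (𝒯.elt k) (sΔ k) uh ((0 : ℂ) • uh) = 0 := fun k => by
    have := (hsΔ k).isStabilized.form_smul_right 0 (hTh.1.2 k) (hTh.1.2 k)
    rwa [star_zero, zero_mul] at this
  simp only [h4, mul_zero, zero_add] at h3
  set c := ‖(n : ℂ) / ((n : ℂ) - 1)‖ + ‖1 / ((n : ℂ) - 1)‖ + 1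
  have hc : 0 ≤ c * C * 𝒯.size := mul_nonneg (mul_nonneg (by positivity) hC) 𝒯.size_nonneg
  have f0 := ((norm0_le_norm1 Ω f).trans (norm1_le_norm2 Ω f)).trans (norm2_le_prodNorm Ω f g)
  refine (h3.trans (mul_le_mul_of_nonneg_left
    (mul_le_mul_of_nonneg_right f0 (semi1_nonneg Ω δ)) hc)).trans_eq ?_
  ring

/-! ### Discrete errors -/

variable {uI uπ φI φπ : Fn}

theorem min_mul_semi2_sub_le (hΩ : IsOpen Ω) (hb : Bornology.IsBounded Ω)
    (hsΔ : ∀ k, IsStabDelta (𝒯.elt k) c₀ c₁ (sΔ k)) (hu : MemH2 Ω u) (huh : MemW 𝒯 uh)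
    (huI : MemW 𝒯 uI) (huπ : PiecewisePoly 𝒯 2 uπ) {E : ℝ} (hE : 0 ≤ E)
    (hres : ‖∑ k, ahDelta (𝒯.elt k) (sΔ k) uh (uh - uI) - aDelta Ω u (uh - uI)‖ ≤
      E * semi2 Ω (uh - uI)) :
    min 1 c₀ * semi2 Ω (uh - uI) ≤
      E + max 1 c₁ * semi2 Ω (u - uI) + (max 1 c₁ + 1) * broken2 𝒯 (u - uπ) := by
  choose p hp hpe using huπ
  have hδ := (huh.sub hΩ hb huI).1.1
  have hK : ∀ k {v : Fn}, MemH2 Ω v → MemH2 (𝒯.elt k).carrier v := fun k _ hv =>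
    hv.mono (𝒯.elt k).isOpen (𝒯.subset k)
  have hpm : ∀ k, MemH2 (𝒯.elt k).carrier (p k) := fun k => (𝒯.elt k).memH2_polyFn (hp k)
  -- The piecewise function equals its polynomial only almost everywhere on each element, which the
  -- seminorm does not notice.
  have hpi : ∀ k, semi2 (𝒯.elt k).carrier (u - p k) = semi2 (𝒯.elt k).carrier (u - uπ) := fun k =>
    semi2_congr (𝒯.elt k).isOpen ((hK k hu).sub (𝒯.elt k).isOpen (hpm k)) <| by
      filter_upwards [hpe k] with x hx
      rw [Pi.sub_apply, Pi.sub_apply, hx]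
  have key := IsStabilized.sqrt_sum_le (fun k => (hsΔ k).isStabilized) huh.2 huI.2
    (fun k => memWK_polyFn (𝒯.elt k) (hp k)) (fun k => projDelta_polyFn (hp k))
    (au := fun k => aDelta (𝒯.elt k).carrier u (uh - uI))
    (ρ := fun k => semi2 (𝒯.elt k).carrier (u - uπ))
    (η := fun k => semi2 (𝒯.elt k).carrier (u - uI)) hE
  simp only [aDelta_self_re, Real.sqrt_sq (semi2_nonneg _ _), ← 𝒯.semi2_eq_sqrt_sum hδ,
    ← 𝒯.semi2_eq_sqrt_sum (hu.sub hΩ huI.1.1), ← 𝒯.aDelta_eq_sum hu hδ] at key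
  refine key (fun k => ?_) (fun k => ?_) hres
  · rw [norm_sub_rev, ← aDelta_sub_left (𝒯.elt k).isOpen (hK k hu) (hpm k) (hK k hδ), ← hpi]
    exact norm_aDelta_le ((hK k hu).sub (𝒯.elt k).isOpen (hpm k)) (hK k hδ)
  · have h := semi2_sub_le (𝒯.elt k).isOpen ((hK k hu).sub (𝒯.elt k).isOpen (hpm k))
      ((hK k hu).sub (𝒯.elt k).isOpen (hK k huI.1.1))
    rw [sub_sub_sub_cancel_left, hpi, add_comm] at h
    exact h

theorem min_mul_semi1_sub_le (hΩ : IsOpen Ω) (hb : Bornology.IsBounded Ω)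
    (hsG : ∀ k, IsStabGrad (𝒯.elt k) c₂ c₃ (sG k)) (hφ : MemH1 Ω φ) (hφh : MemV 𝒯 φh)
    (hφI : MemV 𝒯 φI) (hφπ : PiecewisePoly 𝒯 1 φπ) {E : ℝ} (hE : 0 ≤ E)
    (hres : ‖∑ k, ahGrad (𝒯.elt k) (sG k) φh (φh - φI) - aGrad Ω φ (φh - φI)‖ ≤
      E * semi1 Ω (φh - φI)) :
    min 1 c₂ * semi1 Ω (φh - φI) ≤
      E + max 1 c₃ * semi1 Ω (φ - φI) + (max 1 c₃ + 1) * broken1 𝒯 (φ - φπ) := by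
  choose p hp hpe using hφπ
  have hδ := (hφh.sub hΩ hb hφI).1.1
  have hK : ∀ k {v : Fn}, MemH1 Ω v → MemH1 (𝒯.elt k).carrier v := fun k _ hv =>
    hv.mono (𝒯.subset k)
  have hpm : ∀ k, MemH1 (𝒯.elt k).carrier (p k) := fun k => (𝒯.elt k).memH1_polyFn (hp k)
  have hpi : ∀ k, semi1 (𝒯.elt k).carrier (φ - p k) = semi1 (𝒯.elt k).carrier (φ - φπ) := fun k =>
    semi1_congr (𝒯.elt k).isOpen ((hK k hφ).sub (hpm k)) <| by
      filter_upwards [hpe k] with x hx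
      rw [Pi.sub_apply, Pi.sub_apply, hx]
  have key := IsStabilized.sqrt_sum_le (fun k => (hsG k).isStabilized) hφh.2 hφI.2
    (fun k => memVK_polyFn (𝒯.elt k) (hp k)) (fun k => projGrad1_polyFn (hp k))
    (au := fun k => aGrad (𝒯.elt k).carrier φ (φh - φI))
    (ρ := fun k => semi1 (𝒯.elt k).carrier (φ - φπ))
    (η := fun k => semi1 (𝒯.elt k).carrier (φ - φI)) hE
  simp only [aGrad_self_re, Real.sqrt_sq (semi1_nonneg _ _), ← 𝒯.semi1_eq_sqrt_sum hδ,
    ← 𝒯.semi1_eq_sqrt_sum (hφ.sub hφI.1.1), ← 𝒯.aGrad_eq_sum hφ hδ] at key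
  refine key (fun k => ?_) (fun k => ?_) hres
  · rw [norm_sub_rev, ← aGrad_sub_left (𝒯.elt k).isOpen (hK k hφ) (hpm k) (hK k hδ), ← hpi]
    exact norm_aGrad_le ((hK k hφ).sub (hpm k)) (hK k hδ)
  · have h := semi1_sub_le (𝒯.elt k).isOpen ((hK k hφ).sub (hpm k))
      ((hK k hφ).sub (hK k hφI.1.1))
    rw [sub_sub_sub_cancel_left, hpi, add_comm] at h
    exact h

end global

end

end TransmissionVEM

/-! ### The error estimate -/

theorem mainTheorem4
    (Ω : Set Plane) (hΩ : IsPolygonalDomain Ω)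
    (n : ℝ) (hn : n ≠ 1)
    (CT : ℝ) (hCT : 0 < CT)
    (c₀ c₁ c₂ c₃ : ℝ) (hc₀ : 0 < c₀) (hc₁ : 0 < c₁) (hc₂ : 0 < c₂) (hc₃ : 0 < c₃) :
    ∃ C : ℝ, 0 < C ∧
      ∀ 𝒯 : Mesh Ω, 𝒯.Regular CT →
      ∀ sΔ sG : Fin 𝒯.card → Fn → Fn → ℂ,
        (∀ k, IsStabDelta (𝒯.elt k) c₀ c₁ (sΔ k)) →
        (∀ k, IsStabGrad (𝒯.elt k) c₂ c₃ (sG k)) →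
      ∀ f g : Fn, MemH02 Ω f → MemH01 Ω g →
      ∀ u φ uh φh : Fn, IsT Ω n f g u φ → IsTh 𝒯 n sΔ sG f g uh φh →
      ∀ uI φI : Fn, MemW 𝒯 uI → MemV 𝒯 φI →
      ∀ uπ φπ : Fn, PiecewisePoly 𝒯 2 uπ → PiecewisePoly 𝒯 1 φπ →
        prodNorm Ω (u - uh) (φ - φh) ≤
          C * (𝒯.size * prodNorm Ω f g
            + semi2 Ω (u - uI) + broken2 𝒯 (u - uπ)
            + semi1 Ω (φ - φI) + broken1 𝒯 (φ - φπ)) := by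
  obtain ⟨hO, -, hb, -⟩ := hΩ
  obtain ⟨R', hR'⟩ := hb.subset_closedBall (0 : Plane)
  set R := max R' 0
  have hR0 : 0 ≤ R := le_max_right _ _
  have hR : Ω ⊆ Metric.closedBall 0 R :=
    hR'.trans (Metric.closedBall_subset_closedBall (le_max_left _ _))
  set cP := Real.sqrt (4 * (1 + (1 / CT) ^ 2))
  have hcP : 0 ≤ cP := Real.sqrt_nonneg _
  set c := ‖(n : ℂ) / ((n : ℂ) - 1)‖ + ‖1 / ((n : ℂ) - 1)‖ + 1
  have hc : 0 ≤ c := by positivity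
  set E₂ := |n - 1| * (c * cP * (4 * R + 3))
  have hE₂ : 0 ≤ E₂ := by positivity
  set E₁ := c * cP
  have hE₁ : 0 ≤ E₁ := by positivity
  have hμ₂ : 0 < min 1 c₀ := lt_min one_pos hc₀
  have hμ₁ : 0 < min 1 c₂ := lt_min one_pos hc₂
  have hM₂ : 0 ≤ max 1 c₁ := zero_le_one.trans (le_max_left _ _)
  have hM₁ : 0 ≤ max 1 c₃ := zero_le_one.trans (le_max_left _ _)
  -- One constant dominates the three coefficients of the Strang bound; it serves both components.
  have hcomb : ∀ μ E M D H x y : ℝ, 0 < μ → 0 ≤ E → 0 ≤ M → 0 ≤ H → 0 ≤ x → 0 ≤ y →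
      μ * D ≤ E * H + M * x + (M + 1) * y → D ≤ (E + M + 1) / μ * (H + x + y) := by
    intro μ E M D H x y hμ hE hM hH hx hy h
    rw [div_mul_eq_mul_div, le_div_iff₀ hμ, mul_comm D]
    refine h.trans ?_
    nlinarith [mul_nonneg hE hx, mul_nonneg hE hy, mul_nonneg hM hH]
  set L₂ := (E₂ + max 1 c₁ + 1) / min 1 c₀
  have hL₂ : 0 ≤ L₂ := div_nonneg (by positivity) hμ₂.le
  set L₁ := (E₁ + max 1 c₃ + 1) / min 1 c₂
  have hL₁ : 0 ≤ L₁ := div_nonneg (by positivity) hμ₁.le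
  -- For each component: the Friedrichs constant times 1 for the interpolation error plus `L` for
  -- the discrete error. Everything here is fixed before a mesh is chosen.
  refine ⟨(1 + 2 * R + 4 * R ^ 2) * (1 + L₂) + (1 + 2 * R) * (1 + L₁), by positivity, ?_⟩
  intro 𝒯 hreg sΔ sG hsΔ hsG f g hf hg u φ uh φh hT hTh uI φI huI hφI uπ φπ huπ hφπ
  have hP : ∀ k, (𝒯.elt k).Poincare cP := fun k =>
    (𝒯.elt k).poincare_of_starConvex hCT (hreg k).2
  have hH : 0 ≤ 𝒯.size * prodNorm Ω f g := mul_nonneg 𝒯.size_nonneg (Real.sqrt_nonneg _)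
  have r₂ := norm_sum_ahDelta_sub_le hO hR0 hR hcP hP hn hsG hf hg hT hTh
    (hTh.1.sub hO hb huI)
  have r₁ := norm_sum_ahGrad_sub_le hO hb hcP hP hsΔ hf hg hT hTh (hTh.2.1.sub hO hb hφI)
  have x0 := semi2_nonneg Ω (u - uI)
  have y0 : 0 ≤ broken2 𝒯 (u - uπ) := Real.sqrt_nonneg _
  have z0 := semi1_nonneg Ω (φ - φI)
  have w0 : 0 ≤ broken1 𝒯 (φ - φπ) := Real.sqrt_nonneg _
  have d₂ : semi2 Ω (uh - uI) ≤ L₂ * (𝒯.size * prodNorm Ω f g + semi2 Ω (u - uI) +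
      broken2 𝒯 (u - uπ)) := hcomb _ _ _ _ _ _ _ hμ₂ hE₂ hM₂ hH x0 y0
    (min_mul_semi2_sub_le hO hb hsΔ hT.1.1 hTh.1 huI huπ (mul_nonneg hE₂ hH) r₂)
  have d₁ : semi1 Ω (φh - φI) ≤ L₁ * (𝒯.size * prodNorm Ω f g + semi1 Ω (φ - φI) +
      broken1 𝒯 (φ - φπ)) := hcomb _ _ _ _ _ _ _ hμ₁ hE₁ hM₁ hH z0 w0
    (min_mul_semi1_sub_le hO hb hsG hT.2.1.1 hTh.2.1 hφI hφπ (mul_nonneg hE₁ hH) r₁)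
  -- The error is split as `(u - uI) - (uh - uI)`, and likewise for the second component.
  have t₂ := semi2_sub_le hO (hT.1.1.sub hO huI.1.1) (hTh.1.1.1.sub hO huI.1.1)
  have t₁ := semi1_sub_le hO (hT.2.1.1.sub hφI.1.1) (hTh.2.1.1.1.sub hφI.1.1)
  rw [sub_sub_sub_cancel_right] at t₂ t₁
  have e₂ := norm2_le_mul_semi2 hO hR0 hR (hT.1.sub hO hb hTh.1.1)
  have e₁ := norm1_le_mul_semi1 hO hR0 hR (hT.2.1.sub hO hb hTh.2.1.1)
  refine (prodNorm_le _ _ _).trans ((add_le_add e₂ e₁).trans ?_)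
  rw [add_mul (_ * (1 + L₂)), mul_assoc (1 + 2 * R + 4 * R ^ 2), mul_assoc (1 + 2 * R)]
  refine add_le_add (mul_le_mul_of_nonneg_left ?_ (by positivity))
    (mul_le_mul_of_nonneg_left ?_ (by positivity))
  · nlinarith [mul_nonneg hL₂ z0, mul_nonneg hL₂ w0]
  · nlinarith [mul_nonneg hL₁ x0, mul_nonneg hL₁ y0]
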